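/- **Formulas.** Fix sets of variables, atomic propositions and actions. Formulas in positive form are $\phi ::= Z \mid P \mid \neg P \mid \mathtt{tt} \mid \mathtt{ff} \mid \phi\wedge\phi \mid \phi\vee\phi \mid [a]\phi \mid \langle a\rangle\phi \mid \mu Z.\phi \mid \nu Z.\phi$, interpreted as usual as sets of states of labelled transition systems with an interpretation of the atomic propositions ($\mu$, $\nu$ being least and greatest fixpoints). A formula is *valid* ($\models\phi$) if it holds at every state of every structure under every valuation of the variables. It is in *positive normal form* if distinct fixpoint occurrences bind distinct variables, and *guarded* if for each subformula $\sigma Z.\phi$ ($\sigma\in\{\mu,\nu\}$) every occurrence of $Z$ in $\phi$ is in the scope of a modal operator $[a]$ or $\langle a\rangle$ inside $\phi$. **Names.** Let $\gamma$ be a closed guarded formula in positive normal form, $l$ its length (number of symbols), and $X_1,\dots,X_m$ a linear ordering of its bound variables such that $Y$ precedes $Z$ whenever $\sigma_1 Z.\psi$ is a proper subformula of a subformula $\sigma_2Y.\phi$ of $\gamma$. Each $\nu$-bound variable $Z$ has names $z_1,\dots,z_l$. A *sequent* $w\vdash\Gamma$ consists of a sequence $w$ of distinct names and a set $\Gamma$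 of formulas $\phi^u$ annotated with subsequences $u$ of $w$. Here $\Gamma,\Delta$ stands for $\Gamma\cup\Delta$. Write $u\restriction X_i$ for $u$ with all names of $X_{i+1},\dots,X_m$ removed; $u<_wv$ if for some $j$, $u(i)=v(i)$ for all $i<j$, and $u(j),v(j)$ are names of the same variable with $u(j)$ before $v(j)$ in $w$; and $u\sqsubset_wv$ if $u<_wv$ or, for some $\nu$-variable $X_i$, $v\restriction X_i$ is a proper prefix of $u\restriction X_i$. **Rules** (read downwards, from a node to its children; $w'$ is the subsequence of those names of $w$ that still occur in the annotations of the child, before a new name is appended): - $\vee$: from $w\vdash\Gamma,(\phi\vee\psi)^u$ to $w\vdash\Gamma,\phi^u,\psi^u$; - $\wedge$: from $w\vdash\Gamma,(\phi\wedge\psi)^u$ to the two children $w\vdash\Gamma,\phi^u$ and $w\vdash\Gamma,\psi^u$; - modal: from $w\vdash\Gamma,\langle a\rangle\Sigma,[a]\psi^u$ to $w'\vdash\Sigma,\psi^u$, where $\langle a\rangle\Sigma=\{\langle a\rangle\phi^v : \phi^v\in\Sigma\}$ and $\Sigma$ may be empty; - $\mu$: from $w\vdash\Gamma,\mu Z.\phi(Z)^u$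 to $w'\vdash\Gamma,\phi(\mu Z.\phi(Z))^{u\restriction Z}$; - $\nu$: from $w\vdash\Gamma,\nu Z.\phi(Z)^u$ to $w'z_i\vdash\Gamma,\phi(\nu Z.\phi(Z))^{(u\restriction Z)z_i}$, where $z_i$ is the first name for $Z$ not occurring in $w$; - Thin: from $w\vdash\Gamma,\phi^u,\phi^v$ to $w'\vdash\Gamma,\phi^u$, provided $u\sqsubset_wv$; - Reset$_z$: from $w\vdash\Gamma,\phi_1^{uzz_1u_1},\dots,\phi_k^{uzz_ku_k}$ ($k\ge1$) to $w'\vdash\Gamma,\phi_1^{uz},\dots,\phi_k^{uz}$, provided $z,z_1,\dots,z_k$ are names of the same variable and $z$ does not occur in $\Gamma$. Thin and Reset are the structural rules; they have priority: another rule is applied to a sequent only if no structural rule applies to it. **Proof trees.** A *proof tree* for $\gamma$ is a finite tree of sequents with root $\vdash\gamma$ (empty sequence of names, empty annotation) such that the children of each inner node result from applying a rule to it, each node with the same sequent as some node above it (its companion) is a leaf, and each leaf either is an axiom $w\vdash\Gamma,P^u,\neg P^v$ or $w\vdash\Gamma,\mathtt{tt}^u$, or is a *successful repeat*: it has a companion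 such that for some name $z$, Reset$_z$ is applied between the companion and the leaf, and $z$ occurs in the name sequence of every node from the companion to the leaf inclusive. **Theorem.** For every closed guarded formula $\gamma$ in positive normal form, and every ordering $X_1,\dots,X_m$ as above, $\models\gamma$ if and only if there is a proof tree for $\gamma$. -/

import Mathlib

universe u

namespace MuCalc

noncomputable section

/-- The two kinds of fixpoint operator, written `σ` when the kind is irrelevant. -/
inductive Fix
  | mu
  | nu

/-- Modal mu-calculus formulas in positive form: negation is applied to atoms only. -/
inductive Formula (Var Atom Act : Type*)
  | var (Z : Var)
  | atom (P : Atom)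
  | natom (P : Atom)
  | tt
  | ff
  | and (φ ψ : Formula Var Atom Act)
  | or (φ ψ : Formula Var Atom Act)
  | box (a : Act) (φ : Formula Var Atom Act)
  | dia (a : Act) (φ : Formula Var Atom Act)
  | fix (σ : Fix) (Z : Var) (φ : Formula Var Atom Act)

/-- A labelled transition system with an interpretation of the atomic propositions. -/
structure Model (Atom Act : Type*) (S : Type*) where
  trans : Act → S → S → Prop
  val : Atom → Set S

namespace Formula

variable {Var Atom Act : Type*}

/-! ### Semantics -/

open Classical in
/-- The set of states satisfying a formula under a valuation of the variables. -/
def sem {S : Type*} (T : Model Atom Act S) : (Var → Set S) → Formula Var Atom Act → Set S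
  | V, var Z => V Z
  | _, atom P => T.val P
  | _, natom P => (T.val P)ᶜ
  | _, tt => Set.univ
  | _, ff => ∅
  | V, and φ ψ => sem T V φ ∩ sem T V ψ
  | V, or φ ψ => sem T V φ ∪ sem T V ψ
  | V, box a φ => {s | ∀ t, T.trans a s t → t ∈ sem T V φ}
  | V, dia a φ => {s | ∃ t, T.trans a s t ∧ t ∈ sem T V φ}
  | V, fix Fix.mu Z φ => ⋂₀ {A : Set S | sem T (Function.update V Z A) φ ⊆ A}
  | V, fix Fix.nu Z φ => ⋃₀ {A : Set S | A ⊆ sem T (Function.update V Z A) φ}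

/-- Validity: every state of every structure satisfies the formula, under every valuation. -/
def Valid.{v, v₁, v₂, v₃} {Var : Type v₁} {Atom : Type v₂} {Act : Type v₃}
    (φ : Formula Var Atom Act) : Prop :=
  ∀ (S : Type v) (T : Model Atom Act S) (V : Var → Set S), sem T V φ = Set.univ

/-! ### Syntactic notions -/

/-- The free variables. -/
def freeVars : Formula Var Atom Act → Set Var
  | var Z => {Z}
  | atom _ | natom _ | tt | ff => ∅
  | and φ ψ | or φ ψ => freeVars φ ∪ freeVars ψ
  | box _ φ | dia _ φ => freeVars φ
  | fix _ Z φ => freeVars φ \ {Z}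

def Closed (φ : Formula Var Atom Act) : Prop := φ.freeVars = ∅

/-- The variables bound by the occurrences of fixpoint operators, one entry per occurrence. -/
def boundVars : Formula Var Atom Act → List Var
  | var _ | atom _ | natom _ | tt | ff => []
  | and φ ψ | or φ ψ => boundVars φ ++ boundVars ψ
  | box _ φ | dia _ φ => boundVars φ
  | fix _ Z φ => Z :: boundVars φ

/-- Positive normal form: different occurrences of fixpoint operators bind different variables. -/
def PositiveNormal (φ : Formula Var Atom Act) : Prop := φ.boundVars.Nodup

/-- The subformulas of a formula, including the formula itself. -/
def subformulas : Formula Var Atom Act → Set (Formula Var Atom Act)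
  | var Z => {var Z}
  | atom P => {atom P}
  | natom P => {natom P}
  | tt => {tt}
  | ff => {ff}
  | and φ ψ => insert (and φ ψ) (subformulas φ ∪ subformulas ψ)
  | or φ ψ => insert (or φ ψ) (subformulas φ ∪ subformulas ψ)
  | box a φ => insert (box a φ) (subformulas φ)
  | dia a φ => insert (dia a φ) (subformulas φ)
  | fix σ Z φ => insert (fix σ Z φ) (subformulas φ)

/-- Every occurrence of `Z` in the formula is within the scope of a modal operator. -/
def GuardedIn (Z : Var) : Formula Var Atom Act → Prop
  | var Y => Y ≠ Z
  | atom _ | natom _ | tt | ff => True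
  | and φ ψ | or φ ψ => GuardedIn Z φ ∧ GuardedIn Z ψ
  | box _ _ | dia _ _ => True
  | fix _ _ φ => GuardedIn Z φ

def Guarded (γ : Formula Var Atom Act) : Prop :=
  ∀ σ Z φ, fix σ Z φ ∈ γ.subformulas → GuardedIn Z φ

open Classical in
/-- `subst Z χ φ` replaces the free occurrences of `Z` in `φ` by `χ`. In a proof tree `χ` is always
a closed formula, so that no variable can be captured. -/
def subst (Z : Var) (χ : Formula Var Atom Act) : Formula Var Atom Act → Formula Var Atom Act
  | var Y => if Y = Z then χ else var Y
  | atom P => atom P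
  | natom P => natom P
  | tt => tt
  | ff => ff
  | and φ ψ => and (subst Z χ φ) (subst Z χ ψ)
  | or φ ψ => or (subst Z χ φ) (subst Z χ ψ)
  | box a φ => box a (subst Z χ φ)
  | dia a φ => dia a (subst Z χ φ)
  | fix σ Y φ => if Y = Z then fix σ Y φ else fix σ Y (subst Z χ φ)

/-- The unfolding `φ(σ Z. φ(Z))` of `σ Z. φ(Z)`. -/
def unfold (σ : Fix) (Z : Var) (φ : Formula Var Atom Act) : Formula Var Atom Act :=
  subst Z (fix σ Z φ) φ

/-- The length of a formula: its number of symbols. -/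
def length : Formula Var Atom Act → ℕ
  | var _ | atom _ | tt | ff => 1
  | natom _ => 2
  | and φ ψ | or φ ψ => length φ + length ψ + 1
  | box _ φ | dia _ φ => length φ + 1
  | fix _ _ φ => length φ + 2

/-- `Z` is a variable in `γ`. -/
def IsVariable (γ : Formula Var Atom Act) (Z : Var) : Prop :=
  ∃ σ φ, fix σ Z φ ∈ γ.subformulas

/-- `Z` is a `ν`-variable in `γ`. -/
def IsNuVariable (γ : Formula Var Atom Act) (Z : Var) : Prop :=
  ∃ φ, fix Fix.nu Z φ ∈ γ.subformulas

/-- `Y` is more outermost than `Z` in `γ`. -/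
def MoreOutermost (γ : Formula Var Atom Act) (Y Z : Var) : Prop :=
  ∃ σ₁ ψ σ₂ φ, fix σ₂ Y φ ∈ γ.subformulas ∧
    fix σ₁ Z ψ ∈ (fix σ₂ Y φ).subformulas ∧ fix σ₁ Z ψ ≠ fix σ₂ Y φ

end Formula

/-- `a` occurs before `b` in the list `l` (used for lists without repetitions). -/
def Before {α : Type*} (l : List α) (a b : α) : Prop := [a, b].Sublist l

/-- `X` lists all the distinct variables in `γ`, more outermost ones first. -/
structure IsVarOrder {Var Atom Act : Type*} (γ : Formula Var Atom Act) (X : List Var) : Prop where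
  nodup : X.Nodup
  mem_iff : ∀ Z, Z ∈ X ↔ γ.IsVariable Z
  outer : ∀ Y Z, γ.MoreOutermost Y Z → Before X Y Z

/-- The name with index `idx` for the variable `var`. For a formula `γ` of length `l`, only the
names with index `0, …, l - 1` are used. -/
@[ext]
structure Name (Var : Type*) where
  var : Var
  idx : ℕ

section Names

variable {Var Atom Act : Type*}

open Classical in
/-- `u ↾ Z`: omit from `u` all names of the variables that come after `Z` in the order `X`. -/
def restrict (X : List Var) (Z : Var) (u : List (Name Var)) : List (Name Var) :=
  u.filter fun n => ¬ Before X Z n.var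

/-- `u <_w v`. -/
def NameLt (w u v : List (Name Var)) : Prop :=
  ∃ (j : ℕ) (a b : Name Var), u[j]? = some a ∧ v[j]? = some b ∧ a.var = b.var ∧ Before w a b ∧
    ∀ i < j, u[i]? = v[i]?

/-- `u ⊏_w v`. -/
def NameSqLt (γ : Formula Var Atom Act) (X : List Var) (w u v : List (Name Var)) : Prop :=
  NameLt w u v ∨
    ∃ Z, γ.IsNuVariable Z ∧ restrict X Z v <+: restrict X Z u ∧ restrict X Z v ≠ restrict X Z u

/-- `z` is the first name for its variable that does not occur in `w`. -/
def FirstFresh (γ : Formula Var Atom Act) (w : List (Name Var)) (z : Name Var) : Prop :=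
  z.idx < γ.length ∧ z ∉ w ∧ ∀ j < z.idx, (⟨z.var, j⟩ : Name Var) ∈ w

end Names

/-- A formula with names, `φ^u`. -/
abbrev NFormula (Var Atom Act : Type*) := Formula Var Atom Act × List (Name Var)

/-- A sequent `w ⊢ Γ`. -/
@[ext]
structure Sequent (Var Atom Act : Type*) where
  names : List (Name Var)
  fmls : Set (NFormula Var Atom Act)

section System

variable {Var Atom Act : Type*}

open Classical in
/-- The subsequence `w'` of the names in `w` that occur in `Δ`. -/
def keep (w : List (Name Var)) (Δ : Set (NFormula Var Atom Act)) : List (Name Var) :=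
  w.filter fun n => ∃ p ∈ Δ, n ∈ p.2

/-- The initial sequent `⊢ γ`. -/
def initial (γ : Formula Var Atom Act) : Sequent Var Atom Act := ⟨[], {(γ, [])}⟩

/-- The sequents `w ⊢ Γ, P^u, ¬P^v` and `w ⊢ Γ, tt^u`. -/
def Sequent.IsAxiomatic (s : Sequent Var Atom Act) : Prop :=
  (∃ P u v, (Formula.atom P, u) ∈ s.fmls ∧ (Formula.natom P, v) ∈ s.fmls) ∨
    ∃ u, (Formula.tt, u) ∈ s.fmls

/-- The logical rules: `LogicStep γ X s cs` says that `cs` is the list of the sequents that result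
from the application of a logical rule to `s`. -/
inductive LogicStep (γ : Formula Var Atom Act) (X : List Var) :
    Sequent Var Atom Act → List (Sequent Var Atom Act) → Prop
  | or (w : List (Name Var)) (Γ : Set (NFormula Var Atom Act)) (φ ψ : Formula Var Atom Act)
      (u : List (Name Var)) :
      LogicStep γ X ⟨w, Γ ∪ {(φ.or ψ, u)}⟩ [⟨w, Γ ∪ {(φ, u), (ψ, u)}⟩]
  | and (w : List (Name Var)) (Γ : Set (NFormula Var Atom Act)) (φ ψ : Formula Var Atom Act)
      (u : List (Name Var)) :
      LogicStep γ X ⟨w, Γ ∪ {(φ.and ψ, u)}⟩ [⟨w, Γ ∪ {(φ, u)}⟩, ⟨w, Γ ∪ {(ψ, u)}⟩]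
  | modal (w : List (Name Var)) (Γ Δ : Set (NFormula Var Atom Act)) (a : Act)
      (ψ : Formula Var Atom Act) (u : List (Name Var)) :
      LogicStep γ X ⟨w, Γ ∪ (fun p => (Formula.dia a p.1, p.2)) '' Δ ∪ {(Formula.box a ψ, u)}⟩
        [⟨keep w (Δ ∪ {(ψ, u)}), Δ ∪ {(ψ, u)}⟩]
  | mu (w : List (Name Var)) (Γ : Set (NFormula Var Atom Act)) (Z : Var)
      (φ : Formula Var Atom Act) (u : List (Name Var)) :
      LogicStep γ X ⟨w, Γ ∪ {(Formula.fix Fix.mu Z φ, u)}⟩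
        [⟨keep w (Γ ∪ {(Formula.unfold Fix.mu Z φ, restrict X Z u)}),
          Γ ∪ {(Formula.unfold Fix.mu Z φ, restrict X Z u)}⟩]
  | nu (w : List (Name Var)) (Γ : Set (NFormula Var Atom Act)) (Z : Var)
      (φ : Formula Var Atom Act) (u : List (Name Var)) (i : ℕ) (hi : FirstFresh γ w ⟨Z, i⟩) :
      LogicStep γ X ⟨w, Γ ∪ {(Formula.fix Fix.nu Z φ, u)}⟩
        [⟨keep w (Γ ∪ {(Formula.unfold Fix.nu Z φ, restrict X Z u)}) ++ [⟨Z, i⟩],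
          Γ ∪ {(Formula.unfold Fix.nu Z φ, restrict X Z u ++ [⟨Z, i⟩])}⟩]

/-- The structural rules: `StructStep γ X s r t` says that `t` results from `s` by an application
of Thin (with `r = none`) or of Reset for the name `z` (with `r = some z`). -/
inductive StructStep (γ : Formula Var Atom Act) (X : List Var) :
    Sequent Var Atom Act → Option (Name Var) → Sequent Var Atom Act → Prop
  | thin (w : List (Name Var)) (Γ : Set (NFormula Var Atom Act)) (φ : Formula Var Atom Act)
      (u v : List (Name Var)) (h : NameSqLt γ X w u v) :
      StructStep γ X ⟨w, Γ ∪ {(φ, u), (φ, v)}⟩ none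
        ⟨keep w (Γ ∪ {(φ, u)}), Γ ∪ {(φ, u)}⟩
  | reset (w : List (Name Var)) (Γ Δ : Set (NFormula Var Atom Act)) (u : List (Name Var))
      (z : Name Var) (hΔ : Δ.Nonempty)
      (hz : ∀ p ∈ Δ, ∃ (z' : Name Var) (u' : List (Name Var)),
        z'.var = z.var ∧ p.2 = u ++ z :: z' :: u')
      (hΓ : ∀ p ∈ Γ, z ∉ p.2) :
      StructStep γ X ⟨w, Γ ∪ Δ⟩ (some z)
        ⟨keep w (Γ ∪ (fun p => (p.1, u ++ [z])) '' Δ), Γ ∪ (fun p => (p.1, u ++ [z])) '' Δ⟩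

/-- The part of a branch above a node, listed from the parent of the node up to the root. Each
ancestor comes with its sequent and, if the rule applied to it is Reset, the name that is reset. -/
abbrev Branch (Var Atom Act : Type*) := List (Sequent Var Atom Act × Option (Name Var))

/-- A node below the branch `h` labelled `s` repeats the sequent of some node above it. -/
def IsRepeat (h : Branch Var Atom Act) (s : Sequent Var Atom Act) : Prop :=
  ∃ e ∈ h, e.1 = s

/-- A node below the branch `h` labelled `s` is a successful repeat: it has a companion `(s, r)`
in `h`, and for some name `z` the rule Reset for `z` is applied between the companion and the node,
and `z` occurs in the name sequence of all nodes from the companion to the node. -/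
def IsSuccessfulRepeat (h : Branch Var Atom Act) (s : Sequent Var Atom Act) : Prop :=
  ∃ (h₁ h₂ : Branch Var Atom Act) (r : Option (Name Var)), h = h₁ ++ (s, r) :: h₂ ∧
    ∃ z : Name Var, (∃ e ∈ h₁ ++ [(s, r)], e.2 = some z) ∧
      z ∈ s.names ∧ ∀ e ∈ h₁ ++ [(s, r)], z ∈ e.1.names

/-- `ProofTree γ X h s` is the type of the finite trees with root label `s` that can stand below
the branch `h` in a proof tree. Every node that repeats a sequent above it is a leaf; every leaf is
axiomatic or a successful repeat; the structural rules have priority over the logical ones. -/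
inductive ProofTree (γ : Formula Var Atom Act) (X : List Var) :
    Branch Var Atom Act → Sequent Var Atom Act → Type _
  | axiomLeaf (h : Branch Var Atom Act) (s : Sequent Var Atom Act) (hs : s.IsAxiomatic) :
      ProofTree γ X h s
  | repeatLeaf (h : Branch Var Atom Act) (s : Sequent Var Atom Act)
      (hs : IsSuccessfulRepeat h s) : ProofTree γ X h s
  | structNode (h : Branch Var Atom Act) (s t : Sequent Var Atom Act) (r : Option (Name Var))
      (hs : ¬ IsRepeat h s) (step : StructStep γ X s r t)
      (child : ProofTree γ X ((s, r) :: h) t) : ProofTree γ X h s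
  | logicNode (h : Branch Var Atom Act) (s : Sequent Var Atom Act)
      (cs : List (Sequent Var Atom Act)) (hs : ¬ IsRepeat h s)
      (priority : ¬ ∃ r t, StructStep γ X s r t) (step : LogicStep γ X s cs)
      (children : ∀ t ∈ cs, ProofTree γ X ((s, none) :: h) t) : ProofTree γ X h s

/-- There is a proof tree for `γ`, the variables of `γ` being ordered by `X`. -/
def HasProofTree (γ : Formula Var Atom Act) (X : List Var) : Prop :=
  Nonempty (ProofTree γ X [] (initial γ))

end System

end

end MuCalc

/-! ### Syntax: subformulas, substitution, and the closed formulas that variables stand for -/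

namespace MuCalc
noncomputable section
open Classical

/-! ### Positions in lists without repetitions -/

/-! Every formula in a sequent is the expansion of a subformula of γ, its free variables being
replaced by the closed fixpoint formulas they stand for (`expand`). Semantic arguments are carried
out on the subformula itself, under a valuation interpreting each variable by an ordinal approximant
of its fixpoint (`env`).

Soundness. Suppose γ fails at some state. Give every name a stage, and read φ^u as the claim that φ
fails when each ν-variable is approximated at the stage of its last name in u. A ν-formula failing
at a stage has an unfolding failing at a smaller one, which the fresh name records. Reset for z can
strictly lower the stage of z, since wherever z occurs it is followed by a name of the same variable
with a smaller stage. So every rule passes a refutation on to some child (`refutes_logicStep`,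
`refutes_structStep`), while axioms cannot be refuted. At each node take stages that are
lexicographically least along the name sequence. At a successful repeat, z and all names before it
have survived since the companion, their stages have never risen, and a Reset has lowered one of
them: the repeated sequent is refuted by stages below the least ones (`not_refutes_of_proofTree`).

Completeness. Suppose there is no proof tree. A node without a proof tree has a child without one,
and if that child is a repeat, it is an unsuccessful one and can be replaced by its companion; so
the descent never stops. Fresh names never run out (`exists_firstFresh`). Applying non-modal rules
as long as possible and then branching over all box formulas yields a tree model in which an atom is
true where its negation is in the sequent. If γ were true at the root, a true formula, with stages
for the μ-variables, could be traced forever. By guardedness infinitely many fixpoints are unfolded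
on the trace; let Z be the outermost variable unfolded infinitely often. If Z is a μ-variable, its
stage falls infinitely often (`kind_eq_nu_of_unfolded`). If Z is a ν-variable, the annotations would
stabilise position by position, because a name there can only be exchanged for a better one, unless
some persistent name is reset infinitely often; as annotations have bounded length, the latter
happens (`exists_persistent_reset`). But branches have bounded length too, so some jump to a
companion passes back over such a Reset, and the repeat was successful after all
(`not_reset_infinitely_often`). -/

/-- The position of `a` in the list `l`. -/
def pos {α : Type*} (l : List α) (a : α) : ℕ := l.idxOf a

theorem before_iff {α : Type*} {l : List α} (hl : l.Nodup) {a b : α} :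
    Before l a b ↔ pos l a < pos l b ∧ b ∈ l := by
  unfold Before pos
  induction l with
  | nil => simp
  | cons x l ih =>
    have hx := (List.nodup_cons.1 hl).1
    have ih := ih (List.nodup_cons.1 hl).2
    by_cases hax : a = x
    · subst hax
      by_cases hab : b = a
      · subst hab
        simp only [List.mem_cons, true_or, and_true, lt_self_iff_false, iff_false]
        intro h
        cases h with
        | cons _ h => exact hx (h.subset (by simp))
        | cons_cons _ h => exact hx (h.subset (by simp))
      · rw [List.idxOf_cons_self, List.idxOf_cons_ne _ (Ne.symm hab)]
        simp [hab]
    · have h1 : [a, b].Sublist (x :: l) ↔ [a, b].Sublist l := by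
        constructor
        · intro h
          cases h with
          | cons _ h => exact h
          | cons_cons _ h => exact absurd rfl hax
        · exact fun h => h.cons _
      rw [h1, ih, List.idxOf_cons_ne _ (Ne.symm hax)]
      by_cases hab : b = x
      · subst hab
        rw [List.idxOf_cons_self]
        simp [hx]
      · rw [List.idxOf_cons_ne _ (Ne.symm hab)]
        simp [hab]

theorem pos_injOn {α : Type*} {l : List α} {a b : α} (ha : a ∈ l) (h : pos l a = pos l b) :
    a = b := (List.idxOf_inj ha).1 h

theorem Before.mem_left {α : Type*} {l : List α} {a b : α} (h : Before l a b) : a ∈ l :=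
  h.subset (by simp)

namespace Formula

variable {Var Atom Act : Type*}

/-! ### Subformulas and free variables -/

theorem self_mem_subformulas (φ : Formula Var Atom Act) : φ ∈ φ.subformulas := by
  cases φ <;> simp [subformulas]

theorem subformulas_trans {φ ψ χ : Formula Var Atom Act} (h : ψ ∈ φ.subformulas)
    (h' : χ ∈ ψ.subformulas) : χ ∈ φ.subformulas := by
  induction φ with
  | var _ | atom _ | natom _ | tt | ff =>
    simp only [subformulas, Set.mem_singleton_iff] at h
    subst h
    exact h'
  | and φ₁ φ₂ ih₁ ih₂ | or φ₁ φ₂ ih₁ ih₂ =>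
    simp only [subformulas, Set.mem_insert_iff, Set.mem_union] at h
    rcases h with rfl | h | h
    · exact h'
    · exact Or.inr (Or.inl (ih₁ h))
    · exact Or.inr (Or.inr (ih₂ h))
  | box a φ ih | dia a φ ih | fix σ Z φ ih =>
    simp only [subformulas, Set.mem_insert_iff] at h
    rcases h with rfl | h
    · exact h'
    · exact Or.inr (ih h)

theorem length_le_of_mem_subformulas {φ ψ : Formula Var Atom Act} (h : ψ ∈ φ.subformulas) :
    ψ.length ≤ φ.length := by
  induction φ with
  | var _ | atom _ | natom _ | tt | ff =>
    simp only [subformulas, Set.mem_singleton_iff] at h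
    subst h
    exact le_rfl
  | and φ₁ φ₂ ih₁ ih₂ | or φ₁ φ₂ ih₁ ih₂ =>
    simp only [subformulas, Set.mem_insert_iff, Set.mem_union] at h
    rcases h with rfl | h | h
    · exact le_rfl
    · have := ih₁ h; simp only [length]; omega
    · have := ih₂ h; simp only [length]; omega
  | box a φ ih | dia a φ ih | fix σ Z φ ih =>
    simp only [subformulas, Set.mem_insert_iff] at h
    rcases h with rfl | h
    · exact le_rfl
    · have := ih h; simp only [length]; omega

theorem fix_notMem_subformulas_body {σ : Fix} {Z : Var} {φ : Formula Var Atom Act} :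
    fix σ Z φ ∉ φ.subformulas := fun h => by
  have := length_le_of_mem_subformulas h
  simp only [length] at this
  omega

theorem body_mem_subformulas {σ : Fix} {Z : Var} {φ : Formula Var Atom Act} :
    φ ∈ (fix σ Z φ).subformulas := Or.inr (self_mem_subformulas φ)

/-- A variable that is free in a subformula is free in the formula or bound above it. -/
theorem mem_freeVars_or_exists_fix {φ ψ : Formula Var Atom Act} (h : ψ ∈ φ.subformulas) {Y : Var}
    (hY : Y ∈ ψ.freeVars) :
    Y ∈ φ.freeVars ∨ ∃ σ χ, fix σ Y χ ∈ φ.subformulas ∧ ψ ∈ χ.subformulas := by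
  induction φ with
  | var _ | atom _ | natom _ | tt | ff =>
    simp only [subformulas, Set.mem_singleton_iff] at h
    subst h
    exact Or.inl hY
  | and φ₁ φ₂ ih₁ ih₂ | or φ₁ φ₂ ih₁ ih₂ =>
    simp only [subformulas, Set.mem_insert_iff, Set.mem_union] at h
    rcases h with rfl | h | h
    · exact Or.inl hY
    · rcases ih₁ h with h | ⟨σ, χ, h, h'⟩
      · exact Or.inl (Or.inl h)
      · exact Or.inr ⟨σ, χ, Or.inr (Or.inl h), h'⟩
    · rcases ih₂ h with h | ⟨σ, χ, h, h'⟩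
      · exact Or.inl (Or.inr h)
      · exact Or.inr ⟨σ, χ, Or.inr (Or.inr h), h'⟩
  | box a φ ih | dia a φ ih =>
    simp only [subformulas, Set.mem_insert_iff] at h
    rcases h with rfl | h
    · exact Or.inl hY
    · rcases ih h with h | ⟨σ, χ, h, h'⟩
      · exact Or.inl h
      · exact Or.inr ⟨σ, χ, Or.inr h, h'⟩
  | fix τ W φ ih =>
    simp only [subformulas, Set.mem_insert_iff] at h
    rcases h with rfl | h
    · exact Or.inl hY
    · rcases ih h with h₁ | ⟨σ, χ, h, h'⟩
      · by_cases hYW : Y = W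
        · subst hYW
          exact Or.inr ⟨τ, φ, Or.inl rfl, h⟩
        · exact Or.inl ⟨h₁, hYW⟩
      · exact Or.inr ⟨σ, χ, Or.inr h, h'⟩

theorem mem_boundVars_of_fix_mem {φ : Formula Var Atom Act} {σ : Fix} {Z : Var}
    {χ : Formula Var Atom Act} (h : fix σ Z χ ∈ φ.subformulas) : Z ∈ φ.boundVars := by
  induction φ with
  | var _ | atom _ | natom _ | tt | ff => simp [subformulas] at h
  | and φ₁ φ₂ ih₁ ih₂ | or φ₁ φ₂ ih₁ ih₂ =>
    simp only [subformulas, Set.mem_insert_iff, Set.mem_union, reduceCtorEq, false_or] at h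
    simp only [boundVars, List.mem_append]
    exact h.imp ih₁ ih₂
  | box a φ ih | dia a φ ih =>
    simp only [subformulas, Set.mem_insert_iff, reduceCtorEq, false_or] at h
    exact ih h
  | fix τ W φ ih =>
    simp only [subformulas, Set.mem_insert_iff] at h
    rcases h with h | h
    · cases h; simp [boundVars]
    · exact List.mem_cons_of_mem _ (ih h)

/-- In positive normal form a variable is bound by just one subformula. -/
theorem fix_unique {φ : Formula Var Atom Act} (hφ : φ.PositiveNormal) {σ σ' : Fix} {Z : Var}
    {χ χ' : Formula Var Atom Act} (h : fix σ Z χ ∈ φ.subformulas)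
    (h' : fix σ' Z χ' ∈ φ.subformulas) : σ = σ' ∧ χ = χ' := by
  unfold PositiveNormal at hφ
  induction φ with
  | var _ | atom _ | natom _ | tt | ff => simp [subformulas] at h
  | and φ₁ φ₂ ih₁ ih₂ | or φ₁ φ₂ ih₁ ih₂ =>
    simp only [subformulas, Set.mem_insert_iff, Set.mem_union, reduceCtorEq, false_or] at h h'
    simp only [boundVars, List.nodup_append'] at hφ
    obtain ⟨h1, h2, h3⟩ := hφ
    rcases h with h | h <;> rcases h' with h' | h'
    · exact ih₁ h1 h h'
    · exact (h3 (mem_boundVars_of_fix_mem h) (mem_boundVars_of_fix_mem h')).elim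
    · exact (h3 (mem_boundVars_of_fix_mem h') (mem_boundVars_of_fix_mem h)).elim
    · exact ih₂ h2 h h'
  | box a φ ih | dia a φ ih =>
    simp only [subformulas, Set.mem_insert_iff, reduceCtorEq, false_or] at h h'
    exact ih hφ h h'
  | fix τ W φ ih =>
    simp only [subformulas, Set.mem_insert_iff] at h h'
    simp only [boundVars, List.nodup_cons] at hφ
    rcases h with h | h <;> rcases h' with h' | h'
    · cases h; cases h'; exact ⟨rfl, rfl⟩
    · cases h; exact (hφ.1 (mem_boundVars_of_fix_mem h')).elim
    · cases h'; exact (hφ.1 (mem_boundVars_of_fix_mem h)).elim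
    · exact ih hφ.2 h h'

/-- The inequality becomes strict with a fixpoint because the operator and its variable count as two
symbols but contribute one subformula. This spare unit is what leaves a fresh name among the
`γ.length` names of a variable. -/
theorem subformulas_finite_ncard (φ : Formula Var Atom Act) :
    φ.subformulas.Finite ∧ φ.subformulas.ncard ≤ φ.length ∧
      ((∃ σ Z χ, fix σ Z χ ∈ φ.subformulas) → φ.subformulas.ncard < φ.length) := by
  induction φ with
  | var _ | atom _ | natom _ | tt | ff => simp [subformulas, length]
  | and φ₁ φ₂ ih₁ ih₂ | or φ₁ φ₂ ih₁ ih₂ =>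
    obtain ⟨f₁, l₁, s₁⟩ := ih₁
    obtain ⟨f₂, l₂, s₂⟩ := ih₂
    have hi := Set.ncard_insert_le (and φ₁ φ₂) (φ₁.subformulas ∪ φ₂.subformulas)
    have hi' := Set.ncard_insert_le (or φ₁ φ₂) (φ₁.subformulas ∪ φ₂.subformulas)
    have hu := Set.ncard_union_le φ₁.subformulas φ₂.subformulas
    refine ⟨(f₁.union f₂).insert _, ?_, ?_⟩
    · simp only [subformulas, length]; omega
    · rintro ⟨σ, Z, χ, h⟩
      simp only [subformulas, Set.mem_insert_iff, Set.mem_union, reduceCtorEq, false_or] at h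
      simp only [subformulas, length]
      rcases h with h | h
      · have := s₁ ⟨σ, Z, χ, h⟩; omega
      · have := s₂ ⟨σ, Z, χ, h⟩; omega
  | box a φ ih =>
    obtain ⟨f, l, s⟩ := ih
    have hi := Set.ncard_insert_le (box a φ) φ.subformulas
    refine ⟨f.insert _, ?_, ?_⟩
    · simp only [subformulas, length]; omega
    · rintro ⟨σ, Z, χ, h⟩
      simp only [subformulas, Set.mem_insert_iff, reduceCtorEq, false_or] at h
      have := s ⟨σ, Z, χ, h⟩
      simp only [subformulas, length]; omega
  | dia a φ ih =>
    obtain ⟨f, l, s⟩ := ih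
    have hi := Set.ncard_insert_le (dia a φ) φ.subformulas
    refine ⟨f.insert _, ?_, ?_⟩
    · simp only [subformulas, length]; omega
    · rintro ⟨σ, Z, χ, h⟩
      simp only [subformulas, Set.mem_insert_iff, reduceCtorEq, false_or] at h
      have := s ⟨σ, Z, χ, h⟩
      simp only [subformulas, length]; omega
  | fix τ W φ ih =>
    obtain ⟨f, l, s⟩ := ih
    have hi := Set.ncard_insert_le (fix τ W φ) φ.subformulas
    refine ⟨f.insert _, ?_, fun _ => ?_⟩ <;> simp only [subformulas, length] <;> omega

/-! ### Simultaneous substitution -/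

/-- Replace every free variable `Z` by `E Z`, without renaming of bound variables. -/
def msubst (E : Var → Formula Var Atom Act) : Formula Var Atom Act → Formula Var Atom Act
  | var Z => E Z
  | atom P => atom P
  | natom P => natom P
  | tt => tt
  | ff => ff
  | and φ ψ => and (msubst E φ) (msubst E ψ)
  | or φ ψ => or (msubst E φ) (msubst E ψ)
  | box a φ => box a (msubst E φ)
  | dia a φ => dia a (msubst E φ)
  | fix σ Z φ => fix σ Z (msubst (Function.update E Z (var Z)) φ)

theorem msubst_congr {φ : Formula Var Atom Act} {E E' : Var → Formula Var Atom Act}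
    (h : ∀ Z ∈ φ.freeVars, E Z = E' Z) : msubst E φ = msubst E' φ := by
  induction φ generalizing E E' with
  | var Z => exact h Z rfl
  | atom _ | natom _ | tt | ff => rfl
  | and φ₁ φ₂ ih₁ ih₂ | or φ₁ φ₂ ih₁ ih₂ =>
    simp only [msubst]
    rw [ih₁ fun Z hZ => h Z (Or.inl hZ), ih₂ fun Z hZ => h Z (Or.inr hZ)]
  | box a φ ih | dia a φ ih =>
    simp only [msubst]
    rw [ih h]
  | fix σ Y φ ih =>
    simp only [msubst]
    rw [ih]
    intro Z hZ
    by_cases hZY : Z = Y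
    · subst hZY; simp
    · simp only [Function.update_of_ne hZY]
      exact h Z ⟨hZ, hZY⟩

theorem msubst_var (φ : Formula Var Atom Act) : msubst var φ = φ := by
  induction φ with
  | var _ | atom _ | natom _ | tt | ff => rfl
  | and φ₁ φ₂ ih₁ ih₂ | or φ₁ φ₂ ih₁ ih₂ => simp only [msubst, ih₁, ih₂]
  | box a φ ih | dia a φ ih => simp only [msubst, ih]
  | fix σ Y φ ih => simp only [msubst, Function.update_eq_self, ih]

theorem freeVars_msubst {φ : Formula Var Atom Act} {E : Var → Formula Var Atom Act} {Y : Var}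
    (hY : Y ∈ (msubst E φ).freeVars) : ∃ Z ∈ φ.freeVars, Y ∈ (E Z).freeVars := by
  induction φ generalizing E with
  | var Z => exact ⟨Z, rfl, hY⟩
  | atom _ | natom _ | tt | ff => exact hY.elim
  | and φ₁ φ₂ ih₁ ih₂ | or φ₁ φ₂ ih₁ ih₂ =>
    rcases hY with hY | hY
    · obtain ⟨Z, hZ, h⟩ := ih₁ hY
      exact ⟨Z, Or.inl hZ, h⟩
    · obtain ⟨Z, hZ, h⟩ := ih₂ hY
      exact ⟨Z, Or.inr hZ, h⟩
  | box a φ ih | dia a φ ih => exact ih hY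
  | fix σ W φ ih =>
    obtain ⟨Z, hZ, h⟩ := ih hY.1
    by_cases hZW : Z = W
    · subst hZW
      rw [Function.update_self] at h
      exact (hY.2 h).elim
    · rw [Function.update_of_ne hZW] at h
      exact ⟨Z, ⟨hZ, hZW⟩, h⟩

theorem subst_of_notMem {φ χ : Formula Var Atom Act} {Z : Var} (h : Z ∉ φ.freeVars) :
    subst Z χ φ = φ := by
  induction φ with
  | var Y => exact if_neg fun hY => h hY.symm
  | atom _ | natom _ | tt | ff => rfl
  | and φ₁ φ₂ ih₁ ih₂ | or φ₁ φ₂ ih₁ ih₂ =>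
    simp only [subst]
    rw [ih₁ fun hZ => h (Or.inl hZ), ih₂ fun hZ => h (Or.inr hZ)]
  | box a φ ih | dia a φ ih =>
    simp only [subst]
    rw [ih h]
  | fix σ Y φ ih =>
    simp only [subst]
    split_ifs with hY
    · rfl
    · rw [ih fun hZ => h ⟨hZ, fun e => hY e.symm⟩]

/-- Links the one-variable substitution of the unfolding rules to simultaneous substitution. Since
`Z` is free in no other inserted formula, the later substitution only meets the occurrences of `Z`
left in place. -/
theorem subst_msubst {φ χ : Formula Var Atom Act} {E : Var → Formula Var Atom Act} {Z : Var}
    (h : ∀ W, W ≠ Z → Z ∉ (E W).freeVars) :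
    subst Z χ (msubst (Function.update E Z (var Z)) φ) = msubst (Function.update E Z χ) φ := by
  induction φ generalizing E with
  | var W =>
    by_cases hW : W = Z
    · subst hW; simp [msubst, subst]
    · simp only [msubst, Function.update_of_ne hW]
      exact subst_of_notMem (h W hW)
  | atom _ | natom _ | tt | ff => rfl
  | and φ₁ φ₂ ih₁ ih₂ | or φ₁ φ₂ ih₁ ih₂ => simp only [msubst, subst, ih₁ h, ih₂ h]
  | box a φ ih | dia a φ ih => simp only [msubst, subst, ih h]
  | fix σ Y φ ih =>
    simp only [msubst, subst]
    by_cases hY : Y = Z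
    · subst hY; simp
    · rw [if_neg hY, Function.update_comm (Ne.symm hY), Function.update_comm (Ne.symm hY), ih]
      intro W hW
      by_cases hWY : W = Y
      · subst hWY
        simpa [freeVars] using hW.symm
      · rw [Function.update_of_ne hWY]
        exact h W hW

/-- The number of rule applications to a formula before a modal operator is reached. -/
def depth : Formula Var Atom Act → ℕ
  | and φ ψ | or φ ψ => depth φ + depth ψ + 1
  | fix _ _ φ => depth φ + 1
  | _ => 0

/-- Guarded occurrences of `Z` lie below a modal operator, where `depth` no longer looks. -/
theorem depth_msubst_update {φ χ χ' : Formula Var Atom Act} {E : Var → Formula Var Atom Act}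
    {Z : Var} (h : GuardedIn Z φ) :
    depth (msubst (Function.update E Z χ) φ) = depth (msubst (Function.update E Z χ') φ) := by
  induction φ generalizing E with
  | var W =>
    have hW : W ≠ Z := h
    simp [msubst, hW]
  | atom _ | natom _ | tt | ff | box _ _ _ | dia _ _ _ => rfl
  | and φ₁ φ₂ ih₁ ih₂ | or φ₁ φ₂ ih₁ ih₂ => simp only [msubst, depth, ih₁ h.1, ih₂ h.2]
  | fix σ Y φ ih =>
    simp only [msubst, depth]
    by_cases hY : Y = Z
    · subst hY; simp
    · rw [Function.update_comm (Ne.symm hY), Function.update_comm (Ne.symm hY), ih h]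

end Formula

/-! ### The variables of a formula and their expansions -/

open Formula

variable {Var Atom Act : Type*}

/-- The standing assumptions: `γ` is a closed guarded formula in positive normal form, and `X` is an
admissible order of its variables. -/
structure Admissible (γ : Formula Var Atom Act) (X : List Var) : Prop where
  pnf : γ.PositiveNormal
  closed : γ.Closed
  guarded : γ.Guarded
  order : IsVarOrder γ X

/-- The kind of the fixpoint that binds `Z` in `γ`. -/
def kind (γ : Formula Var Atom Act) (Z : Var) : Fix :=
  if h : γ.IsVariable Z then h.choose else Fix.mu

/-- The formula `φ` such that `σ Z. φ` is a subformula of `γ`. -/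
def body (γ : Formula Var Atom Act) (Z : Var) : Formula Var Atom Act :=
  if h : γ.IsVariable Z then h.choose_spec.choose else tt

theorem fix_kind_body_mem {γ : Formula Var Atom Act} {Z : Var} (h : γ.IsVariable Z) :
    fix (kind γ Z) Z (body γ Z) ∈ γ.subformulas := by
  unfold kind body
  rw [dif_pos h, dif_pos h]
  exact h.choose_spec.choose_spec

namespace Admissible

variable {γ : Formula Var Atom Act} {X : List Var}

theorem mem_order (H : Admissible γ X) {σ : Fix} {Z : Var} {χ : Formula Var Atom Act}
    (h : fix σ Z χ ∈ γ.subformulas) : Z ∈ X := (H.order.mem_iff Z).2 ⟨σ, χ, h⟩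

theorem fix_mem (H : Admissible γ X) {Z : Var} (h : Z ∈ X) :
    fix (kind γ Z) Z (body γ Z) ∈ γ.subformulas :=
  fix_kind_body_mem ((H.order.mem_iff Z).1 h)

theorem body_mem (H : Admissible γ X) {Z : Var} (h : Z ∈ X) : body γ Z ∈ γ.subformulas :=
  subformulas_trans (H.fix_mem h) body_mem_subformulas

theorem eq_kind_body (H : Admissible γ X) {σ : Fix} {Z : Var} {χ : Formula Var Atom Act}
    (h : fix σ Z χ ∈ γ.subformulas) : σ = kind γ Z ∧ χ = body γ Z :=
  fix_unique H.pnf h (H.fix_mem (H.mem_order h))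

theorem kind_eq_nu_iff (H : Admissible γ X) {Z : Var} :
    Z ∈ X ∧ kind γ Z = Fix.nu ↔ γ.IsNuVariable Z := by
  constructor
  · rintro ⟨h, hk⟩
    have := H.fix_mem h
    rw [hk] at this
    exact ⟨_, this⟩
  · rintro ⟨χ, h⟩
    exact ⟨H.mem_order h, (H.eq_kind_body h).1.symm⟩

/-- As γ is closed, such a `Y` is bound by a fixpoint properly enclosing that of `Z`. This justifies
the recursions along the variable order that define `expandVar` and `env`. -/
theorem pos_lt_of_mem_freeVars (H : Admissible γ X) {Y Z : Var} (hZ : Z ∈ X) (hY : Y ∈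
    (body γ Z).freeVars)
    (hYZ : Y ≠ Z) : pos X Y < pos X Z ∧ Y ∈ X := by
  have h1 : Y ∈ (fix (kind γ Z) Z (body γ Z)).freeVars := ⟨hY, hYZ⟩
  rcases mem_freeVars_or_exists_fix (H.fix_mem hZ) h1 with h | ⟨σ, χ, h, h'⟩
  · rw [show γ.freeVars = ∅ from H.closed] at h
    exact h.elim
  · have : γ.MoreOutermost Y Z := by
      refine ⟨_, _, σ, χ, h, Or.inr h', ?_⟩
      intro e
      rw [e] at h'
      exact fix_notMem_subformulas_body h'
    exact ⟨((before_iff H.order.nodup).1 (H.order.outer Y Z this)).1, H.mem_order h⟩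

theorem var_mem_order (H : Admissible γ X) {Y : Var} (h : var Y ∈ γ.subformulas) : Y ∈ X := by
  rcases mem_freeVars_or_exists_fix h (Y := Y) rfl with h | ⟨σ, χ, h, -⟩
  · rw [show γ.freeVars = ∅ from H.closed] at h
    exact h.elim
  · exact H.mem_order h

/-- A variable occurring in the body of `Z` is `Z`, or more outermost than `Z`, or bound within the
body of `Z`. -/
theorem body_mem_of_var_mem (H : Admissible γ X) {Y Z : Var} (hZ : Z ∈ X) (h : var Y ∈
    (body γ Z).subformulas)
    (hYZ : pos X Z ≤ pos X Y) : body γ Y ∈ (body γ Z).subformulas := by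
  rcases mem_freeVars_or_exists_fix h (Y := Y) rfl with h | ⟨σ, χ, h, -⟩
  · by_cases e : Y = Z
    · subst e; exact self_mem_subformulas _
    · have := (H.pos_lt_of_mem_freeVars hZ h e).1
      omega
  · have h2 := (H.eq_kind_body (subformulas_trans (H.body_mem hZ) h)).2
    rw [← h2]
    exact subformulas_trans h body_mem_subformulas

end Admissible

/-- The closed formula that a variable `Z` of `γ` stands for. -/
def expandVar (γ : Formula Var Atom Act) (X : List Var) (Z : Var) : Formula Var Atom Act :=
  if Z ∈ X then
    -- The test on positions serves termination; by `pos_lt_of_mem_freeVars` the default `tt` is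
    -- never used for a free variable of the body.
    fix (kind γ Z) Z (msubst (fun W => if W = Z then var Z else
      if _h : pos X W < pos X Z then expandVar γ X W else tt) (body γ Z))
  else tt
termination_by pos X Z

/-- The closed formula that a subformula of `γ` stands for. -/
def expand (γ : Formula Var Atom Act) (X : List Var) (ψ : Formula Var Atom Act) :
    Formula Var Atom Act := msubst (expandVar γ X) ψ

theorem expandVar_closed (γ : Formula Var Atom Act) (X : List Var) (Z : Var) :
    (expandVar γ X Z).freeVars = ∅ := by
  rw [expandVar]
  split_ifs with hZ
  · rw [Set.eq_empty_iff_forall_notMem]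
    rintro Y ⟨hY, hYZ⟩
    obtain ⟨W, -, h⟩ := freeVars_msubst hY
    by_cases hWZ : W = Z
    · rw [if_pos hWZ] at h
      exact hYZ h
    · rw [if_neg hWZ] at h
      split_ifs at h with hlt
      · rw [expandVar_closed γ X W] at h
        exact h
      · exact h
  · rfl
termination_by pos X Z

namespace Admissible

variable {γ : Formula Var Atom Act} {X : List Var}

theorem expandVar_eq (H : Admissible γ X) {Z : Var} (hZ : Z ∈ X) : expandVar γ X Z =
    fix (kind γ Z) Z (msubst (Function.update (expandVar γ X) Z (var Z)) (body γ Z)) := by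
  rw [expandVar, if_pos hZ]
  congr 1
  apply msubst_congr
  intro W hW
  by_cases hWZ : W = Z
  · subst hWZ; simp
  · rw [if_neg hWZ, dif_pos (H.pos_lt_of_mem_freeVars hZ hW hWZ).1, Function.update_of_ne hWZ]

theorem expand_fix (H : Admissible γ X) {σ : Fix} {Z : Var} {χ : Formula Var Atom Act}
    (h : fix σ Z χ ∈ γ.subformulas) : expand γ X (fix σ Z χ) = expandVar γ X Z := by
  obtain ⟨rfl, rfl⟩ := H.eq_kind_body h
  rw [H.expandVar_eq (H.mem_order h)]
  rfl

/-- A subformula that stands for a fixpoint formula is a variable or a fixpoint formula. -/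
theorem of_expand_eq_fix (H : Admissible γ X) {ψ : Formula Var Atom Act} (hψ : ψ ∈ γ.subformulas)
    {σ : Fix} {Z : Var}
    {φ : Formula Var Atom Act} (h : expand γ X ψ = fix σ Z φ) :
    Z ∈ X ∧ σ = kind γ Z ∧ (ψ = var Z ∨ ψ = fix (kind γ Z) Z (body γ Z)) := by
  cases ψ with
  | var Y =>
    have hY := H.var_mem_order hψ
    have h : expandVar γ X Y = fix σ Z φ := h
    rw [H.expandVar_eq hY] at h
    cases h
    exact ⟨hY, rfl, Or.inl rfl⟩
  | fix τ Y χ =>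
    have h' := H.eq_kind_body hψ
    simp only [expand, msubst, fix.injEq] at h
    obtain ⟨rfl, rfl, -⟩ := h
    exact ⟨H.mem_order hψ, h'.1, Or.inr (by rw [← h'.1, ← h'.2])⟩
  | _ => simp [expand, msubst] at h

/-- The unfolding of the fixpoint formula that `Z` stands for. -/
theorem unfold_expand (H : Admissible γ X) {Z : Var} {σ : Fix} {φ : Formula Var Atom Act}
    (h : expandVar γ X Z = fix σ Z φ) (hZ : Z ∈ X) :
    Formula.unfold σ Z φ = expand γ X (body γ Z) := by
  have h' := h
  rw [H.expandVar_eq hZ] at h'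
  cases h'
  unfold Formula.unfold
  rw [subst_msubst, ← H.expandVar_eq hZ, Function.update_eq_self]
  · rfl
  · intro W _
    simp [expandVar_closed]

theorem expandVar_eq_of_expand (H : Admissible γ X) {ψ : Formula Var Atom Act}
    (hψ : ψ ∈ γ.subformulas) {σ : Fix}
    {Z : Var} {φ : Formula Var Atom Act} (h : expand γ X ψ = fix σ Z φ) :
    expandVar γ X Z = fix σ Z φ := by
  obtain ⟨hZ, -, rfl | rfl⟩ := H.of_expand_eq_fix hψ h
  · exact h
  · rw [← h, H.expand_fix hψ]

theorem unfold_eq (H : Admissible γ X) {ψ : Formula Var Atom Act} (hψ : ψ ∈ γ.subformulas)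
    {σ : Fix} {Z : Var}
    {φ : Formula Var Atom Act} (h : expand γ X ψ = fix σ Z φ) :
    Formula.unfold σ Z φ = expand γ X (body γ Z) :=
  H.unfold_expand (H.expandVar_eq_of_expand hψ h) (H.of_expand_eq_fix hψ h).1

/-- By guardedness the expanded body is as deep as the body with `Z` left as a variable, which is
one less than the fixpoint formula. Hence chains of non-modal rule applications end. -/
theorem depth_unfold (H : Admissible γ X) {ψ : Formula Var Atom Act} (hψ : ψ ∈ γ.subformulas)
    {σ : Fix} {Z : Var}
    {φ : Formula Var Atom Act} (h : expand γ X ψ = fix σ Z φ) :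
    (Formula.unfold σ Z φ).depth < (fix σ Z φ).depth := by
  have hZ := (H.of_expand_eq_fix hψ h).1
  rw [H.unfold_eq hψ h, ← H.expandVar_eq_of_expand hψ h, H.expandVar_eq hZ, expand]
  have hg := H.guarded _ _ _ (H.fix_mem hZ)
  have := depth_msubst_update (E := expandVar γ X) (χ := expandVar γ X Z) (χ' := var Z) hg
  rw [Function.update_eq_self] at this
  rw [this]
  exact Nat.lt_succ_self _

theorem expand_self (H : Admissible γ X) : expand γ X γ = γ := by
  have := msubst_congr (φ := γ) (E := expandVar γ X) (E' := var)
    (by intro Z hZ; rw [show γ.freeVars = ∅ from H.closed] at hZ; exact hZ.elim)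
  rw [expand, this, msubst_var]

end Admissible

end
end MuCalc
-- Semantics: ordinal approximants of fixpoints and the valuations they define
namespace MuCalc
noncomputable section
open Classical
open Formula

variable {Var Atom Act : Type*}

/-! ### Approximants of fixpoints -/

/-- The stages of the approximation of a fixpoint; the fixpoint itself is reached at stage `⊤`. -/
abbrev Stage := WithTop Ordinal.{u}

/-- The approximant at stage `a` of the least or greatest fixpoint of `F`. -/
def approx {S : Type u} (κ : Fix) (F : Set S → Set S) (a : Stage.{u}) : Set S :=
  match κ with
  | Fix.mu => {x | ∃ b, ∃ _h : b < a, x ∈ F (approx Fix.mu F b)}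
  | Fix.nu => {x | ∀ b, ∀ _h : b < a, x ∈ F (approx Fix.nu F b)}
termination_by (wellFounded_lt (α := Stage.{u})).wrap a
decreasing_by all_goals exact _h

section Approx

variable {S : Type u} {F G : Set S → Set S} {a b : Stage.{u}} {x : S}

theorem mem_approx_mu : x ∈ approx Fix.mu F a ↔ ∃ b < a, x ∈ F (approx Fix.mu F b) := by
  rw [approx]; simp

theorem mem_approx_nu : x ∈ approx Fix.nu F a ↔ ∀ b < a, x ∈ F (approx Fix.nu F b) := by
  rw [approx]; simp

theorem approx_mu_mono (h : a ≤ b) : approx Fix.mu F a ⊆ approx Fix.mu F b := fun x hx => by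
  rw [mem_approx_mu] at hx ⊢
  obtain ⟨c, hc, hx⟩ := hx
  exact ⟨c, hc.trans_le h, hx⟩

theorem approx_nu_anti (h : a ≤ b) : approx Fix.nu F b ⊆ approx Fix.nu F a := fun x hx => by
  rw [mem_approx_nu] at hx ⊢
  exact fun c hc => hx c (hc.trans_le h)

theorem approx_mono (hF : Monotone F) (h : ∀ A, F A ⊆ G A) (κ : Fix) (a : Stage.{u}) :
    approx κ F a ⊆ approx κ G a := by
  induction a using WellFoundedLT.induction with
  | ind a ih =>
    intro x hx
    cases κ
    · rw [mem_approx_mu] at hx ⊢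
      obtain ⟨b, hb, hx⟩ := hx
      exact ⟨b, hb, h _ (hF (ih b hb) hx)⟩
    · rw [mem_approx_nu] at hx ⊢
      exact fun b hb => h _ (hF (ih b hb) (hx b hb))

/-- The ordinals of a universe cannot be injected into the subsets of a type of that universe. A
repeated approximant is a pre- or postfixed point, so the approximation has closed off there and
stage `⊤` is the true fixpoint. -/
theorem exists_approx_eq (κ : Fix) (F : Set S → Set S) :
    ∃ a b : Ordinal.{u}, a < b ∧ approx κ F a = approx κ F b := by
  have h := not_injective_of_ordinal.{u} fun a : Ordinal.{u} => approx κ F a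
  simp only [Function.Injective, not_forall] at h
  obtain ⟨a, b, h, hne⟩ := h
  rcases lt_or_gt_of_ne hne with hlt | hlt
  · exact ⟨a, b, hlt, h⟩
  · exact ⟨b, a, hlt, h.symm⟩

theorem approx_mu_subset (hF : Monotone F) {A : Set S} (hA : F A ⊆ A) (a : Stage.{u}) :
    approx Fix.mu F a ⊆ A := by
  induction a using WellFoundedLT.induction with
  | ind a ih =>
    intro x hx
    rw [mem_approx_mu] at hx
    obtain ⟨b, hb, hx⟩ := hx
    exact hA (hF (ih b hb) hx)

theorem subset_approx_nu (hF : Monotone F) {A : Set S} (hA : A ⊆ F A) (a : Stage.{u}) :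
    A ⊆ approx Fix.nu F a := by
  induction a using WellFoundedLT.induction with
  | ind a ih =>
    intro x hx
    rw [mem_approx_nu]
    exact fun b hb => hF (ih b hb) (hA hx)

theorem apply_approx_mu_top (hF : Monotone F) :
    F (approx Fix.mu F ⊤) ⊆ approx Fix.mu F ⊤ := by
  obtain ⟨a, b, hab, h⟩ := exists_approx_eq Fix.mu F
  have h1 : F (approx Fix.mu F a) ⊆ approx Fix.mu F a := fun x hx => by
    rw [h, mem_approx_mu]
    exact ⟨a, WithTop.coe_lt_coe.2 hab, hx⟩
  exact fun x hx => approx_mu_mono le_top (h1 (hF (approx_mu_subset hF h1 ⊤) hx))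

theorem approx_nu_top_subset_apply (hF : Monotone F) :
    approx Fix.nu F ⊤ ⊆ F (approx Fix.nu F ⊤) := by
  obtain ⟨a, b, hab, h⟩ := exists_approx_eq Fix.nu F
  have h1 : approx Fix.nu F a ⊆ F (approx Fix.nu F a) := fun x hx => by
    rw [h, mem_approx_nu] at hx
    exact hx a (WithTop.coe_lt_coe.2 hab)
  exact fun x hx => hF (subset_approx_nu hF h1 ⊤) (h1 (approx_nu_anti le_top hx))

theorem approx_mu_top (hF : Monotone F) : approx Fix.mu F ⊤ = ⋂₀ {A | F A ⊆ A} :=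
  subset_antisymm (Set.subset_sInter fun _ hA => approx_mu_subset hF hA ⊤)
    (Set.sInter_subset_of_mem (apply_approx_mu_top hF))

theorem approx_nu_top (hF : Monotone F) : approx Fix.nu F ⊤ = ⋃₀ {A | A ⊆ F A} :=
  subset_antisymm (Set.subset_sUnion_of_mem (approx_nu_top_subset_apply hF))
    (Set.sUnion_subset fun _ hA => subset_approx_nu hF hA ⊤)

theorem apply_approx_top (hF : Monotone F) (κ : Fix) :
    F (approx κ F ⊤) = approx κ F ⊤ := by
  cases κ
  · refine subset_antisymm (apply_approx_mu_top hF) fun x hx => ?_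
    rw [mem_approx_mu] at hx
    obtain ⟨b, hb, hx⟩ := hx
    exact hF (approx_mu_mono le_top) hx
  · refine subset_antisymm (fun x hx => ?_) (approx_nu_top_subset_apply hF)
    rw [mem_approx_nu]
    exact fun b hb => hF (approx_nu_anti le_top) hx

end Approx

/-! ### Monotonicity and dependence on the free variables -/

section Sem

variable {S : Type u} (T : Model Atom Act S)

theorem sem_mono {φ : Formula Var Atom Act} {V V' : Var → Set S} (h : ∀ Z, V Z ⊆ V' Z) :
    sem T V φ ⊆ sem T V' φ := by
  induction φ generalizing V V' with
  | var Z => exact h Z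
  | atom _ | natom _ | tt | ff => exact subset_rfl
  | and φ ψ ih₁ ih₂ => exact Set.inter_subset_inter (ih₁ h) (ih₂ h)
  | or φ ψ ih₁ ih₂ => exact Set.union_subset_union (ih₁ h) (ih₂ h)
  | box a φ ih => exact fun s hs t ht => ih h (hs t ht)
  | dia a φ ih => exact fun s ⟨t, ht, hs⟩ => ⟨t, ht, ih h hs⟩
  | fix σ Y φ ih =>
    have hu : ∀ A Z, Function.update V Y A Z ⊆ Function.update V' Y A Z := by
      intro A Z
      by_cases hZ : Z = Y
      · subst hZ; simp
      · simpa [hZ] using h Z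
    cases σ with
    | mu => exact Set.sInter_subset_sInter fun A hA => (ih (hu A)).trans hA
    | nu => exact Set.sUnion_subset_sUnion fun A hA => subset_trans hA (ih (hu A))

theorem sem_congr {φ : Formula Var Atom Act} {V V' : Var → Set S}
    (h : ∀ Z ∈ φ.freeVars, V Z = V' Z) : sem T V φ = sem T V' φ := by
  induction φ generalizing V V' with
  | var Z => exact h Z rfl
  | atom _ | natom _ | tt | ff => rfl
  | and φ ψ ih₁ ih₂ | or φ ψ ih₁ ih₂ =>
    simp only [sem]
    rw [ih₁ fun Z hZ => h Z (Or.inl hZ), ih₂ fun Z hZ => h Z (Or.inr hZ)]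
  | box a φ ih | dia a φ ih =>
    simp only [sem]
    rw [ih h]
  | fix σ Y φ ih =>
    have hu : ∀ A, sem T (Function.update V Y A) φ = sem T (Function.update V' Y A) φ := by
      intro A
      apply ih
      intro Z hZ
      by_cases hZY : Z = Y
      · subst hZY; simp
      · simpa [hZY] using h Z ⟨hZ, hZY⟩
    cases σ <;> simp only [sem, hu]

theorem sem_update_monotone (V : Var → Set S) (Z : Var) (φ : Formula Var Atom Act) :
    Monotone fun A => sem T (Function.update V Z A) φ := by
  intro A B hAB
  apply sem_mono
  intro Y
  by_cases hY : Y = Z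
  · subst hY; simpa using hAB
  · simp [hY]

theorem sem_fix_eq_approx (V : Var → Set S) (κ : Fix) (Z : Var) (φ : Formula Var Atom Act) :
    sem T V (fix κ Z φ) = approx κ (fun A => sem T (Function.update V Z A) φ) ⊤ := by
  cases κ with
  | mu => rw [approx_mu_top (sem_update_monotone T V Z φ)]; rfl
  | nu => rw [approx_nu_top (sem_update_monotone T V Z φ)]; rfl

/-! ### Valuations by approximants -/

/-- The valuation interpreting each variable `Z` of `γ` by the approximant at stage `σ Z` of its
fixpoint formula. -/
def env (γ : Formula Var Atom Act) (X : List Var) (σ : Var → Stage.{u}) (Z : Var) : Set S :=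
  -- The default `∅` is only there for termination: it is never read at a free variable of the body.
  approx (kind γ Z) (fun A => sem T (Function.update
    (fun W => if _h : pos X W < pos X Z then env γ X σ W else ∅) Z A) (body γ Z)) (σ Z)
termination_by pos X Z

namespace Admissible

variable {γ : Formula Var Atom Act} {X : List Var}

theorem env_eq (H : Admissible γ X) (σ : Var → Stage.{u}) {Z : Var} (hZ : Z ∈ X) :
    env T γ X σ Z = approx (kind γ Z)
    (fun A => sem T (Function.update (env T γ X σ) Z A) (body γ Z)) (σ Z) := by
  rw [env]
  congr 1
  funext A
  apply sem_congr
  intro W hW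
  by_cases hWZ : W = Z
  · subst hWZ; simp
  · simp only [Function.update_of_ne hWZ, dif_pos (H.pos_lt_of_mem_freeVars hZ hW hWZ).1]

theorem env_congr (H : Admissible γ X) {σ σ' : Var → Stage.{u}} {Z : Var} (hZ : Z ∈ X)
    (h : ∀ Y ∈ X, pos X Y ≤ pos X Z → σ Y = σ' Y) : env T γ X σ Z = env T γ X σ' Z := by
  induction hn : pos X Z using Nat.strong_induction_on generalizing Z with
  | _ n ih =>
    subst hn
    rw [H.env_eq T σ hZ, H.env_eq T σ' hZ, h Z hZ le_rfl]
    congr 1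
    funext A
    apply sem_congr
    intro W hW
    by_cases hWZ : W = Z
    · subst hWZ; simp
    · simp only [Function.update_of_ne hWZ]
      obtain ⟨hlt, hWX⟩ := H.pos_lt_of_mem_freeVars hZ hW hWZ
      exact ih _ hlt hWX (fun Y hY hle => h Y hY (hle.trans hlt.le)) rfl

theorem env_update_self (H : Admissible γ X) (σ : Var → Stage.{u}) {Z : Var} (hZ : Z ∈ X)
    (b : Stage.{u}) :
    env T γ X (Function.update σ Z b) Z = approx (kind γ Z)
      (fun A => sem T (Function.update (env T γ X σ) Z A) (body γ Z)) b := by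
  rw [H.env_eq T _ hZ, Function.update_self]
  congr 1
  funext A
  apply sem_congr
  intro W hW
  by_cases hWZ : W = Z
  · subst hWZ; simp
  · simp only [Function.update_of_ne hWZ]
    obtain ⟨hlt, hWX⟩ := H.pos_lt_of_mem_freeVars hZ hW hWZ
    refine H.env_congr T hWX fun Y _ hle => Function.update_of_ne ?_ _ _
    rintro rfl
    omega

/-- The other free variables of the body precede `Z`, and their interpretations do not depend on the
stage of `Z`. -/
theorem sem_update_env (H : Admissible γ X) (σ : Var → Stage.{u}) {Z : Var} (hZ : Z ∈ X)
    (b : Stage.{u}) :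
    sem T (Function.update (env T γ X σ) Z (approx (kind γ Z)
      (fun A => sem T (Function.update (env T γ X σ) Z A) (body γ Z)) b)) (body γ Z) =
    sem T (env T γ X (Function.update σ Z b)) (body γ Z) := by
  apply sem_congr
  intro W hW
  by_cases hWZ : W = Z
  · subst hWZ
    rw [Function.update_self, H.env_update_self T σ hZ]
  · rw [Function.update_of_ne hWZ]
    obtain ⟨hlt, hWX⟩ := H.pos_lt_of_mem_freeVars hZ hW hWZ
    refine H.env_congr T hWX fun Y _ hle => (Function.update_of_ne ?_ _ _).symm
    rintro rfl
    omega

theorem mem_env_mu (H : Admissible γ X) {σ : Var → Stage.{u}} {Z : Var} (hZ : Z ∈ X)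
    (hk : kind γ Z = Fix.mu) {x : S} :
    x ∈ env T γ X σ Z ↔ ∃ b < σ Z, x ∈ sem T (env T γ X (Function.update σ Z b)) (body γ Z) := by
  simp only [← H.sem_update_env T σ hZ]
  rw [H.env_eq T σ hZ, hk, mem_approx_mu]

theorem mem_env_nu (H : Admissible γ X) {σ : Var → Stage.{u}} {Z : Var} (hZ : Z ∈ X)
    (hk : kind γ Z = Fix.nu) {x : S} :
    x ∈ env T γ X σ Z ↔ ∀ b < σ Z, x ∈ sem T (env T γ X (Function.update σ Z b)) (body γ Z) := by
  simp only [← H.sem_update_env T σ hZ]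
  rw [H.env_eq T σ hZ, hk, mem_approx_nu]

theorem sem_fix_env (H : Admissible γ X) (σ : Var → Stage.{u}) {Z : Var} (hZ : Z ∈ X) :
    sem T (env T γ X σ) (fix (kind γ Z) Z (body γ Z)) = env T γ X (Function.update σ Z ⊤) Z := by
  rw [sem_fix_eq_approx, H.env_update_self T σ hZ]

/-- Stage `⊤` is the fixpoint itself, so unfolding there costs no stage. This handles μ-formulas in
the soundness proof and ν-formulas in the completeness proof. -/
theorem env_of_top (H : Admissible γ X) {σ : Var → Stage.{u}} {Z : Var} (hZ : Z ∈ X) (h : σ Z = ⊤) :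
    env T γ X σ Z = sem T (env T γ X σ) (body γ Z) := by
  have := apply_approx_top (sem_update_monotone T (env T γ X σ) Z (body γ Z)) (kind γ Z)
  rw [← h, ← H.env_eq T σ hZ] at this
  simp only [Function.update_eq_self] at this
  exact this.symm

/-- Raising the stages of the `ν`-variables shrinks the valuation. -/
theorem env_anti (H : Admissible γ X) {σ σ' : Var → Stage.{u}} {Z : Var} (hZ : Z ∈ X)
    (hν : ∀ Y ∈ X, kind γ Y = Fix.nu → σ Y ≤ σ' Y)
    (hμ : ∀ Y ∈ X, kind γ Y = Fix.mu → σ Y = σ' Y) : env T γ X σ' Z ⊆ env T γ X σ Z := by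
  induction hn : pos X Z using Nat.strong_induction_on generalizing Z with
  | _ n ih =>
    subst hn
    rw [H.env_eq T σ hZ, H.env_eq T σ' hZ]
    have h1 : ∀ A, sem T (Function.update (env T γ X σ') Z A) (body γ Z) ⊆
        sem T (Function.update (env T γ X σ) Z A) (body γ Z) := by
      intro A
      -- The inclusion is known only for free variables of the body, whereas `sem_mono` asks for all
      -- variables. Intersecting the two valuations changes nothing on the free variables and makes
      -- the inclusion hold everywhere.
      have : sem T (Function.update (env T γ X σ') Z A) (body γ Z) =
          sem T (Function.update (fun W => env T γ X σ' W ∩ env T γ X σ W) Z A) (body γ Z) := by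
        apply sem_congr
        intro W hW
        by_cases hWZ : W = Z
        · subst hWZ; simp
        · simp only [Function.update_of_ne hWZ]
          obtain ⟨hlt, hWX⟩ := H.pos_lt_of_mem_freeVars hZ hW hWZ
          exact (Set.inter_eq_left.2 (ih _ hlt hWX rfl)).symm
      rw [this]
      apply sem_mono
      intro W
      by_cases hWZ : W = Z
      · subst hWZ; simp
      · simp only [Function.update_of_ne hWZ]
        exact Set.inter_subset_right
    refine (approx_mono (sem_update_monotone T _ _ _) h1 (kind γ Z) (σ' Z)).trans ?_
    cases hk : kind γ Z
    · rw [hμ Z hZ hk]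
    · exact approx_nu_anti (hν Z hZ hk)

theorem sem_env_anti (H : Admissible γ X) {σ σ' : Var → Stage.{u}} {ψ : Formula Var Atom Act}
    (hψ : ψ ∈ γ.subformulas)
    (hν : ∀ Y ∈ X, kind γ Y = Fix.nu → σ Y ≤ σ' Y)
    (hμ : ∀ Y ∈ X, kind γ Y = Fix.mu → σ Y = σ' Y) :
    sem T (env T γ X σ') ψ ⊆ sem T (env T γ X σ) ψ := by
  have : sem T (env T γ X σ') ψ = sem T (fun W => env T γ X σ' W ∩ env T γ X σ W) ψ := by
    apply sem_congr
    intro W hW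
    rcases mem_freeVars_or_exists_fix hψ hW with h | ⟨κ, χ, h, -⟩
    · rw [show γ.freeVars = ∅ from H.closed] at h
      exact h.elim
    · exact (Set.inter_eq_left.2 (H.env_anti T (H.mem_order h) hν hμ)).symm
  rw [this]
  exact sem_mono T fun W => Set.inter_subset_right

end Admissible

end Sem

end
end MuCalc
-- Annotations: the order on them, and the invariants of reachable sequents
namespace MuCalc
noncomputable section
open Classical
open Formula

variable {Var Atom Act : Type*}

/-! ### Lists of names -/

/-- If the whole initial segment survives a deletion, nothing before or inside it was deleted, so it
remains initial. -/
theorem prefix_of_sublist {α : Type*} {w w₀ q : List α} (hw : w.Nodup) (h : w₀.Sublist w)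
    (hq : q <+: w) (hsub : q ⊆ w₀) : q <+: w₀ := by
  induction h generalizing q with
  | slnil => exact hq
  | cons a h ih =>
    rw [List.nodup_cons] at hw
    cases q with
    | nil => exact ⟨_, rfl⟩
    | cons b q =>
      rw [List.cons_prefix_cons] at hq
      obtain ⟨rfl, hq⟩ := hq
      exact (hw.1 (h.subset (hsub (by simp)))).elim
  | cons_cons a h ih =>
    rw [List.nodup_cons] at hw
    cases q with
    | nil => exact ⟨_, rfl⟩
    | cons b q =>
      rw [List.cons_prefix_cons] at hq ⊢
      obtain ⟨rfl, hq⟩ := hq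
      refine ⟨rfl, ih hw.2 hq fun x hx => ?_⟩
      rcases List.mem_cons.1 (hsub (List.mem_cons_of_mem _ hx)) with rfl | h'
      · exact (hw.1 (hq.subset hx)).elim
      · exact h'

theorem eq_of_append_cons_eq_concat {α : Type*} {a b v : List α} {z : α}
    (h : a ++ z :: b = v ++ [z]) (hz : z ∉ v) : a = v := by
  rcases List.eq_nil_or_concat b with rfl | ⟨b, y, rfl⟩
  · exact List.append_cancel_right h
  · have : (a ++ z :: b) ++ [y] = v ++ [z] := by simpa using h
    have := (List.append_inj' this rfl).1
    exact (hz (this ▸ by simp)).elim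

theorem exists_of_append_cons_eq_concat {α : Type*} {a b v : List α} {z z' : α}
    (h : a ++ z' :: b = v ++ [z]) (hz : z' ≠ z) : ∃ b', v = a ++ z' :: b' := by
  rcases List.eq_nil_or_concat b with rfl | ⟨b, y, rfl⟩
  · have := (List.append_inj' h rfl).2
    simp only [List.cons.injEq, and_true] at this
    exact (hz this).elim
  · have : (a ++ z' :: b) ++ [y] = v ++ [z] := by simpa using h
    exact ⟨b, (List.append_inj' this rfl).1.symm⟩

/-- Two different lists differ at a first position. -/
theorem exists_first_difference {α : Type*} {u v : List α} (h : u ≠ v) :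
    ∃ c, (∃ a u', u = c ++ a :: u' ∧ v = c) ∨ (∃ b v', v = c ++ b :: v' ∧ u = c) ∨
      ∃ a b u' v', a ≠ b ∧ u = c ++ a :: u' ∧ v = c ++ b :: v' := by
  induction u generalizing v with
  | nil =>
    cases v with
    | nil => exact (h rfl).elim
    | cons b v => exact ⟨[], Or.inr (Or.inl ⟨b, v, rfl, rfl⟩)⟩
  | cons a u ih =>
    cases v with
    | nil => exact ⟨[], Or.inl ⟨a, u, rfl, rfl⟩⟩
    | cons b v =>
      by_cases hab : a = b
      · subst hab
        obtain ⟨c, h | h | h⟩ := ih (v := v) (fun e => h (by rw [e]))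
        · obtain ⟨x, u', rfl, rfl⟩ := h
          exact ⟨a :: v, Or.inl ⟨x, u', rfl, rfl⟩⟩
        · obtain ⟨x, v', rfl, rfl⟩ := h
          exact ⟨a :: u, Or.inr (Or.inl ⟨x, v', rfl, rfl⟩)⟩
        · obtain ⟨x, y, u', v', hxy, rfl, rfl⟩ := h
          exact ⟨a :: c, Or.inr (Or.inr ⟨x, y, u', v', hxy, rfl, rfl⟩)⟩
      · exact ⟨[], Or.inr (Or.inr ⟨a, b, u, v, hab, rfl, rfl⟩)⟩

/-- `w'` results from `w` by deleting names and then appending new ones. -/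
def NamesStep (w w' : List (Name Var)) : Prop :=
  ∃ w₀ new, w' = w₀ ++ new ∧ w₀.Sublist w ∧ ∀ n ∈ new, n ∉ w

theorem NamesStep.prefix_of_subset {w w' q : List (Name Var)} (h : NamesStep w w') (hw : w.Nodup)
    (hq : q <+: w) (hsub : q ⊆ w') : q <+: w' := by
  obtain ⟨w₀, new, rfl, h, hnew⟩ := h
  refine (prefix_of_sublist hw h hq fun x hx => ?_).trans (List.prefix_append _ _)
  rcases List.mem_append.1 (hsub hx) with h' | h'
  · exact h'
  · exact (hnew x h' (hq.subset hx)).elim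

/-- New names go to the end, so whatever precedes an old name is itself old, and deletions do not
reorder. -/
theorem NamesStep.before {w w' : List (Name Var)} (h : NamesStep w w') {n z : Name Var}
    (hnz : Before w' n z) (hz : z ∈ w) : Before w n z := by
  obtain ⟨w₀, new, rfl, h, hnew⟩ := h
  obtain ⟨l₁, l₂, e, h₁, h₂⟩ := List.sublist_append_iff.1 hnz
  rcases List.eq_nil_or_concat l₂ with rfl | ⟨l, y, rfl⟩
  · rw [List.append_nil] at e
    exact (e ▸ h₁ : [n, z].Sublist w₀).trans h
  · have : [n] ++ [z] = (l₁ ++ l) ++ [y] := by simpa using e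
    have := (List.append_inj' this rfl).2
    simp only [List.cons.injEq, and_true] at this
    exact (hnew z (h₂.subset (by simp [this])) hz).elim

/-- Deletions move a surviving name to the left and additions happen behind it; its position can
serve as a descending quantity. -/
theorem NamesStep.pos_le {w w' : List (Name Var)} (h : NamesStep w w') (hw : w.Nodup)
    {n : Name Var} (hn : n ∈ w) (hn' : n ∈ w') : pos w' n ≤ pos w n := by
  obtain ⟨w₀, new, rfl, h, hnew⟩ := h
  have hn₀ : n ∈ w₀ := (List.mem_append.1 hn').resolve_right fun h' => hnew n h' hn
  have : pos (w₀ ++ new) n = pos w₀ n := List.idxOf_append_of_mem hn₀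
  rw [this]
  clear this hnew hn hn'
  unfold pos
  induction h with
  | slnil => exact le_rfl
  | cons a h ih =>
    rw [List.nodup_cons] at hw
    have ha : a ≠ n := fun ha => hw.1 (h.subset (ha ▸ hn₀))
    rw [List.idxOf_cons_ne _ ha]
    exact (ih hw.2 hn₀).trans (Nat.le_succ _)
  | cons_cons a h ih =>
    rw [List.nodup_cons] at hw
    by_cases ha : a = n
    · subst ha; simp
    · rw [List.idxOf_cons_ne _ ha, List.idxOf_cons_ne _ ha]
      exact Nat.succ_le_succ (ih hw.2 ((List.mem_cons.1 hn₀).resolve_left (Ne.symm ha)))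

/-- The names in `u` are sorted by their variables. -/
def SortedNames (X : List Var) (u : List (Name Var)) : Prop :=
  u.Pairwise fun m n => pos X m.var ≤ pos X n.var

theorem not_before_iff {X : List Var} (hX : X.Nodup) {Y Z : Var} (hY : Y ∈ X) :
    ¬ Before X Z Y ↔ pos X Y ≤ pos X Z := by
  rw [before_iff hX]
  simp [hY]

theorem restrict_append (X : List Var) (Z : Var) (u v : List (Name Var)) :
    restrict X Z (u ++ v) = restrict X Z u ++ restrict X Z v := List.filter_append ..

theorem restrict_eq_self {X : List Var} (hX : X.Nodup) {Z : Var} {u : List (Name Var)}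
    (h : ∀ n ∈ u, n.var ∈ X ∧ pos X n.var ≤ pos X Z) : restrict X Z u = u := by
  unfold restrict
  rw [List.filter_eq_self]
  intro n hn
  simpa using (not_before_iff hX (h n hn).1).2 (h n hn).2

theorem restrict_eq_nil {X : List Var} (hX : X.Nodup) {Z : Var} {u : List (Name Var)}
    (h : ∀ n ∈ u, n.var ∈ X ∧ pos X Z < pos X n.var) : restrict X Z u = [] := by
  unfold restrict
  rw [List.filter_eq_nil_iff]
  intro n hn
  simpa using (before_iff hX).2 ⟨(h n hn).2, (h n hn).1⟩

theorem mem_restrict {X : List Var} (hX : X.Nodup) {Z : Var} {u : List (Name Var)} {n : Name Var}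
    (hn : n.var ∈ X) : n ∈ restrict X Z u ↔ n ∈ u ∧ pos X n.var ≤ pos X Z := by
  unfold restrict
  rw [List.mem_filter, ← not_before_iff hX hn]
  simp

/-- For sorted `u`, the list `u ↾ Z` is a prefix of `u`. -/
theorem restrict_append_rest {X : List Var} (hX : X.Nodup) (Z : Var) {u : List (Name Var)}
    (hu : SortedNames X u) (hv : ∀ n ∈ u, n.var ∈ X) :
    ∃ rest, u = restrict X Z u ++ rest ∧ ∀ n ∈ rest, pos X Z < pos X n.var := by
  induction u with
  | nil => exact ⟨[], rfl, by simp⟩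
  | cons a u ih =>
    have hu' := List.pairwise_cons.1 hu
    by_cases ha : pos X a.var ≤ pos X Z
    · obtain ⟨rest, h, hr⟩ := ih hu'.2 fun n hn => hv n (List.mem_cons_of_mem _ hn)
      refine ⟨rest, ?_, hr⟩
      have h1 : restrict X Z [a] = [a] :=
        restrict_eq_self hX (by simpa using ⟨hv a (by simp), ha⟩)
      rw [← List.singleton_append, restrict_append, h1, List.append_assoc, ← h]
    · have : ∀ n ∈ a :: u, pos X Z < pos X n.var := by
        intro n hn
        rcases List.mem_cons.1 hn with rfl | hn
        · omega
        · have := hu'.1 n hn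
          omega
      refine ⟨a :: u, ?_, this⟩
      rw [restrict_eq_nil hX fun n hn => ⟨hv n hn, this n hn⟩]
      rfl

theorem restrict_prefix_self {X : List Var} (hX : X.Nodup) (Z : Var) {u : List (Name Var)}
    (hu : SortedNames X u) (hv : ∀ n ∈ u, n.var ∈ X) : restrict X Z u <+: u := by
  obtain ⟨rest, h, -⟩ := restrict_append_rest hX Z hu hv
  exact ⟨rest, h.symm⟩

/-- The order `⊏_w` on sorted annotations, described at the first difference. -/
def Better (X : List Var) (w u v : List (Name Var)) : Prop :=
  ∃ (j : ℕ) (a : Name Var), u[j]? = some a ∧ (∀ i < j, u[i]? = v[i]?) ∧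
    ∀ b, v[j]? = some b → pos X a.var < pos X b.var ∨ a.var = b.var ∧ Before w a b

/-- In the second alternative of `⊏_w` the first difference is where `v ↾ Z` ends: there `u` has a
name for a variable up to `Z`, while `v` ends or continues with a name for a later variable. -/
theorem better_of_nameSqLt {γ : Formula Var Atom Act} {X : List Var} (hX : X.Nodup)
    {w u v : List (Name Var)} (hu : SortedNames X u) (hv : SortedNames X v)
    (hu' : ∀ n ∈ u, n.var ∈ X) (hv' : ∀ n ∈ v, n.var ∈ X) (h : NameSqLt γ X w u v) :
    Better X w u v := by
  rcases h with ⟨j, a, b, ha, hb, hab, hw, hlt⟩ | ⟨Z, -, hpre, hne⟩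
  · refine ⟨j, a, ha, hlt, fun b' hb' => ?_⟩
    rw [hb] at hb'
    cases hb'
    exact Or.inr ⟨hab, hw⟩
  · obtain ⟨ru, eu, hru⟩ := restrict_append_rest hX Z hu hu'
    obtain ⟨rv, ev, hrv⟩ := restrict_append_rest hX Z hv hv'
    obtain ⟨t, ht⟩ := hpre
    cases t with
    | nil => exact (hne (by simpa using ht)).elim
    | cons a t =>
      rw [← ht] at eu
      have ha : pos X a.var ≤ pos X Z := by
        have : a ∈ restrict X Z u := by rw [← ht]; simp
        have hau : a ∈ u := by rw [eu]; simp
        exact ((mem_restrict hX (hu' a hau)).1 this).2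
      refine ⟨(restrict X Z v).length, a, ?_, fun i hi => ?_, fun b hb => ?_⟩
      · rw [eu, List.append_assoc]; simp
      · rw [eu]
        conv_rhs => rw [ev]
        rw [List.append_assoc, List.getElem?_append_left hi, List.getElem?_append_left hi]
      · left
        have hb' : (restrict X Z v ++ rv)[(restrict X Z v).length]? = some b := by
          rw [← ev]; exact hb
        rw [List.getElem?_append_right le_rfl] at hb'
        exact ha.trans_lt (hrv b (List.mem_of_getElem? hb'))

theorem Better.ne {X : List Var} {w u v : List (Name Var)} (hw : w.Nodup) (h : Better X w u v) :
    u ≠ v := by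
  rintro rfl
  obtain ⟨j, a, ha, -, h⟩ := h
  rcases h a ha with h | ⟨-, h⟩
  · exact lt_irrefl _ h
  · exact lt_irrefl _ ((before_iff hw).1 h).1

/-- Restricting both sides to the variable of `a` leaves at least `c ++ [a]` on the left and exactly
`c` on the right. -/
theorem nameSqLt_of_pos_lt {γ : Formula Var Atom Act} {X : List Var} (hX : X.Nodup)
    {w c u' v' : List (Name Var)} {a : Name Var} (hu : SortedNames X (c ++ a :: u'))
    (hu' : ∀ n ∈ c ++ a :: u', n.var ∈ X) (ha : γ.IsNuVariable a.var)
    (hv' : ∀ n ∈ v', n.var ∈ X ∧ pos X a.var < pos X n.var) :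
    NameSqLt γ X w (c ++ a :: u') (c ++ v') := by
  right
  refine ⟨a.var, ha, ?_⟩
  have hc : restrict X a.var c = c := by
    apply restrict_eq_self hX
    intro n hn
    exact ⟨hu' n (by simp [hn]), (List.pairwise_append.1 hu).2.2 n hn a (by simp)⟩
  have ha' : restrict X a.var [a] = [a] :=
    restrict_eq_self hX (by simpa using hu' a (by simp))
  rw [← List.singleton_append, restrict_append, restrict_append, restrict_append, hc, ha',
    restrict_eq_nil hX hv']
  simp

/-- Of two different annotations one is below the other. -/
theorem nameSqLt_total {γ : Formula Var Atom Act} {X : List Var} (hX : X.Nodup)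
    {w u v : List (Name Var)} (hu : SortedNames X u) (hv : SortedNames X v)
    (hw : ∀ n ∈ w, n.var ∈ X ∧ γ.IsNuVariable n.var) (hnd : w.Nodup)
    (huw : u ⊆ w) (hvw : v ⊆ w) (hne : u ≠ v) :
    NameSqLt γ X w u v ∨ NameSqLt γ X w v u := by
  have hu' : ∀ n ∈ u, n.var ∈ X := fun n hn => (hw n (huw hn)).1
  have hv' : ∀ n ∈ v, n.var ∈ X := fun n hn => (hw n (hvw hn)).1
  obtain ⟨c, ⟨a, u', rfl, rfl⟩ | ⟨b, v', rfl, rfl⟩ | ⟨a, b, u', v', hab, rfl, rfl⟩⟩ :=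
    exists_first_difference hne
  · left
    have := nameSqLt_of_pos_lt (γ := γ) (w := w) (v' := []) hX hu hu'
      (hw a (huw (by simp))).2 (by simp)
    simpa using this
  · right
    have := nameSqLt_of_pos_lt (γ := γ) (w := w) (v' := []) hX hv hv'
      (hw b (hvw (by simp))).2 (by simp)
    simpa using this
  · have haw : a ∈ w := huw (by simp)
    have hbw : b ∈ w := hvw (by simp)
    have key : ∀ {b : Name Var} {v' : List (Name Var)} {p : ℕ}, SortedNames X (c ++ b :: v') →
        p < pos X b.var → ∀ n ∈ b :: v', p < pos X n.var := by
      intro b v' p hs hp n hn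
      have := (List.pairwise_append.1 hs).2.1
      rcases List.mem_cons.1 hn with rfl | hn
      · exact hp
      · exact hp.trans_le ((List.pairwise_cons.1 this).1 n hn)
    rcases lt_trichotomy (pos X a.var) (pos X b.var) with h | h | h
    · exact Or.inl (nameSqLt_of_pos_lt hX hu hu' (hw a haw).2 fun n hn =>
        ⟨hv' n (by simp only [List.mem_append]; exact Or.inr hn), key hv h n hn⟩)
    · have hvar : a.var = b.var := pos_injOn (hw a haw).1 h
      have hlt : ∀ {a b : Name Var} {u' v' : List (Name Var)}, a.var = b.var → Before w a b →
          NameLt w (c ++ a :: u') (c ++ b :: v') := by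
        intro a b u' v' hvar hb
        refine ⟨c.length, a, b, by simp, by simp, hvar, hb, fun i hi => ?_⟩
        rw [List.getElem?_append_left hi, List.getElem?_append_left hi]
      rcases lt_or_gt_of_ne (fun e => hab (pos_injOn haw e) : pos w a ≠ pos w b) with h | h
      · exact Or.inl (Or.inl (hlt hvar ((before_iff hnd).2 ⟨h, hbw⟩)))
      · exact Or.inr (Or.inl (hlt hvar.symm ((before_iff hnd).2 ⟨h, haw⟩)))
    · exact Or.inr (nameSqLt_of_pos_lt hX hv hv' (hw b hbw).2 fun n hn =>
        ⟨hu' n (by simp only [List.mem_append]; exact Or.inr hn), key hu h n hn⟩)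

/-! ### Invariants of the sequents in a proof tree -/

/-- The formulas that the subformulas of `γ` stand for. -/
def closureSet (γ : Formula Var Atom Act) (X : List Var) : Set (Formula Var Atom Act) :=
  expand γ X '' γ.subformulas

/-- The properties shared by all sequents that can be reached from `⊢ γ`. -/
structure Good (γ : Formula Var Atom Act) (X : List Var) (s : Sequent Var Atom Act) : Prop where
  nodup : s.names.Nodup
  nu : ∀ n ∈ s.names, n.var ∈ X ∧ γ.IsNuVariable n.var
  idx_lt : ∀ n ∈ s.names, n.idx < γ.length
  mem_closure : ∀ p ∈ s.fmls, p.1 ∈ closureSet γ X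
  sublist : ∀ p ∈ s.fmls, p.2.Sublist s.names
  sorted : ∀ p ∈ s.fmls, SortedNames X p.2
  occurs : ∀ n ∈ s.names, ∃ p ∈ s.fmls, n ∈ p.2
  share : ∀ p ∈ s.fmls, ∀ q ∈ s.fmls, ∀ z a b a' b',
    p.2 = a ++ z :: b → q.2 = a' ++ z :: b' → a = a'

theorem mem_keep {w : List (Name Var)} {Δ : Set (NFormula Var Atom Act)} {n : Name Var} :
    n ∈ keep w Δ ↔ n ∈ w ∧ ∃ p ∈ Δ, n ∈ p.2 := by
  unfold keep
  rw [List.mem_filter]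
  simp

theorem keep_sublist (w : List (Name Var)) (Δ : Set (NFormula Var Atom Act)) :
    (keep w Δ).Sublist w := List.filter_sublist

theorem namesStep_keep (w : List (Name Var)) (Δ : Set (NFormula Var Atom Act)) :
    NamesStep w (keep w Δ) :=
  ⟨keep w Δ, [], (List.append_nil _).symm, keep_sublist _ _, by simp⟩

theorem keep_eq_self {w : List (Name Var)} {Δ : Set (NFormula Var Atom Act)}
    (h : ∀ n ∈ w, ∃ p ∈ Δ, n ∈ p.2) : keep w Δ = w := by
  unfold keep
  rw [List.filter_eq_self]
  intro n hn
  simpa using h n hn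

theorem sublist_keep {w u : List (Name Var)} {Δ : Set (NFormula Var Atom Act)}
    (hu : u.Sublist w) (h : ∀ n ∈ u, ∃ p ∈ Δ, n ∈ p.2) : u.Sublist (keep w Δ) := by
  have := hu.filter fun n => ∃ p ∈ Δ, n ∈ p.2
  rwa [List.filter_eq_self.2 (by intro n hn; simpa using h n hn)] at this

namespace Good

variable {γ : Formula Var Atom Act} {X : List Var} {s : Sequent Var Atom Act}

theorem var_mem (hs : Good γ X s) {p : NFormula Var Atom Act} (hp : p ∈ s.fmls) {n : Name Var}
    (hn : n ∈ p.2) : n.var ∈ X := (hs.nu n ((hs.sublist p hp).subset hn)).1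

/-- A sequent remains good if annotations are replaced by prefixes. -/
theorem of_prefixes (hs : Good γ X s) {Δ : Set (NFormula Var Atom Act)}
    (h : ∀ p ∈ Δ, p.1 ∈ closureSet γ X ∧ ∃ q ∈ s.fmls, p.2 <+: q.2) :
    Good γ X ⟨keep s.names Δ, Δ⟩ where
  nodup := hs.nodup.sublist (keep_sublist _ _)
  nu n hn := hs.nu n (mem_keep.1 hn).1
  idx_lt n hn := hs.idx_lt n (mem_keep.1 hn).1
  mem_closure p hp := (h p hp).1
  sublist p hp := by
    obtain ⟨-, q, hq, hpq⟩ := h p hp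
    exact sublist_keep (hpq.sublist.trans (hs.sublist q hq)) fun n hn => ⟨p, hp, hn⟩
  sorted p hp := by
    obtain ⟨-, q, hq, hpq⟩ := h p hp
    exact (hs.sorted q hq).sublist hpq.sublist
  occurs n hn := (mem_keep.1 hn).2
  share p hp q hq z a b a' b' e e' := by
    obtain ⟨-, p', hp', c, ec⟩ := h p hp
    obtain ⟨-, q', hq', c', ec'⟩ := h q hq
    refine hs.share p' hp' q' hq' z a (b ++ c) a' (b' ++ c') ?_ ?_
    · rw [← ec, e]; simp
    · rw [← ec', e']; simp

/-- A sequent remains good if a new name is appended to the annotation of a formula. -/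
theorem concat {w v : List (Name Var)} {Γ : Set (NFormula Var Atom Act)}
    {φ : Formula Var Atom Act} {z : Name Var} (hs : Good γ X ⟨w, Γ ∪ {(φ, v)}⟩) (hz : z ∉ w)
    (hzX : z.var ∈ X ∧ γ.IsNuVariable z.var) (hi : z.idx < γ.length)
    (hv : ∀ n ∈ v, pos X n.var ≤ pos X z.var) :
    Good γ X ⟨w ++ [z], Γ ∪ {(φ, v ++ [z])}⟩ where
  nodup := by
    have := hs.nodup
    simp only [List.nodup_append', List.nodup_singleton, true_and, this,
      List.disjoint_singleton, hz, not_false_eq_true]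
  nu n hn := by
    rcases List.mem_append.1 hn with hn | hn
    · exact hs.nu n hn
    · rw [List.mem_singleton.1 hn]; exact hzX
  idx_lt n hn := by
    rcases List.mem_append.1 hn with hn | hn
    · exact hs.idx_lt n hn
    · rw [List.mem_singleton.1 hn]; exact hi
  mem_closure p hp := by
    rcases hp with hp | rfl
    · exact hs.mem_closure p (Or.inl hp)
    · exact hs.mem_closure (φ, v) (Or.inr rfl)
  sublist p hp := by
    rcases hp with hp | rfl
    · exact (hs.sublist p (Or.inl hp)).trans (List.sublist_append_left _ _)
    · exact (hs.sublist (φ, v) (Or.inr rfl)).append (List.Sublist.refl _)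
  sorted p hp := by
    rcases hp with hp | rfl
    · exact hs.sorted p (Or.inl hp)
    · refine List.pairwise_append.2 ⟨hs.sorted (φ, v) (Or.inr rfl), by simp, ?_⟩
      simpa using hv
  occurs n hn := by
    rcases List.mem_append.1 hn with hn | hn
    · obtain ⟨p, hp | rfl, h⟩ := hs.occurs n hn
      · exact ⟨p, Or.inl hp, h⟩
      · exact ⟨_, Or.inr rfl, by simp [show n ∈ v from h]⟩
    · exact ⟨_, Or.inr rfl, by simp [List.mem_singleton.1 hn]⟩
  share p hp q hq y a b a' b' e e' := by
    have hzv : z ∉ v := fun h => hz ((hs.sublist (φ, v) (Or.inr rfl)).subset h)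
    -- The new name occurs only directly after `v`; any other name is preceded by the same names as
    -- before the extension.
    by_cases hy : y = z
    · subst hy
      have key : ∀ p ∈ Γ ∪ {(φ, v ++ [y])}, ∀ a b, p.2 = a ++ y :: b → a = v := by
        rintro p (hp | rfl) a b e
        · exact (hz ((hs.sublist p (Or.inl hp)).subset (by rw [e]; simp))).elim
        · exact eq_of_append_cons_eq_concat e.symm hzv
      rw [key p hp a b e, key q hq a' b' e']
    · have key : ∀ p ∈ Γ ∪ {(φ, v ++ [z])}, ∀ a b, p.2 = a ++ y :: b →
          ∃ p' ∈ Γ ∪ {(φ, v)}, ∃ b', p'.2 = a ++ y :: b' := by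
        rintro p (hp | rfl) a b e
        · exact ⟨p, Or.inl hp, b, e⟩
        · exact ⟨(φ, v), Or.inr rfl, exists_of_append_cons_eq_concat e.symm hy⟩
      obtain ⟨p', hp', c, ec⟩ := key p hp a b e
      obtain ⟨q', hq', c', ec'⟩ := key q hq a' b' e'
      exact hs.share p' hp' q' hq' y a c a' c' ec ec'

theorem finite (hs : Good γ X s) : s.fmls.Finite := by
  have h1 : (closureSet γ X).Finite := (subformulas_finite_ncard γ).1.image _
  have h2 : {u : List (Name Var) | u.Sublist s.names}.Finite := by
    refine (List.finite_toSet s.names.sublists).subset fun u hu => ?_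
    exact List.mem_sublists.2 hu
  exact (h1.prod h2).subset fun p hp => ⟨hs.mem_closure p hp, hs.sublist p hp⟩

theorem of_initial (H : Admissible γ X) : Good γ X (initial γ) := by
  refine ⟨?_, ?_, ?_, ?_, ?_, ?_, ?_, ?_⟩ <;> simp only [initial, Set.mem_singleton_iff,
    forall_eq, List.nodup_nil, List.not_mem_nil, false_imp_iff, implies_true]
  · exact ⟨γ, self_mem_subformulas γ, H.expand_self⟩
  · exact List.Sublist.refl _
  · exact List.Pairwise.nil
  · intro z a b a' b' e
    simp at e

end Good

namespace Admissible

variable {γ : Formula Var Atom Act} {X : List Var}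

theorem of_expand_eq_or (H : Admissible γ X) {χ φ ψ : Formula Var Atom Act}
    (hχ : χ ∈ γ.subformulas) (e : expand γ X χ = φ.or ψ) : ∃ φ' ∈ γ.subformulas,
      ∃ ψ' ∈ γ.subformulas, χ = φ'.or ψ' ∧ expand γ X φ' = φ ∧ expand γ X ψ' = ψ := by
  cases χ with
  | var Y => exact absurd e (by rw [expand, msubst, H.expandVar_eq (H.var_mem_order hχ)]; simp)
  | or φ' ψ' =>
    cases e
    exact ⟨φ', subformulas_trans hχ (Or.inr (Or.inl (self_mem_subformulas _))),
      ψ', subformulas_trans hχ (Or.inr (Or.inr (self_mem_subformulas _))), rfl, rfl, rfl⟩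
  | _ => simp [expand, msubst] at e

theorem of_expand_eq_and (H : Admissible γ X) {χ φ ψ : Formula Var Atom Act}
    (hχ : χ ∈ γ.subformulas) (e : expand γ X χ = φ.and ψ) : ∃ φ' ∈ γ.subformulas,
      ∃ ψ' ∈ γ.subformulas, χ = φ'.and ψ' ∧ expand γ X φ' = φ ∧ expand γ X ψ' = ψ := by
  cases χ with
  | var Y => exact absurd e (by rw [expand, msubst, H.expandVar_eq (H.var_mem_order hχ)]; simp)
  | and φ' ψ' =>
    cases e
    exact ⟨φ', subformulas_trans hχ (Or.inr (Or.inl (self_mem_subformulas _))),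
      ψ', subformulas_trans hχ (Or.inr (Or.inr (self_mem_subformulas _))), rfl, rfl, rfl⟩
  | _ => simp [expand, msubst] at e

theorem of_expand_eq_box (H : Admissible γ X) {a : Act} {χ φ : Formula Var Atom Act}
    (hχ : χ ∈ γ.subformulas) (e : expand γ X χ = box a φ) :
    ∃ φ' ∈ γ.subformulas, χ = box a φ' ∧ expand γ X φ' = φ := by
  cases χ with
  | var Y => exact absurd e (by rw [expand, msubst, H.expandVar_eq (H.var_mem_order hχ)]; simp)
  | box a' φ' =>
    cases e
    exact ⟨φ', subformulas_trans hχ (Or.inr (self_mem_subformulas _)), rfl, rfl⟩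
  | _ => simp [expand, msubst] at e

theorem of_expand_eq_dia (H : Admissible γ X) {a : Act} {χ φ : Formula Var Atom Act}
    (hχ : χ ∈ γ.subformulas) (e : expand γ X χ = dia a φ) :
    ∃ φ' ∈ γ.subformulas, χ = dia a φ' ∧ expand γ X φ' = φ := by
  cases χ with
  | var Y => exact absurd e (by rw [expand, msubst, H.expandVar_eq (H.var_mem_order hχ)]; simp)
  | dia a' φ' =>
    cases e
    exact ⟨φ', subformulas_trans hχ (Or.inr (self_mem_subformulas _)), rfl, rfl⟩
  | _ => simp [expand, msubst] at e

theorem mem_closure_or (H : Admissible γ X) {φ ψ : Formula Var Atom Act}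
    (h : φ.or ψ ∈ closureSet γ X) : φ ∈ closureSet γ X ∧ ψ ∈ closureSet γ X := by
  obtain ⟨χ, hχ, e⟩ := h
  obtain ⟨φ', hφ, ψ', hψ, -, rfl, rfl⟩ := H.of_expand_eq_or hχ e
  exact ⟨⟨φ', hφ, rfl⟩, ⟨ψ', hψ, rfl⟩⟩

theorem mem_closure_and (H : Admissible γ X) {φ ψ : Formula Var Atom Act}
    (h : φ.and ψ ∈ closureSet γ X) : φ ∈ closureSet γ X ∧ ψ ∈ closureSet γ X := by
  obtain ⟨χ, hχ, e⟩ := h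
  obtain ⟨φ', hφ, ψ', hψ, -, rfl, rfl⟩ := H.of_expand_eq_and hχ e
  exact ⟨⟨φ', hφ, rfl⟩, ⟨ψ', hψ, rfl⟩⟩

theorem mem_closure_box (H : Admissible γ X) {a : Act} {φ : Formula Var Atom Act}
    (h : box a φ ∈ closureSet γ X) : φ ∈ closureSet γ X := by
  obtain ⟨χ, hχ, e⟩ := h
  obtain ⟨φ', hφ, -, rfl⟩ := H.of_expand_eq_box hχ e
  exact ⟨φ', hφ, rfl⟩

theorem mem_closure_dia (H : Admissible γ X) {a : Act} {φ : Formula Var Atom Act}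
    (h : dia a φ ∈ closureSet γ X) : φ ∈ closureSet γ X := by
  obtain ⟨χ, hχ, e⟩ := h
  obtain ⟨φ', hφ, -, rfl⟩ := H.of_expand_eq_dia hχ e
  exact ⟨φ', hφ, rfl⟩

theorem mem_closure_unfold (H : Admissible γ X) {σ : Fix} {Z : Var} {φ : Formula Var Atom Act}
    (h : fix σ Z φ ∈ closureSet γ X) : Formula.unfold σ Z φ ∈ closureSet γ X ∧ Z ∈ X ∧
      σ = kind γ Z := by
  obtain ⟨χ, hχ, e⟩ := h
  have h := H.of_expand_eq_fix hχ e
  exact ⟨⟨body γ Z, H.body_mem h.1, (H.unfold_eq hχ e).symm⟩, h.1, h.2.1⟩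

/-- Every rule replaces annotations by prefixes of existing ones, `restrict` being a prefix on
sorted annotations; only the ν-rule then appends a fresh name. -/
theorem good_logicStep (H : Admissible γ X) {s t : Sequent Var Atom Act}
    {cs : List (Sequent Var Atom Act)} (hs : Good γ X s) (h : LogicStep γ X s cs) (ht : t ∈ cs) :
    Good γ X t ∧ NamesStep s.names t.names := by
  -- For `∨` and `∧` the annotation passes on unchanged, so no name disappears and `keep` deletes
  -- nothing.
  have same : ∀ {w : List (Name Var)} {Γ Δ : Set (NFormula Var Atom Act)}
      {φ : Formula Var Atom Act} {u : List (Name Var)}, Good γ X ⟨w, Γ ∪ {(φ, u)}⟩ →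
      (∀ p ∈ Δ, p.1 ∈ closureSet γ X ∧ p.2 = u) → Δ.Nonempty →
      Good γ X ⟨w, Γ ∪ Δ⟩ ∧ NamesStep w w := by
    intro w Γ Δ φ u hs hΔ hne
    have h1 : keep w (Γ ∪ Δ) = w := by
      apply keep_eq_self
      intro n hn
      obtain ⟨p, hp | rfl, hnp⟩ := hs.occurs n hn
      · exact ⟨p, Or.inl hp, hnp⟩
      · obtain ⟨q, hq⟩ := hne
        exact ⟨q, Or.inr hq, by rw [(hΔ q hq).2]; exact hnp⟩
    have h2 := hs.of_prefixes (Δ := Γ ∪ Δ) <| by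
      rintro p (hp | hp)
      · exact ⟨hs.mem_closure p (Or.inl hp), p, Or.inl hp, List.prefix_rfl⟩
      · exact ⟨(hΔ p hp).1, _, Or.inr rfl, by rw [(hΔ p hp).2]⟩
    rw [h1] at h2
    exact ⟨h2, w, [], by simp, List.Sublist.refl _, by simp⟩
  have rpre : ∀ {w : List (Name Var)} {Γ : Set (NFormula Var Atom Act)}
      {φ : Formula Var Atom Act} {u : List (Name Var)} (Z : Var), Good γ X ⟨w, Γ ∪ {(φ, u)}⟩ →
      restrict X Z u <+: u := by
    intro w Γ φ u Z hs
    exact restrict_prefix_self H.order.nodup Z (hs.sorted (φ, u) (Or.inr rfl))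
      fun n hn => hs.var_mem (p := (φ, u)) (Or.inr rfl) hn
  cases h with
  | or w Γ φ ψ u =>
    rw [List.mem_singleton] at ht
    subst ht
    have := H.mem_closure_or (hs.mem_closure _ (Or.inr rfl))
    refine same hs ?_ ⟨_, Or.inl rfl⟩
    rintro p (rfl | rfl)
    · exact ⟨this.1, rfl⟩
    · exact ⟨this.2, rfl⟩
  | and w Γ φ ψ u =>
    have := H.mem_closure_and (hs.mem_closure _ (Or.inr rfl))
    simp only [List.mem_cons, List.not_mem_nil, or_false] at ht
    rcases ht with rfl | rfl
    · exact same hs (by rintro p rfl; exact ⟨this.1, rfl⟩) ⟨_, rfl⟩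
    · exact same hs (by rintro p rfl; exact ⟨this.2, rfl⟩) ⟨_, rfl⟩
  | modal w Γ Δ a ψ u =>
    rw [List.mem_singleton] at ht
    subst ht
    refine ⟨hs.of_prefixes ?_, namesStep_keep _ _⟩
    rintro p (hp | rfl)
    · exact ⟨H.mem_closure_dia (hs.mem_closure (dia a p.1, p.2) (Or.inl (Or.inr ⟨p, hp, rfl⟩))),
        (dia a p.1, p.2), Or.inl (Or.inr ⟨p, hp, rfl⟩), List.prefix_rfl⟩
    · exact ⟨H.mem_closure_box (hs.mem_closure _ (Or.inr rfl)), _, Or.inr rfl, List.prefix_rfl⟩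
  | mu w Γ Z φ u =>
    rw [List.mem_singleton] at ht
    subst ht
    refine ⟨hs.of_prefixes ?_, namesStep_keep _ _⟩
    rintro p (hp | rfl)
    · exact ⟨hs.mem_closure p (Or.inl hp), p, Or.inl hp, List.prefix_rfl⟩
    · exact ⟨(H.mem_closure_unfold (hs.mem_closure _ (Or.inr rfl))).1, _, Or.inr rfl, rpre Z hs⟩
  | nu w Γ Z φ u i hi =>
    rw [List.mem_singleton] at ht
    subst ht
    obtain ⟨h1, h2, h3⟩ := H.mem_closure_unfold (hs.mem_closure _ (Or.inr rfl))
    refine ⟨Good.concat (hs.of_prefixes ?_) (fun h => hi.2.1 (mem_keep.1 h).1)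
      ⟨h2, H.kind_eq_nu_iff.1 ⟨h2, h3.symm⟩⟩ hi.1 ?_,
      _, [⟨Z, i⟩], rfl, keep_sublist _ _, by simpa using hi.2.1⟩
    · rintro p (hp | rfl)
      · exact ⟨hs.mem_closure p (Or.inl hp), p, Or.inl hp, List.prefix_rfl⟩
      · exact ⟨h1, _, Or.inr rfl, rpre Z hs⟩
    · intro n hn
      have hnu := (rpre Z hs).subset hn
      exact ((mem_restrict H.order.nodup (hs.var_mem (Or.inr rfl) hnu)).1 hn).2

theorem good_structStep {s t : Sequent Var Atom Act} {r : Option (Name Var)}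
    (hs : Good γ X s) (h : StructStep γ X s r t) :
    Good γ X t ∧ NamesStep s.names t.names := by
  cases h with
  | thin w Γ φ u v h =>
    refine ⟨hs.of_prefixes ?_, namesStep_keep _ _⟩
    rintro p (hp | rfl)
    · exact ⟨hs.mem_closure p (Or.inl hp), p, Or.inl hp, List.prefix_rfl⟩
    · exact ⟨hs.mem_closure (φ, u) (Or.inr (Or.inl rfl)), _, Or.inr (Or.inl rfl),
        List.prefix_rfl⟩
  | reset w Γ Δ u z hΔ hz hΓ =>
    refine ⟨hs.of_prefixes ?_, namesStep_keep _ _⟩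
    rintro p (hp | ⟨p, hp, rfl⟩)
    · exact ⟨hs.mem_closure p (Or.inl hp), p, Or.inl hp, List.prefix_rfl⟩
    · obtain ⟨z', u', -, e⟩ := hz p hp
      exact ⟨hs.mem_closure p (Or.inr hp), p, Or.inr hp, z' :: u', by rw [e]; simp⟩

end Admissible

end
end MuCalc
-- Soundness: refutations with least stages
namespace MuCalc
noncomputable section
open Classical
open Formula

variable {Var Atom Act : Type*}

/-! ### Stages attached to names -/

/-- The stage of the variable `Z` in a formula annotated by `u`: that of the last name for `Z`. -/
def stageOf (O : Name Var → Stage.{u}) (u : List (Name Var)) (Z : Var) : Stage.{u} :=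
  match (u.filter fun n => n.var = Z).getLast? with
  | none => ⊤
  | some n => O n

/-- The stages of the names for each variable decrease strictly along `u`. -/
def DecreasingStages (O : Name Var → Stage.{u}) (u : List (Name Var)) : Prop :=
  u.Pairwise fun m n => m.var = n.var → O n < O m

/-- Stages decrease along the names of one variable, so the last name has the least stage. -/
theorem stageOf_le_of_mem {O : Name Var → Stage.{u}} {u : List (Name Var)}
    (h : DecreasingStages O u) {n : Name Var} (hn : n ∈ u) : stageOf O u n.var ≤ O n := by
  unfold stageOf
  have hd : (u.filter fun m => m.var = n.var).Pairwise fun m m' => O m' < O m := by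
    refine (h.filter _).imp_of_mem fun ha hb hab => ?_
    simp only [List.mem_filter, decide_eq_true_eq] at ha hb
    exact hab (ha.2.trans hb.2.symm)
  have hn' : n ∈ u.filter fun m => m.var = n.var := by simp [hn]
  rcases List.eq_nil_or_concat (u.filter fun m => m.var = n.var) with e | ⟨l, m, e⟩
  · rw [e] at hn'
    simp at hn'
  · rw [e] at hd hn' ⊢
    simp only [List.concat_eq_append, List.getLast?_append, List.getLast?_singleton,
      Option.some_or] at hd hn' ⊢
    rcases List.mem_append.1 hn' with hn' | hn'
    · exact ((List.pairwise_append.1 hd).2.2 n hn' m (by simp)).le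
    · rw [List.mem_singleton.1 hn']

theorem stageOf_eq_top {O : Name Var → Stage.{u}} {u : List (Name Var)} {Z : Var}
    (h : ∀ n ∈ u, n.var ≠ Z) : stageOf O u Z = ⊤ := by
  unfold stageOf
  rw [List.filter_eq_nil_iff.2 (by simpa using h)]
  rfl

theorem stageOf_le_of_sublist {O : Name Var → Stage.{u}} {u u' : List (Name Var)}
    (h : DecreasingStages O u) (hu : u'.Sublist u) (Z : Var) :
    stageOf O u Z ≤ stageOf O u' Z := by
  cases e : (u'.filter fun n => n.var = Z).getLast? with
  | none =>
    rw [show stageOf O u' Z = ⊤ by unfold stageOf; rw [e]]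
    exact le_top
  | some n =>
    rw [show stageOf O u' Z = O n by unfold stageOf; rw [e]]
    have := List.mem_of_getLast? e
    simp only [List.mem_filter, decide_eq_true_eq] at this
    rw [← this.2]
    exact stageOf_le_of_mem h (hu.subset this.1)

theorem stageOf_concat (O : Name Var → Stage.{u}) (u : List (Name Var)) (z : Name Var) :
    stageOf O (u ++ [z]) = Function.update (stageOf O u) z.var (O z) := by
  funext Z
  by_cases hZ : Z = z.var
  · subst hZ
    rw [Function.update_self]
    simp [stageOf]
  · rw [Function.update_of_ne hZ]
    simp [stageOf, Ne.symm hZ]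

theorem stageOf_congr {O O' : Name Var → Stage.{u}} {u : List (Name Var)}
    (h : ∀ n ∈ u, O n = O' n) : stageOf O u = stageOf O' u := by
  funext Z
  unfold stageOf
  cases e : (u.filter fun n => n.var = Z).getLast? with
  | none => rfl
  | some n =>
    have := List.mem_of_getLast? e
    simp only [List.mem_filter, decide_eq_true_eq] at this
    exact h n this.1

theorem DecreasingStages.congr {O O' : Name Var → Stage.{u}} {u : List (Name Var)}
    (h : DecreasingStages O u) (hO : ∀ n ∈ u, O n = O' n) : DecreasingStages O' u :=
  h.imp_of_mem fun ha hb hab hv => by rw [← hO _ ha, ← hO _ hb]; exact hab hv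

/-! ### The lexicographic order of stages -/

theorem map_le_map_of_le {O O' : Name Var → Stage.{u}} {q : List (Name Var)}
    (h : ∀ n ∈ q, O' n ≤ O n) : q.map O' ≤ q.map O := by
  induction q with
  | nil => exact le_rfl
  | cons z q ih =>
    have ih := ih fun n hn => h n (List.mem_cons_of_mem _ hn)
    rw [List.map_cons, List.map_cons]
    rcases (h z (by simp)).lt_or_eq with h | h
    · exact (List.cons_lt_cons_iff.2 (Or.inl h)).le
    · rcases ih.lt_or_eq with h' | h'
      · exact (List.cons_lt_cons_iff.2 (Or.inr ⟨h, h'⟩)).le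
      · rw [h, h']

theorem map_lt_map_of_lt {O O' : Name Var → Stage.{u}} {q : List (Name Var)}
    (h : ∀ n ∈ q, O' n ≤ O n) {z : Name Var} (hz : z ∈ q) (hlt : O' z < O z) :
    q.map O' < q.map O := by
  refine lt_of_le_of_ne (map_le_map_of_le h) fun e => ?_
  exact hlt.ne (List.map_inj_left.1 e z hz)

/-- Both images of `q` have the same length, so they differ inside `q`, before the common extension
matters. -/
theorem map_append_lt {O O' : Name Var → Stage.{u}} {q r : List (Name Var)}
    (h : q.map O' < q.map O) : (q ++ r).map O' < (q ++ r).map O := by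
  induction q with
  | nil => exact (lt_irrefl _ h).elim
  | cons z q ih =>
    simp only [List.cons_append, List.map_cons, List.cons_lt_cons_iff] at h ⊢
    exact h.imp id fun h => ⟨h.1, ih h.2⟩

theorem map_prefix_le_map {O O' : Name Var → Stage.{u}} {q w : List (Name Var)}
    (hq : q <+: w) (h : w.map O' ≤ w.map O) : q.map O' ≤ q.map O := by
  obtain ⟨r, rfl⟩ := hq
  exact not_lt.1 fun hlt => (map_append_lt hlt).not_ge h

/-- The lexicographic order on lists of all lengths is not well-founded; with `q` fixed it is a
finite iterated lexicographic product of well-orders. -/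
theorem wellFounded_map_lt (q : List (Name Var)) :
    WellFounded fun O' O : Name Var → Stage.{u} => q.map O' < q.map O := by
  induction q with
  | nil => exact ⟨fun O => ⟨_, fun O' h => (lt_irrefl _ h).elim⟩⟩
  | cons z q ih =>
    have h1 := WellFounded.prod_lex (wellFounded_lt (α := Stage.{u})) ih
    have h2 := InvImage.wf (fun O : Name Var → Stage.{u} => (O z, O)) h1
    refine Subrelation.wf (fun {O' O} h => ?_) h2
    rw [List.map_cons, List.map_cons, List.cons_lt_cons_iff] at h
    exact Prod.lex_def.2 h

/-! ### Refutations of sequents -/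

section Soundness

variable {S : Type u} (T : Model Atom Act S) (γ : Formula Var Atom Act) (X : List Var)

/-- The state `x` refutes the annotated formula `p` when each `ν`-variable is approximated at the
stage of its last name. -/
def RefutesFormula (O : Name Var → Stage.{u}) (x : S) (p : NFormula Var Atom Act) : Prop :=
  ∃ ψ ∈ γ.subformulas, expand γ X ψ = p.1 ∧ (∀ n ∈ p.2, ψ ∈ (body γ n.var).subformulas) ∧
    DecreasingStages O p.2 ∧ x ∉ sem T (env T γ X (stageOf O p.2)) ψ

/-- The state `x` refutes all the formulas of the sequent. -/
def Refutes (O : Name Var → Stage.{u}) (x : S) (s : Sequent Var Atom Act) : Prop :=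
  ∀ p ∈ s.fmls, RefutesFormula T γ X O x p

variable {T γ X}

theorem RefutesFormula.congr {O O' : Name Var → Stage.{u}} {x : S} {p : NFormula Var Atom Act}
    (h : RefutesFormula T γ X O x p) (hO : ∀ n ∈ p.2, O n = O' n) :
    RefutesFormula T γ X O' x p := by
  obtain ⟨ψ, hψ, e, hn, hd, hx⟩ := h
  exact ⟨ψ, hψ, e, hn, hd.congr hO, by rwa [← stageOf_congr hO]⟩

/-- Supplies the stage that Reset gives to a name of stage `a`: still below `a`, but bounding all
the finitely many smaller stages in use. The name `y` covers the case that no name of `w` is below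
`a`. -/
theorem exists_max_lt (w : List (Name Var)) (O : Name Var → Stage.{u}) {a : Stage.{u}}
    {y : Name Var} (hy : O y < a) : ∃ m < a, ∀ n ∈ w, O n < a → O n ≤ m := by
  induction w with
  | nil => exact ⟨O y, hy, by simp⟩
  | cons z w ih =>
    obtain ⟨m, hm, h⟩ := ih
    by_cases hz : O z < a
    · refine ⟨max m (O z), max_lt hm hz, fun n hn hlt => ?_⟩
      rcases List.mem_cons.1 hn with rfl | hn
      · exact le_max_right _ _
      · exact (h n hn hlt).trans (le_max_left _ _)
    · refine ⟨m, hm, fun n hn hlt => ?_⟩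
      rcases List.mem_cons.1 hn with rfl | hn
      · exact (hz hlt).elim
      · exact h n hn hlt

namespace Admissible

/-- Names belong to ν-variables only, so annotations always leave the μ-variables at stage `⊤`. -/
theorem var_ne_of_kind_mu (H : Admissible γ X) {s : Sequent Var Atom Act} (hs : Good γ X s)
    {p : NFormula Var Atom Act} (hp : p ∈ s.fmls) {Y : Var} (hY : kind γ Y = Fix.mu) :
    ∀ n ∈ p.2, n.var ≠ Y := by
  rintro n hn rfl
  have h := hs.nu n ((hs.sublist p hp).subset hn)
  rw [(H.kind_eq_nu_iff.2 h.2).2] at hY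
  cases hY

/-- Thin only discards formulas. For Reset, each affected annotation contains a later name of the
same variable with a smaller stage, so `z` can take over a stage strictly below its own that is
still large enough for all these formulas. -/
theorem refutes_structStep (H : Admissible γ X) {s t : Sequent Var Atom Act}
    {r : Option (Name Var)} (hs : Good γ X s) (h : StructStep γ X s r t)
    {O : Name Var → Stage.{u}} {x : S} (hx : Refutes T γ X O x s) :
    ∃ O', Refutes T γ X O' x t ∧ (∀ n ∈ s.names, O' n ≤ O n) ∧ ∀ z, r = some z → O' z < O z := by
  have hk := fun (p : NFormula Var Atom Act) (hp : p ∈ s.fmls) (Y : Var)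
    (hY : kind γ Y = Fix.mu) => H.var_ne_of_kind_mu hs hp hY
  cases h with
  | thin w Γ φ u v h =>
    refine ⟨O, ?_, fun _ _ => le_rfl, by simp⟩
    rintro p (hp | rfl)
    · exact hx p (Or.inl hp)
    · exact hx _ (Or.inr (Or.inl rfl))
  | reset w Γ Δ u z hΔ hz hΓ =>
    have hlt : ∀ p ∈ Δ, ∀ z' u', z'.var = z.var → p.2 = u ++ z :: z' :: u' →
        O z' < O z ∧ z ∉ u ∧ ∀ n ∈ u, n.var = z.var → O z < O n := by
      intro p hp z' u' hv e
      obtain ⟨ψ, -, -, -, hd, -⟩ := hx p (Or.inr hp)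
      rw [e] at hd
      have hd' := List.pairwise_append.1 hd
      have h3 : ∀ n ∈ u, n.var = z.var → O z < O n := fun n hn => hd'.2.2 n hn z (by simp)
      exact ⟨(List.pairwise_cons.1 hd'.2.1).1 z' (by simp) hv.symm,
        fun hzu => lt_irrefl _ (h3 z hzu rfl), h3⟩
    obtain ⟨p₀, hp₀⟩ := hΔ
    obtain ⟨y, u₀, hy, e₀⟩ := hz p₀ hp₀
    obtain ⟨m, hm, hmax⟩ := exists_max_lt w O (hlt p₀ hp₀ y u₀ hy e₀).1
    have hzu := (hlt p₀ hp₀ y u₀ hy e₀).2.1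
    have hne : ∀ {u : List (Name Var)}, z ∉ u → ∀ n ∈ u, O n = Function.update O z m n := by
      intro u hu n hn
      rw [Function.update_of_ne]
      rintro rfl
      exact hu hn
    refine ⟨Function.update O z m, ?_, fun n _ => ?_, ?_⟩
    · rintro q (hq | ⟨p, hp, rfl⟩)
      · exact (hx q (Or.inl hq)).congr (hne (hΓ q hq))
      · obtain ⟨z', u', hv, e⟩ := hz p hp
        obtain ⟨hz', -, hu⟩ := hlt p hp z' u' hv e
        obtain ⟨ψ, hψ, eψ, hb, hd, hnot⟩ := hx p (Or.inr hp)
        have hpre : (u ++ [z]).Sublist p.2 := by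
          rw [e]
          exact (List.Sublist.refl u).append (by simp)
        refine ⟨ψ, hψ, eψ, fun n hn => hb n (hpre.subset hn), ?_, ?_⟩
        · refine List.pairwise_append.2 ⟨?_, by simp, ?_⟩
          · have := hd.sublist hpre
            exact DecreasingStages.congr (List.pairwise_append.1 this).1 (hne hzu)
          · intro n hn z₁ hz₁ hv₁
            rw [List.mem_singleton.1 hz₁] at hv₁ ⊢
            rw [← hne hzu n hn, Function.update_self]
            exact hm.trans (hu n hn hv₁)
        -- No variable has a smaller stage after the Reset than before, and larger ν-stages make the
        -- formula harder to satisfy, so it remains refuted.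
        · refine fun hin => hnot (H.sem_env_anti T hψ (fun Y _ _ => ?_) (fun Y _ hY => ?_) hin)
          · rw [stageOf_concat, ← stageOf_congr (hne hzu), Function.update_self]
            by_cases hYz : Y = z.var
            · subst hYz
              rw [Function.update_self, ← hv]
              have hz'p : z' ∈ p.2 := by rw [e]; simp
              exact (stageOf_le_of_mem hd hz'p).trans
                (hmax z' ((hs.sublist p (Or.inr hp)).subset hz'p) hz')
            · rw [Function.update_of_ne hYz]
              exact stageOf_le_of_sublist hd ((List.sublist_append_left _ _).trans hpre) Y
          · have := hk p (Or.inr hp) Y hY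
            rw [stageOf_eq_top this, stageOf_eq_top fun n hn => this n (hpre.subset hn)]
    · by_cases hn : n = z
      · subst hn; simpa using hm.le
      · rw [Function.update_of_ne hn]
    · rintro z' ⟨⟩
      simpa using hm

/-- A refuted fixpoint formula is refuted as a variable, also after dropping the names of the
variables that come after it. -/
theorem refutes_fix (H : Admissible γ X) {s : Sequent Var Atom Act} (hs : Good γ X s) {κ : Fix}
    {Z : Var} {φ : Formula Var Atom Act} {u : List (Name Var)} (hp : (fix κ Z φ, u) ∈ s.fmls)
    {O : Name Var → Stage.{u}} {x : S} (hx : RefutesFormula T γ X O x (fix κ Z φ, u)) :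
    Z ∈ X ∧ κ = kind γ Z ∧ Formula.unfold κ Z φ = expand γ X (body γ Z) ∧
      (∀ n ∈ restrict X Z u, body γ Z ∈ (body γ n.var).subformulas) ∧
      DecreasingStages O (restrict X Z u) ∧
      x ∉ env T γ X (stageOf O (restrict X Z u)) Z := by
  obtain ⟨ψ, hψ, e, hb, hd, hnot⟩ := hx
  obtain ⟨hZ, hκ, hrep⟩ := H.of_expand_eq_fix hψ e
  have hsub : (restrict X Z u).Sublist u := List.filter_sublist
  refine ⟨hZ, hκ, H.unfold_eq hψ e, fun n hn => ?_, hd.sublist hsub, ?_⟩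
  · have hnX := hs.var_mem hp (hsub.subset hn)
    have hn' := (mem_restrict H.order.nodup hnX).1 hn
    have := hb n hn'.1
    rcases hrep with rfl | rfl
    · exact H.body_mem_of_var_mem hnX this hn'.2
    · exact subformulas_trans this body_mem_subformulas
  · have h1 : x ∉ env T γ X (stageOf O u) Z := by
      rcases hrep with rfl | rfl
      · exact hnot
      · rw [H.sem_fix_env T _ hZ] at hnot
        -- A name for `Z` in `u` would place the fixpoint formula inside its own body; so `Z` is
        -- unnamed and its stage is that of the full fixpoint.
        have htop : stageOf O u Z = ⊤ := by
          apply stageOf_eq_top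
          rintro n hn rfl
          exact fix_notMem_subformulas_body (hb n hn)
        rwa [← htop, Function.update_eq_self] at hnot
    refine fun hin => h1 (H.env_anti T hZ (fun Y _ _ => ?_) (fun Y _ hY => ?_) hin)
    · exact stageOf_le_of_sublist hd hsub Y
    · have := H.var_ne_of_kind_mu hs hp hY
      rw [stageOf_eq_top this, stageOf_eq_top fun n hn => this n (hsub.subset hn)]

/-- The refuting state moves only at the modal rule, to a successor that falsifies the box formula
and hence all the selected diamond formulas. Stages of old names never change. -/
theorem refutes_logicStep (H : Admissible γ X) {s : Sequent Var Atom Act}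
    {cs : List (Sequent Var Atom Act)} (hs : Good γ X s) (h : LogicStep γ X s cs)
    {O : Name Var → Stage.{u}} {x : S} (hx : Refutes T γ X O x s) :
    ∃ t ∈ cs, ∃ O' x', Refutes T γ X O' x' t ∧ ∀ n ∈ s.names, O' n ≤ O n := by
  cases h with
  | or w Γ φ ψ u =>
    refine ⟨_, List.mem_singleton_self _, O, x, ?_, fun _ _ => le_rfl⟩
    obtain ⟨χ, hχ, e, hb, hd, hnot⟩ := hx _ (Or.inr rfl)
    obtain ⟨φ', hφ, ψ', hψ, rfl, e₁, e₂⟩ := H.of_expand_eq_or hχ e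
    rintro p (hp | rfl | rfl)
    · exact hx p (Or.inl hp)
    · exact ⟨φ', hφ, e₁, fun n hn => subformulas_trans (hb n hn)
        (Or.inr (Or.inl (self_mem_subformulas _))), hd, fun h => hnot (Or.inl h)⟩
    · exact ⟨ψ', hψ, e₂, fun n hn => subformulas_trans (hb n hn)
        (Or.inr (Or.inr (self_mem_subformulas _))), hd, fun h => hnot (Or.inr h)⟩
  | and w Γ φ ψ u =>
    obtain ⟨χ, hχ, e, hb, hd, hnot⟩ := hx _ (Or.inr rfl)
    obtain ⟨φ', hφ, ψ', hψ, rfl, e₁, e₂⟩ := H.of_expand_eq_and hχ e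
    rcases not_and_or.1 hnot with hnot | hnot
    · refine ⟨_, List.mem_cons_self, O, x, ?_, fun _ _ => le_rfl⟩
      rintro p (hp | rfl)
      · exact hx p (Or.inl hp)
      · exact ⟨φ', hφ, e₁, fun n hn => subformulas_trans (hb n hn)
          (Or.inr (Or.inl (self_mem_subformulas _))), hd, hnot⟩
    · refine ⟨_, List.mem_cons_of_mem _ List.mem_cons_self, O, x, ?_, fun _ _ => le_rfl⟩
      rintro p (hp | rfl)
      · exact hx p (Or.inl hp)
      · exact ⟨ψ', hψ, e₂, fun n hn => subformulas_trans (hb n hn)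
          (Or.inr (Or.inr (self_mem_subformulas _))), hd, hnot⟩
  | modal w Γ Δ a ψ u =>
    obtain ⟨χ, hχ, e, hb, hd, hnot⟩ := hx _ (Or.inr rfl)
    obtain ⟨ψ', hψ, rfl, e₁⟩ := H.of_expand_eq_box hχ e
    simp only [sem, Set.mem_ofPred_eq, not_forall] at hnot
    obtain ⟨y, hxy, hnot⟩ := hnot
    refine ⟨_, List.mem_singleton_self _, O, y, ?_, fun _ _ => le_rfl⟩
    rintro p (hp | rfl)
    · obtain ⟨χ, hχ, e, hb, hd, hnot⟩ := hx (dia a p.1, p.2) (Or.inl (Or.inr ⟨p, hp, rfl⟩))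
      obtain ⟨φ', hφ, rfl, e₁⟩ := H.of_expand_eq_dia hχ e
      exact ⟨φ', hφ, e₁, fun n hn => subformulas_trans (hb n hn)
        (Or.inr (self_mem_subformulas _)), hd, fun h => hnot ⟨y, hxy, h⟩⟩
    · exact ⟨ψ', hψ, e₁, fun n hn => subformulas_trans (hb n hn)
        (Or.inr (self_mem_subformulas _)), hd, hnot⟩
  | mu w Γ Z φ u =>
    obtain ⟨hZ, hκ, eu, hb, hd, hnot⟩ := H.refutes_fix hs (Or.inr rfl) (hx _ (Or.inr rfl))
    refine ⟨_, List.mem_singleton_self _, O, x, ?_, fun _ _ => le_rfl⟩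
    rintro p (hp | rfl)
    · exact hx p (Or.inl hp)
    · refine ⟨body γ Z, H.body_mem hZ, eu.symm, hb, hd, ?_⟩
      rwa [H.env_of_top T hZ] at hnot
      apply stageOf_eq_top
      intro n hn
      exact H.var_ne_of_kind_mu hs (Or.inr rfl) hκ.symm n (List.mem_of_mem_filter hn)
  | nu w Γ Z φ u i hi =>
    obtain ⟨hZ, hκ, eu, hb, hd, hnot⟩ := H.refutes_fix hs (Or.inr rfl) (hx _ (Or.inr rfl))
    rw [H.mem_env_nu T hZ hκ.symm] at hnot
    push Not at hnot
    -- This `b` becomes the stage of the fresh name; it lies below the stages of all earlier names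
    -- for `Z` in the annotation, as decreasing stages require.
    obtain ⟨b, hb', hnot⟩ := hnot
    have hw : ∀ {u : List (Name Var)}, u ⊆ w →
        ∀ n ∈ u, O n = Function.update O ⟨Z, i⟩ b n := by
      intro u hu n hn
      rw [Function.update_of_ne]
      rintro rfl
      exact hi.2.1 (hu hn)
    have hru : restrict X Z u ⊆ w := fun n hn =>
      (hs.sublist _ (Or.inr rfl)).subset (List.mem_of_mem_filter hn)
    refine ⟨_, List.mem_singleton_self _, Function.update O ⟨Z, i⟩ b, x, ?_, fun n hn =>
      (hw (List.Subset.refl w) n hn).ge⟩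
    rintro p (hp | rfl)
    · exact (hx p (Or.inl hp)).congr (hw (hs.sublist p (Or.inl hp)).subset)
    · refine ⟨body γ Z, H.body_mem hZ, eu.symm, ?_, ?_, ?_⟩
      · intro n hn
        rcases List.mem_append.1 hn with hn | hn
        · exact hb n hn
        · rw [List.mem_singleton.1 hn]
          exact self_mem_subformulas _
      · refine List.pairwise_append.2 ⟨hd.congr (hw hru), by simp, ?_⟩
        intro n hn z hz hv
        rw [List.mem_singleton.1 hz] at hv ⊢
        rw [Function.update_self, ← hw hru n hn]
        subst hv
        exact hb'.trans_le (stageOf_le_of_mem hd hn)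
      · rwa [stageOf_concat, ← stageOf_congr (hw hru), Function.update_self]

end Admissible

/-! ### Soundness -/

variable (T γ X)

/-- The stages `O` at a node labelled `s` below the branch `h` are related to lexicographically
minimal stages for all the nodes above it. -/
def Tracked (h : Branch Var Atom Act) (s : Sequent Var Atom Act) (O : Name Var → Stage.{u}) :
    Prop :=
  -- Here `c` is a possible companion and `Oc` its least stages. Names standing before a persistent
  -- name are persistent, and on a persistent initial segment of `c` the stages have not risen
  -- lexicographically, and have fallen if one of its names was reset.
  ∀ h₁ c r h₂, h = h₁ ++ (c, r) :: h₂ → ∃ Oc : Name Var → Stage.{u},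
    (∀ O' x, Refutes T γ X O' x c → ¬ c.names.map O' < c.names.map Oc) ∧
    (∀ z, z ∈ s.names → (∀ e ∈ h₁ ++ [(c, r)], z ∈ e.1.names) → ∀ n, Before s.names n z →
      ∀ e ∈ h₁ ++ [(c, r)], n ∈ e.1.names) ∧
    ∀ q, q <+: c.names → q ⊆ s.names → (∀ z ∈ q, ∀ e ∈ h₁ ++ [(c, r)], z ∈ e.1.names) →
      q <+: s.names ∧ q.map O ≤ q.map Oc ∧
        ∀ e ∈ h₁ ++ [(c, r)], ∀ z ∈ q, e.2 = some z → q.map O < q.map Oc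

variable {T γ X}

/-- Allows least stages to be chosen afresh at each node: a comparison of whole name sequences
restricts to the persistent initial segments. -/
theorem Tracked.of_le {h : Branch Var Atom Act} {s : Sequent Var Atom Act}
    {O O' : Name Var → Stage.{u}} (ht : Tracked T γ X h s O)
    (hle : s.names.map O' ≤ s.names.map O) : Tracked T γ X h s O' := by
  intro h₁ c r h₂ e
  obtain ⟨Oc, h1, h2, h3⟩ := ht h₁ c r h₂ e
  refine ⟨Oc, h1, h2, fun q hq hqs hqe => ?_⟩
  obtain ⟨hp, hl, hr⟩ := h3 q hq hqs hqe
  have := map_prefix_le_map hp hle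
  exact ⟨hp, this.trans hl, fun e he z hz hez => this.trans_lt (hr e he z hz hez)⟩

/-- The minimality hypothesis makes `s` available as a companion; for the older ones the segment
stays initial and its comparison is composed with that of the new step. -/
theorem Tracked.push {h : Branch Var Atom Act} {s t : Sequent Var Atom Act}
    {r : Option (Name Var)} {O O' : Name Var → Stage.{u}} (ht : Tracked T γ X h s O)
    (hs : s.names.Nodup) (hmin : ∀ O' x, Refutes T γ X O' x s → ¬ s.names.map O' < s.names.map O)
    (hstep : NamesStep s.names t.names) (hle : ∀ n ∈ s.names, O' n ≤ O n)
    (hlt : ∀ z, r = some z → O' z < O z) : Tracked T γ X ((s, r) :: h) t O' := by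
  intro h₁ c r' h₂ e
  cases h₁ with
  | nil =>
    simp only [List.nil_append, List.cons.injEq, Prod.mk.injEq] at e
    obtain ⟨⟨rfl, rfl⟩, rfl⟩ := e
    refine ⟨O, hmin, ?_, ?_⟩
    · intro z hz hze n hn e he
      simp only [List.nil_append, List.mem_singleton, forall_eq] at hze he
      subst he
      exact (hstep.before hn hze).mem_left
    · intro q hq hqt hqe
      have hle' : ∀ n ∈ q, O' n ≤ O n := fun n hn => hle n (hq.subset hn)
      refine ⟨hstep.prefix_of_subset hs hq hqt, map_le_map_of_le hle', fun e he z hz hez => ?_⟩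
      simp only [List.nil_append, List.mem_singleton] at he
      subst he
      exact map_lt_map_of_lt hle' hz (hlt z hez)
  | cons e₁ h₁ =>
    simp only [List.cons_append, List.cons.injEq] at e
    obtain ⟨rfl, e⟩ := e
    obtain ⟨Oc, h1, h2, h3⟩ := ht h₁ c r' h₂ e
    refine ⟨Oc, h1, ?_, ?_⟩
    · intro z hz hze n hn e he
      simp only [List.cons_append, List.mem_cons, forall_eq_or_imp] at hze he
      have hb := hstep.before hn hze.1
      rcases he with rfl | he
      · exact hb.mem_left
      · exact h2 z hze.1 hze.2 n hb e he
    · intro q hq hqt hqe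
      simp only [List.cons_append, List.mem_cons, forall_eq_or_imp] at hqe ⊢
      obtain ⟨hp, hl, hr⟩ := h3 q hq (fun z hz => (hqe z hz).1) fun z hz => (hqe z hz).2
      have hle' : ∀ n ∈ q, O' n ≤ O n := fun n hn => hle n (hp.subset hn)
      have hle'' := map_le_map_of_le hle'
      refine ⟨hstep.prefix_of_subset hs hp hqt, hle''.trans hl, fun z hz hez => ?_,
        fun e he z hz hez => ?_⟩
      · exact (map_lt_map_of_lt hle' hz (hlt z hez)).trans_le hl
      · exact hle''.trans_lt (hr e he z hz hez)

namespace Admissible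

theorem not_refutes_of_proofTree (H : Admissible γ X) {h : Branch Var Atom Act}
    {s : Sequent Var Atom Act} (D : ProofTree γ X h s) (hs : Good γ X s)
    {O : Name Var → Stage.{u}} {x : S} (hx : Refutes T γ X O x s)
    (ht : Tracked T γ X h s O) : False := by
  -- Minimality is taken over all states as well as all stages, so that it depends on the sequent
  -- alone and can be invoked from a repeat for its companion.
  have minimal : ∀ {h : Branch Var Atom Act} {s : Sequent Var Atom Act}
      {O : Name Var → Stage.{u}} {x : S}, Refutes T γ X O x s → Tracked T γ X h s O →
      ∃ O' x', Refutes T γ X O' x' s ∧ Tracked T γ X h s O' ∧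
        ∀ O'' y, Refutes T γ X O'' y s → ¬ s.names.map O'' < s.names.map O' := by
    intro h s O x hx ht
    obtain ⟨O', ⟨x', hx'⟩, hmin⟩ := (wellFounded_map_lt.{u} s.names).has_min
      {O | ∃ x, Refutes T γ X O x s} ⟨O, x, hx⟩
    exact ⟨O', x', hx', ht.of_le (not_lt.1 (hmin O ⟨x, hx⟩)), fun O'' y hy => hmin O'' ⟨y, hy⟩⟩
  induction D generalizing O x with
  | axiomLeaf h s hax =>
    rcases hax with ⟨P, u, v, hP, hN⟩ | ⟨u, hu⟩
    · obtain ⟨ψ, hψ, e, -, -, hnot⟩ := hx _ hP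
      obtain ⟨χ, hχ, e', -, -, hnot'⟩ := hx _ hN
      cases ψ with
      | var Y => exact absurd e (by rw [expand, msubst, H.expandVar_eq (H.var_mem_order hψ)]; simp)
      | atom P' =>
        cases e
        cases χ with
        | var Y =>
          exact absurd e' (by rw [expand, msubst, H.expandVar_eq (H.var_mem_order hχ)]; simp)
        | natom P' => cases e'; exact hnot' hnot
        | _ => simp [expand, msubst] at e'
      | _ => simp [expand, msubst] at e
    · obtain ⟨ψ, hψ, e, -, -, hnot⟩ := hx _ hu
      cases ψ with
      | var Y => exact absurd e (by rw [expand, msubst, H.expandVar_eq (H.var_mem_order hψ)]; simp)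
      | tt => exact hnot trivial
      | _ => simp [expand, msubst] at e
  | repeatLeaf h s hrep =>
    obtain ⟨h₁, h₂, r, e, z, ⟨e₁, he₁, hez⟩, hzs, hze⟩ := hrep
    obtain ⟨Oc, hmin, hbef, hq⟩ := ht h₁ s r h₂ e
    -- The decisive segment consists of the names up to `z`: all of them persist, and the Reset for
    -- `z` lowers its stages lexicographically, against minimality at the companion.
    obtain ⟨l₁, l₂, hl⟩ := List.append_of_mem hzs
    have hpre : l₁ ++ [z] <+: s.names := ⟨l₂, by rw [hl]; simp⟩
    have hsurv : ∀ y ∈ l₁ ++ [z], ∀ e ∈ h₁ ++ [(s, r)], y ∈ e.1.names := by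
      intro y hy
      rcases List.mem_append.1 hy with hy | hy
      · refine hbef z hzs hze y ?_
        unfold Before
        rw [hl]
        exact (List.singleton_sublist.2 hy).append (by simp : [z].Sublist (z :: l₂))
      · rw [List.mem_singleton.1 hy]
        exact hze
    have hlt := (hq _ hpre hpre.subset hsurv).2.2 e₁ he₁ z (by simp) hez
    obtain ⟨t, ht⟩ := hpre
    apply hmin O x hx
    rw [← ht]
    exact map_append_lt hlt
  | structNode h s t r hrep step child ih =>
    obtain ⟨O', x', hx', ht', hmin⟩ := minimal hx ht
    obtain ⟨O'', hx'', hle, hlt⟩ := H.refutes_structStep hs step hx'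
    have hg := good_structStep hs step
    exact ih hg.1 hx'' (ht'.push hs.nodup hmin hg.2 hle hlt)
  | logicNode h s cs hrep hpri step children ih =>
    obtain ⟨O', x', hx', ht', hmin⟩ := minimal hx ht
    obtain ⟨t, htc, O'', x'', hx'', hle⟩ := H.refutes_logicStep hs step hx'
    have hg := H.good_logicStep hs step htc
    exact ih t htc hg.1 hx'' (ht'.push hs.nodup hmin hg.2 hle (by simp))

theorem valid_of_hasProofTree (H : Admissible γ X) (h : HasProofTree γ X) :
    Formula.Valid.{u} γ := by
  intro S T V
  rw [Set.eq_univ_iff_forall]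
  intro x
  by_contra hx
  obtain ⟨D⟩ := h
  refine H.not_refutes_of_proofTree (T := T) D (Good.of_initial H) (O := fun _ => ⊤) (x := x)
    ?_ (by intro h₁ c r h₂ e; simp at e)
  rintro p rfl
  refine ⟨γ, self_mem_subformulas γ, H.expand_self, by simp, List.Pairwise.nil, ?_⟩
  rwa [sem_congr T (V' := V)]
  intro Z hZ
  rw [show γ.freeVars = ∅ from H.closed] at hZ
  exact hZ.elim

end Admissible

end Soundness

end
end MuCalc
-- Completeness: fresh names, termination of the non-modal rules, and traces
namespace MuCalc
noncomputable section
open Classical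
open Formula

variable {Var Atom Act : Type*}

/-! ### Sequents to which no structural rule applies -/

section Names

variable {γ : Formula Var Atom Act} {X : List Var} {s : Sequent Var Atom Act}

theorem Good.length_names_le (hs : Good γ X s) : s.names.length ≤ X.length * γ.length := by
  have hinj : Function.Injective fun n : Name Var => (n.var, n.idx) := by
    rintro ⟨a, i⟩ ⟨b, j⟩ h
    cases h
    rfl
  have hnd := hs.nodup.map hinj
  have hsub : (s.names.map fun n => (n.var, n.idx)).toFinset ⊆
      X.toFinset ×ˢ Finset.range γ.length := by
    intro p hp
    rw [List.mem_toFinset, List.mem_map] at hp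
    obtain ⟨n, hn, rfl⟩ := hp
    simp [(hs.nu n hn).1, hs.idx_lt n hn]
  have := Finset.card_le_card hsub
  rw [List.toFinset_card_of_nodup hnd, List.length_map, Finset.card_product,
    Finset.card_range] at this
  exact this.trans (Nat.mul_le_mul_right _ (List.toFinset_card_le X))

theorem Good.length_le (hs : Good γ X s) {p : NFormula Var Atom Act} (hp : p ∈ s.fmls) :
    p.2.length ≤ X.length * γ.length :=
  (hs.sublist p hp).length_le.trans hs.length_names_le

theorem finite_good (γ : Formula Var Atom Act) (X : List Var) : {s | Good γ X s}.Finite := by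
  let N : Set (Name Var) := {n | n.var ∈ X ∧ n.idx < γ.length}
  have hN : N.Finite := by
    refine Set.Finite.of_finite_image (f := fun n : Name Var => (n.var, n.idx)) ?_ ?_
    · refine ((List.finite_toSet X).prod (Set.finite_lt_nat γ.length)).subset ?_
      rintro _ ⟨n, hn, rfl⟩
      exact hn
    · rintro ⟨a, i⟩ - ⟨b, j⟩ - h
      cases h
      rfl
  have hL : {w : List (Name Var) | w.length ≤ X.length * γ.length ∧ ∀ n ∈ w, n ∈ N}.Finite := by
    have := hN.to_subtype
    refine ((List.finite_length_le N (X.length * γ.length)).image (List.map Subtype.val)).subset ?_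
    rintro w ⟨hw, hmem⟩
    refine ⟨w.pmap Subtype.mk hmem, by simpa using hw, ?_⟩
    simp [List.map_pmap]
  have hC : (closureSet γ X).Finite := (subformulas_finite_ncard γ).1.image _
  refine Set.Finite.of_finite_image (f := fun s : Sequent Var Atom Act => (s.names, s.fmls)) ?_ ?_
  · refine (hL.prod (hC.prod hL).powerset).subset ?_
    rintro _ ⟨s, hs, rfl⟩
    have h1 : ∀ n ∈ s.names, n ∈ N := fun n hn => ⟨(hs.nu n hn).1, hs.idx_lt n hn⟩
    exact ⟨⟨hs.length_names_le, h1⟩, fun p hp => ⟨hs.mem_closure p hp, hs.length_le hp,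
      fun n hn => h1 n ((hs.sublist p hp).subset hn)⟩⟩
  · rintro ⟨w, Γ⟩ - ⟨w', Γ'⟩ - h
    cases h
    rfl

/-- If Thin does not apply, each formula has just one annotation. -/
theorem Admissible.annotation_unique (H : Admissible γ X) (hs : Good γ X s)
    (hno : ¬ ∃ r t, StructStep γ X s r t) {p q : NFormula Var Atom Act} (hp : p ∈ s.fmls)
    (hq : q ∈ s.fmls) (h : p.1 = q.1) : p = q := by
  by_contra hne
  have hne2 : p.2 ≠ q.2 := fun e => hne (Prod.ext h e)
  have thin : ∀ p ∈ s.fmls, ∀ q ∈ s.fmls, p.1 = q.1 → ¬ NameSqLt γ X s.names p.2 q.2 := by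
    rintro ⟨φ, u⟩ hp ⟨_, v⟩ hq rfl hlt
    -- The whole sequent serves as context. The conclusion may still contain the worse annotation,
    -- but only the applicability of Thin matters here.
    have := StructStep.thin (γ := γ) (X := X) s.names s.fmls φ u v hlt
    have e : s.fmls ∪ {(φ, u), (φ, v)} = s.fmls := by
      apply Set.union_eq_self_of_subset_right
      rintro _ (rfl | rfl)
      exacts [hp, hq]
    rw [e] at this
    exact hno ⟨_, _, this⟩
  rcases nameSqLt_total H.order.nodup (hs.sorted p hp) (hs.sorted q hq) hs.nu hs.nodup
    (hs.sublist p hp).subset (hs.sublist q hq).subset hne2 with hlt | hlt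
  · exact thin p hp q hq h hlt
  · exact thin q hq p hp h.symm hlt

/-- If Reset does not apply, each name is the last name for its variable in some annotation. -/
theorem Good.exists_last_name (hs : Good γ X s)
    (hno : ¬ ∃ r t, StructStep γ X s r t) {z : Name Var} (hz : z ∈ s.names) :
    ∃ p ∈ s.fmls, (p.2.filter fun n => n.var = z.var).getLast? = some z := by
  obtain ⟨p₀, hp₀, hzp₀⟩ := hs.occurs z hz
  obtain ⟨u, b₀, e₀⟩ := List.append_of_mem hzp₀
  by_contra hcon
  push Not at hcon
  apply hno
  -- Reset is tried on all formulas whose annotation contains `z`. If `z` is never the last name for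
  -- its variable, it applies.
  have hstep := StructStep.reset (γ := γ) (X := X) s.names {p ∈ s.fmls | z ∉ p.2}
    {p ∈ s.fmls | z ∈ p.2} u z ⟨p₀, hp₀, hzp₀⟩ ?_ (fun p hp => hp.2)
  · have e : {p ∈ s.fmls | z ∉ p.2} ∪ {p ∈ s.fmls | z ∈ p.2} = s.fmls := by
      ext p
      simp only [Set.mem_union, Set.mem_ofPred_eq, ← and_or_left]
      exact and_iff_left (em' _)
    rw [e] at hstep
    exact ⟨_, _, hstep⟩
  · rintro p ⟨hp, hzp⟩
    obtain ⟨a, b, e⟩ := List.append_of_mem hzp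
    -- All occurrences of `z` are preceded by the same names, which provides the common prefix
    -- demanded by Reset.
    obtain rfl := hs.share p hp p₀ hp₀ z a b u b₀ e e₀
    have hlast := hcon p hp
    have hb : ∃ n ∈ b, n.var = z.var := by
      by_contra hb
      push Not at hb
      apply hlast
      have hnil : b.filter (fun n => n.var = z.var) = [] :=
        List.filter_eq_nil_iff.2 (by simpa using hb)
      rw [e, List.filter_append, List.filter_cons_of_pos (by simp), hnil]
      simp
    obtain ⟨n, hn, hnz⟩ := hb
    cases b with
    | nil => simp at hn
    | cons z' u' =>
      -- Annotations are sorted by variables, so the name right after `z` lies between two names for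
      -- the variable of `z` and belongs to it as well.
      refine ⟨z', u', ?_, e⟩
      have hsort := hs.sorted p hp
      rw [e] at hsort
      have h2 := List.pairwise_cons.1 (List.pairwise_append.1 hsort).2.1
      have h3 := h2.1 z' (by simp)
      have h4 : pos X z'.var ≤ pos X n.var := by
        rcases List.mem_cons.1 hn with rfl | hn
        · exact le_rfl
        · exact (List.pairwise_cons.1 h2.2).1 n hn
      rw [hnz] at h4
      exact pos_injOn (hs.var_mem hp (by rw [e]; simp)) (le_antisymm h4 h3)

/-- If no structural rule applies, there is a fresh name for each `ν`-variable. -/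
theorem Admissible.exists_firstFresh (H : Admissible γ X) (hs : Good γ X s)
    (hno : ¬ ∃ r t, StructStep γ X s r t) {Z : Var} (hZ : γ.IsNuVariable Z) :
    ∃ i, FirstFresh γ s.names ⟨Z, i⟩ := by
  by_cases hex : ∃ i, (⟨Z, i⟩ : Name Var) ∉ s.names ∧ i < γ.length
  · refine ⟨Nat.find hex, (Nat.find_spec hex).2, (Nat.find_spec hex).1, fun j hj => ?_⟩
    by_contra hnot
    exact Nat.find_min hex hj ⟨hnot, hj.trans (Nat.find_spec hex).2⟩
  · push Not at hex
    exfalso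
    -- If all names for `Z` were in use, each would be the last one in some annotation. Formulas
    -- have unique annotations, so there would be at least `γ.length` formulas in the closure, more
    -- than γ has subformulas.
    have hall : ∀ j : Fin γ.length, ∃ p ∈ s.fmls,
        (p.2.filter fun n => n.var = Z).getLast? = some ⟨Z, j⟩ := by
      intro j
      have hj : (⟨Z, j⟩ : Name Var) ∈ s.names := by
        by_contra hj
        exact absurd j.2 (not_lt.2 (hex j hj))
      exact hs.exists_last_name hno hj
    choose f hf hlast using hall
    have hinj : Function.Injective fun j => (f j).1 := by
      intro j k hjk
      have := H.annotation_unique hs hno (hf j) (hf k) hjk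
      have h1 := hlast j
      rw [this, hlast k] at h1
      simp only [Option.some.injEq, Name.mk.injEq, true_and] at h1
      exact (Fin.ext h1).symm
    have h1 := Set.ncard_range_of_injective hinj
    have hfin := (subformulas_finite_ncard γ).1
    have h2 : Set.range (fun j => (f j).1) ⊆ closureSet γ X := by
      rintro _ ⟨j, rfl⟩
      exact hs.mem_closure _ (hf j)
    have h3 := Set.ncard_le_ncard h2 (hfin.image _)
    have h4 : (closureSet γ X).ncard ≤ γ.subformulas.ncard := Set.ncard_image_le hfin
    obtain ⟨χ, hχ⟩ := hZ
    have h5 := (subformulas_finite_ncard γ).2.2 ⟨_, _, _, hχ⟩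
    rw [h1, Nat.card_fin] at h3
    omega

end Names

/-! ### A measure that decreases between modal steps -/

theorem finsum_mem_diff_union_lt {α : Type*} {A N : Set α} (f : α → ℕ) (hA : A.Finite)
    (hN : N.Finite) {p : α} (hp : p ∈ A) (h : ∑ᶠ a ∈ N, f a < f p) :
    ∑ᶠ a ∈ A \ {p} ∪ N, f a < ∑ᶠ a ∈ A, f a := by
  have h1 := finsum_mem_union_inter (f := f) (hA.sdiff (t := {p})) hN
  have h2 : ∑ᶠ a ∈ A, f a = f p + ∑ᶠ a ∈ A \ {p}, f a := by
    rw [← finsum_mem_insert f (by simp) (hA.sdiff (t := {p})), Set.insert_sdiff_singleton,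
      Set.insert_eq_of_mem hp]
  omega

/-- The map may identify elements, which can only lower the sum. -/
theorem finsum_mem_image_lt {α : Type*} {A : Set α} (f : α → ℕ) (g : α → α) (hA : A.Finite)
    (hle : ∀ a ∈ A, f (g a) ≤ f a) {p : α} (hp : p ∈ A) (hlt : f (g p) < f p) :
    ∑ᶠ a ∈ g '' A, f a < ∑ᶠ a ∈ A, f a := by
  have h2 : (hA.image g).toFinset = hA.toFinset.image g := by ext; simp
  rw [finsum_mem_eq_finite_toFinset_sum f (hA.image g), finsum_mem_eq_finite_toFinset_sum f hA, h2]
  refine (Finset.sum_image_le_of_nonneg fun _ _ => Nat.zero_le _).trans_lt ?_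
  exact Finset.sum_lt_sum (fun a ha => hle a (by simpa using ha)) ⟨p, by simpa using hp, hlt⟩

/-- The weight of an annotated formula. -/
def weight (γ : Formula Var Atom Act) (X : List Var) (p : NFormula Var Atom Act) : ℕ :=
  -- The factor exceeds the length of any annotation by enough that one unit of depth pays for the
  -- second copy made by `∨` and for the name added by ν. The length term lets Reset decrease the
  -- weight, and the final `1` makes removals by Thin count.
  p.1.depth * (X.length * γ.length + 3) + p.2.length + 1

/-- The sum of the weights of the formulas of a sequent. -/
def measure (γ : Formula Var Atom Act) (X : List Var) (s : Sequent Var Atom Act) : ℕ :=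
  ∑ᶠ p ∈ s.fmls, weight γ X p

/-! ### Traces of true formulas -/

/-- A subformula of `γ`, an annotation and stages for the variables. -/
structure Config (Var Atom Act : Type*) where
  fml : Formula Var Atom Act
  ann : List (Name Var)
  stage : Var → Stage.{u}

section Trace

variable (γ : Formula Var Atom Act) (X : List Var)

/-- The annotated formula of a configuration. -/
def Config.toNFormula (c : Config.{u} Var Atom Act) : NFormula Var Atom Act :=
  (expand γ X c.fml, c.ann)

/-- The formula of the configuration holds at `x`, with the `μ`-variables approximated at the given
stages. -/
def Config.TrueAt {S : Type u} (T : Model Atom Act S) (x : S) (c : Config.{u} Var Atom Act) :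
    Prop :=
  c.fml ∈ γ.subformulas ∧ (∀ Z, kind γ Z = Fix.nu → c.stage Z = ⊤) ∧
    x ∈ sem T (env T γ X c.stage) c.fml

/-- A step of a trace without the unfolding of a fixpoint. -/
def QuietStep (w : List (Name Var)) (r : Option (Name Var)) (c c' : Config.{u} Var Atom Act) :
    Prop :=
  c'.fml ∈ c.fml.subformulas ∧ c'.stage = c.stage ∧
    (c'.ann = c.ann ∨ Better X w c'.ann c.ann ∨ ∃ a z z' b, r = some z ∧
      c.ann = a ++ z :: z' :: b ∧ z'.var = z.var ∧ c'.ann = a ++ [z])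

/-- A step of a trace that unfolds the variable `Z`. -/
def UnfoldStep (Z : Var) (c c' : Config.{u} Var Atom Act) : Prop :=
  Z ∈ X ∧ (c.fml = var Z ∨ c.fml = fix (kind γ Z) Z (body γ Z)) ∧ c'.fml = body γ Z ∧
    (kind γ Z = Fix.mu ∧ c'.ann = restrict X Z c.ann ∧
        -- The stage must drop only when the variable itself is unfolded; unfolding the explicit
        -- fixpoint formula enters it anew and may set any stage.
        (∃ b, c'.stage = Function.update c.stage Z b ∧ (c.fml = var Z → b < c.stage Z)) ∨
      kind γ Z = Fix.nu ∧ c'.stage = c.stage ∧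
        ∃ z : Name Var, z.var = Z ∧ c'.ann = restrict X Z c.ann ++ [z])

/-- `t` results from `s` by a rule that is not modal, and traces of true formulas can be
continued from `s` to `t`. -/
structure LocalStep (s : Sequent Var Atom Act) (r : Option (Name Var))
    (t : Sequent Var Atom Act) : Prop where
  good : Good γ X t
  names : NamesStep s.names t.names
  measure_lt : measure γ X t < measure γ X s
  trace : ∀ (S : Type u) (T : Model Atom Act S) (x : S) (c : Config.{u} Var Atom Act),
    c.TrueAt γ X T x → c.toNFormula γ X ∈ s.fmls → ∃ c', c'.TrueAt γ X T x ∧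
      c'.toNFormula γ X ∈ t.fmls ∧ (QuietStep X s.names r c c' ∨ ∃ Z, UnfoldStep γ X Z c c')

variable {γ X}

theorem QuietStep.rfl {w : List (Name Var)} {r : Option (Name Var)}
    {c : Config.{u} Var Atom Act} : QuietStep X w r c c :=
  ⟨self_mem_subformulas _, _root_.rfl, Or.inl _root_.rfl⟩

namespace Admissible

variable {s t : Sequent Var Atom Act}

/-- The given instance of Thin may have the worse formula in its context too and then removes
nothing, so Thin is applied anew with that formula taken out of the context. For Reset the side
condition already separates context and principal formulas. -/
theorem exists_localStep_of_structStep (H : Admissible γ X) (hs : Good γ X s)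
    {r : Option (Name Var)} (h : StructStep γ X s r t) :
    ∃ r t, StructStep γ X s r t ∧ LocalStep.{u} γ X s r t := by
  cases h with
  | thin w Γ φ u v h =>
    set A := Γ ∪ {(φ, u), (φ, v)} with hA
    have hu : (φ, u) ∈ A := Or.inr (Or.inl rfl)
    have hv : (φ, v) ∈ A := Or.inr (Or.inr rfl)
    have hbet := better_of_nameSqLt H.order.nodup (hs.sorted _ hu) (hs.sorted _ hv)
      (fun n hn => hs.var_mem hu hn) (fun n hn => hs.var_mem hv hn) h
    have hne : u ≠ v := hbet.ne hs.nodup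
    have e1 : A \ {(φ, v)} ∪ {(φ, u), (φ, v)} = A := by
      ext p
      simp only [Set.mem_union, Set.mem_sdiff, Set.mem_singleton_iff, Set.mem_insert_iff]
      constructor
      · rintro (hp | rfl | rfl)
        exacts [hp.1, hu, hv]
      · intro hp
        by_cases hpv : p = (φ, v)
        · exact Or.inr (Or.inr hpv)
        · exact Or.inl ⟨hp, hpv⟩
    have e2 : A \ {(φ, v)} ∪ {(φ, u)} = A \ {(φ, v)} ∪ ∅ := by
      rw [Set.union_empty, Set.union_eq_left, Set.singleton_subset_iff]
      exact ⟨hu, by simpa using hne⟩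
    have step := StructStep.thin (γ := γ) (X := X) w (A \ {(φ, v)}) φ u v h
    rw [e1, e2] at step
    have hg := good_structStep hs step
    refine ⟨_, _, step, hg.1, hg.2, ?_, ?_⟩
    · exact finsum_mem_diff_union_lt _ hs.finite Set.finite_empty hv (by simp [weight])
    · intro S T x c hc hcs
      -- A trace at the discarded formula continues at its better annotated copy, with the same
      -- subformula and stages.
      by_cases hcv : c.toNFormula γ X = (φ, v)
      · have h1 : expand γ X c.fml = φ := congrArg Prod.fst hcv
        have h2 : c.ann = v := congrArg Prod.snd hcv
        refine ⟨{ c with ann := u }, hc, Or.inl ⟨?_, ?_⟩, Or.inl ⟨self_mem_subformulas _, rfl,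
          Or.inr (Or.inl ?_)⟩⟩
        · rw [Config.toNFormula, h1]; exact hu
        · rw [Config.toNFormula, h1]; simpa using hne
        · rw [h2]; exact hbet
      · exact ⟨c, hc, Or.inl ⟨hcs, hcv⟩, Or.inl QuietStep.rfl⟩
  | reset w Γ Δ u z hΔ hz hΓ =>
    have step := StructStep.reset (γ := γ) (X := X) w Γ Δ u z hΔ hz hΓ
    have hg := good_structStep hs step
    have hdis : ∀ p ∈ Γ, p ∉ Δ := by
      intro p hp hp'
      obtain ⟨z', u', -, e⟩ := hz p hp'
      exact hΓ p hp (by rw [e]; simp)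
    refine ⟨_, _, step, hg.1, hg.2, ?_, ?_⟩
    · let g : NFormula Var Atom Act → NFormula Var Atom Act :=
        fun p => if p ∈ Δ then (p.1, u ++ [z]) else p
      have hgΔ : ∀ p ∈ Δ, weight γ X (g p) < weight γ X p := by
        intro p hp
        obtain ⟨z', u', -, e⟩ := hz p hp
        simp only [g, if_pos hp, weight, e, List.length_append, List.length_cons, List.length_nil]
        omega
      have e : Γ ∪ (fun p => (p.1, u ++ [z])) '' Δ = g '' (Γ ∪ Δ) := by
        rw [Set.image_union]
        congr 1
        · ext p
          constructor
          · exact fun hp => ⟨p, hp, if_neg (hdis p hp)⟩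
          · rintro ⟨q, hq, rfl⟩
            simpa only [g, if_neg (hdis q hq)] using hq
        · exact Set.image_congr fun p hp => (if_pos hp).symm
      obtain ⟨p, hp⟩ := hΔ
      unfold measure
      rw [e]
      refine finsum_mem_image_lt _ g hs.finite ?_ (Or.inr hp) (hgΔ p hp)
      rintro q (hq | hq)
      · simp only [g, if_neg (hdis q hq), le_refl]
      · exact (hgΔ q hq).le
    · intro S T x c hc hcs
      rcases hcs with hcs | hcs
      · exact ⟨c, hc, Or.inl hcs, Or.inl QuietStep.rfl⟩
      · obtain ⟨z', u', hv, e⟩ := hz _ hcs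
        exact ⟨{ c with ann := u ++ [z] }, hc, Or.inr ⟨_, hcs, rfl⟩, Or.inl
          ⟨self_mem_subformulas _, rfl, Or.inr (Or.inr ⟨u, z, z', u', rfl, e, hv, rfl⟩)⟩⟩

/-- A true fixpoint formula has a true unfolding. -/
theorem exists_unfoldStep (H : Admissible γ X) {S : Type u} {T : Model Atom Act S} {x : S}
    {c : Config.{u} Var Atom Act} (hc : c.TrueAt γ X T x) {κ : Fix} {Z : Var}
    {φ : Formula Var Atom Act} (e : expand γ X c.fml = fix κ Z φ) (z : Name Var)
    (hz : z.var = Z) :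
    ∃ c', c'.TrueAt γ X T x ∧ expand γ X c'.fml = Formula.unfold κ Z φ ∧
      c'.ann = (match κ with
        | Fix.mu => restrict X Z c.ann
        | Fix.nu => restrict X Z c.ann ++ [z]) ∧ UnfoldStep γ X Z c c' := by
  obtain ⟨hsub, htop, hx⟩ := hc
  obtain ⟨hZ, hκ, hrep⟩ := H.of_expand_eq_fix hsub e
  have hu := (H.unfold_eq hsub e).symm
  have hrep' : x ∈ env T γ X c.stage Z ∧ c.fml = var Z ∨
      x ∈ env T γ X (Function.update c.stage Z ⊤) Z ∧
        c.fml = fix (kind γ Z) Z (body γ Z) := by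
    rcases hrep with hrep | hrep
    · rw [hrep] at hx
      exact Or.inl ⟨hx, hrep⟩
    · rw [hrep, H.sem_fix_env T _ hZ] at hx
      exact Or.inr ⟨hx, hrep⟩
  cases κ with
  | mu =>
    have : ∃ b, x ∈ sem T (env T γ X (Function.update c.stage Z b)) (body γ Z) ∧
        (c.fml = var Z → b < c.stage Z) := by
      rcases hrep' with ⟨hx, hf⟩ | ⟨hx, hf⟩
      · obtain ⟨b, hb, hx⟩ := (H.mem_env_mu T hZ hκ.symm).1 hx
        exact ⟨b, hx, fun _ => hb⟩
      · obtain ⟨b, hb, hx⟩ := (H.mem_env_mu T hZ hκ.symm).1 hx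
        rw [Function.update_idem] at hx
        exact ⟨b, hx, fun h => by rw [hf] at h; cases h⟩
    obtain ⟨b, hx, hb⟩ := this
    refine ⟨⟨body γ Z, restrict X Z c.ann, Function.update c.stage Z b⟩,
      ⟨H.body_mem hZ, fun Y hY => ?_, hx⟩, hu, rfl, hZ, hrep, rfl,
      Or.inl ⟨hκ.symm, rfl, b, rfl, hb⟩⟩
    have hYZ : Y ≠ Z := by
      rintro rfl
      rw [hY] at hκ
      cases hκ
    simpa only [Function.update_of_ne hYZ] using htop Y hY
  | nu =>
    have hx' : x ∈ env T γ X c.stage Z := by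
      rcases hrep' with ⟨hx, -⟩ | ⟨hx, -⟩
      · exact hx
      · rwa [← htop Z hκ.symm, Function.update_eq_self] at hx
    rw [H.env_of_top T hZ (htop Z hκ.symm)] at hx'
    exact ⟨⟨body γ Z, restrict X Z c.ann ++ [z], c.stage⟩,
      ⟨H.body_mem hZ, htop, hx'⟩, hu, rfl, hZ, hrep, rfl, Or.inr ⟨hκ.symm, rfl, z, hz, rfl⟩⟩

/-- The possible results of applying a rule that is not modal to the formula `p` of `s`. -/
theorem exists_logicStep (H : Admissible γ X) (hs : Good γ X s)
    (hno : ¬ ∃ r t, StructStep γ X s r t) {p : NFormula Var Atom Act} (hp : p ∈ s.fmls)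
    (hd : p.1.depth ≠ 0) :
    ∃ cs, LogicStep γ X s cs ∧ ∀ t ∈ cs, LocalStep.{u} γ X s none t := by
  obtain ⟨φ₀, u⟩ := p
  -- The context is chosen without the principal formula, so that this formula really disappears and
  -- the measure drops.
  have e : s.fmls \ {(φ₀, u)} ∪ {(φ₀, u)} = s.fmls := by
    rw [Set.sdiff_union_self, Set.union_eq_left, Set.singleton_subset_iff]
    exact hp
  have hlen := hs.length_le hp
  simp only at hlen
  -- Traces at other formulas stay put, so only the passage from the principal formula to its
  -- replacements `N` remains to be checked for each rule.
  have wait : ∀ (N : Set (NFormula Var Atom Act)) (w' : List (Name Var)),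
      (∀ (S : Type u) (T : Model Atom Act S) (x : S) (c : Config.{u} Var Atom Act),
        c.TrueAt γ X T x → c.toNFormula γ X = (φ₀, u) → ∃ c', c'.TrueAt γ X T x ∧
          c'.toNFormula γ X ∈ N ∧
          (QuietStep X s.names none c c' ∨ ∃ Z, UnfoldStep γ X Z c c')) →
      N.Finite → ∑ᶠ q ∈ N, weight γ X q < weight γ X (φ₀, u) →
      ∀ {cs}, LogicStep γ X s cs → (⟨w', s.fmls \ {(φ₀, u)} ∪ N⟩ : Sequent Var Atom Act) ∈ cs →
      LocalStep.{u} γ X s none ⟨w', s.fmls \ {(φ₀, u)} ∪ N⟩ := by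
    intro N w' hN hfin hw cs hstep hmem
    have hg := H.good_logicStep hs hstep hmem
    refine ⟨hg.1, hg.2, finsum_mem_diff_union_lt _ hs.finite hfin hp hw, ?_⟩
    intro S T x c hc hcs
    by_cases hcp : c.toNFormula γ X = (φ₀, u)
    · obtain ⟨c', h1, h2, h3⟩ := hN S T x c hc hcp
      exact ⟨c', h1, Or.inr h2, h3⟩
    · exact ⟨c, hc, Or.inl ⟨hcs, hcp⟩, Or.inl QuietStep.rfl⟩
  cases φ₀ with
  | var _ | atom _ | natom _ | tt | ff | box _ _ | dia _ _ => exact (hd rfl).elim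
  | or φ ψ =>
    have step := LogicStep.or (γ := γ) (X := X) s.names (s.fmls \ {(φ.or ψ, u)}) φ ψ u
    rw [e] at step
    refine ⟨_, step, fun t ht => ?_⟩
    have hmem := ht
    rw [List.mem_singleton] at ht
    subst ht
    refine wait _ _ ?_ (Set.toFinite _) ?_ step hmem
    · intro S T x c hc hcp
      have h1 : expand γ X c.fml = φ.or ψ := congrArg Prod.fst hcp
      have h2 : c.ann = u := congrArg Prod.snd hcp
      obtain ⟨hsub, htop, hx⟩ := hc
      obtain ⟨φ', hφ, ψ', hψ, ef, e₁, e₂⟩ := H.of_expand_eq_or hsub h1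
      rw [ef] at hx
      rcases hx with hx | hx
      · exact ⟨⟨φ', u, c.stage⟩, ⟨hφ, htop, hx⟩, Or.inl (Prod.ext e₁ rfl), Or.inl
          ⟨by rw [ef]; exact Or.inr (Or.inl (self_mem_subformulas _)), rfl, Or.inl h2.symm⟩⟩
      · exact ⟨⟨ψ', u, c.stage⟩, ⟨hψ, htop, hx⟩, Or.inr (Prod.ext e₂ rfl), Or.inl
          ⟨by rw [ef]; exact Or.inr (Or.inr (self_mem_subformulas _)), rfl, Or.inl h2.symm⟩⟩
    · have h1 := finsum_mem_union_inter (f := weight γ X)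
        (Set.finite_singleton (φ, u)) (Set.finite_singleton (ψ, u))
      rw [finsum_mem_singleton, finsum_mem_singleton, Set.singleton_union] at h1
      have h2 : weight γ X (φ, u) + weight γ X (ψ, u) < weight γ X (φ.or ψ, u) := by
        simp only [weight, depth, add_mul]
        omega
      omega
  | and φ ψ =>
    have step := LogicStep.and (γ := γ) (X := X) s.names (s.fmls \ {(φ.and ψ, u)}) φ ψ u
    rw [e] at step
    refine ⟨_, step, fun t ht => ?_⟩
    have hmem := ht
    have trace : ∀ (S : Type u) (T : Model Atom Act S) (x : S) (c : Config.{u} Var Atom Act),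
        c.TrueAt γ X T x → c.toNFormula γ X = (φ.and ψ, u) →
          (∃ c', c'.TrueAt γ X T x ∧ c'.toNFormula γ X = (φ, u) ∧
            QuietStep X s.names none c c') ∧
          ∃ c', c'.TrueAt γ X T x ∧ c'.toNFormula γ X = (ψ, u) ∧
            QuietStep X s.names none c c' := by
      intro S T x c hc hcp
      have h1 : expand γ X c.fml = φ.and ψ := congrArg Prod.fst hcp
      have h2 : c.ann = u := congrArg Prod.snd hcp
      obtain ⟨hsub, htop, hx⟩ := hc
      obtain ⟨φ', hφ, ψ', hψ, ef, e₁, e₂⟩ := H.of_expand_eq_and hsub h1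
      rw [ef] at hx
      exact ⟨⟨⟨φ', u, c.stage⟩, ⟨hφ, htop, hx.1⟩, Prod.ext e₁ rfl,
          by rw [ef]; exact Or.inr (Or.inl (self_mem_subformulas _)), rfl, Or.inl h2.symm⟩,
        ⟨ψ', u, c.stage⟩, ⟨hψ, htop, hx.2⟩, Prod.ext e₂ rfl,
          by rw [ef]; exact Or.inr (Or.inr (self_mem_subformulas _)), rfl, Or.inl h2.symm⟩
    have hw : weight γ X (φ, u) + weight γ X (ψ, u) < weight γ X (φ.and ψ, u) := by
      simp only [weight, depth, add_mul]
      omega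
    simp only [List.mem_cons, List.not_mem_nil, or_false] at ht
    rcases ht with rfl | rfl
    · refine wait _ _ ?_ (Set.finite_singleton _) ?_ step hmem
      · intro S T x c hc hcp
        obtain ⟨⟨c', h1, h2, h3⟩, -⟩ := trace S T x c hc hcp
        exact ⟨c', h1, h2, Or.inl h3⟩
      · rw [finsum_mem_singleton]
        omega
    · refine wait _ _ ?_ (Set.finite_singleton _) ?_ step hmem
      · intro S T x c hc hcp
        obtain ⟨-, c', h1, h2, h3⟩ := trace S T x c hc hcp
        exact ⟨c', h1, h2, Or.inl h3⟩
      · rw [finsum_mem_singleton]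
        omega
  | fix κ Z φ =>
    obtain ⟨χ, hχ, eχ⟩ := hs.mem_closure _ hp
    have hdepth := H.depth_unfold hχ eχ
    have hκ := (H.mem_closure_unfold (hs.mem_closure _ hp)).2
    have hres : (restrict X Z u).length ≤ u.length := List.length_filter_le _ _
    have hw : ∀ v : List (Name Var), v.length ≤ u.length + 1 →
        weight γ X (Formula.unfold κ Z φ, v) < weight γ X (fix κ Z φ, u) := by
      intro v hv
      have : ((Formula.unfold κ Z φ).depth + 1) * (X.length * γ.length + 3) ≤
          (fix κ Z φ).depth * (X.length * γ.length + 3) := Nat.mul_le_mul_right _ hdepth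
      simp only [weight]
      rw [add_mul] at this
      omega
    cases κ with
    | mu =>
      have step := LogicStep.mu (γ := γ) (X := X) s.names (s.fmls \ {(fix Fix.mu Z φ, u)}) Z φ u
      rw [e] at step
      refine ⟨_, step, fun t ht => ?_⟩
      have hmem := ht
      rw [List.mem_singleton] at ht
      subst ht
      refine wait _ _ ?_ (Set.finite_singleton _) ?_ step hmem
      · intro S T x c hc hcp
        have h1 : expand γ X c.fml = fix Fix.mu Z φ := congrArg Prod.fst hcp
        have h2 : c.ann = u := congrArg Prod.snd hcp
        obtain ⟨c', h3, h4, h5, h6⟩ := H.exists_unfoldStep hc h1 ⟨Z, 0⟩ rfl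
        exact ⟨c', h3, Prod.ext h4 (h2 ▸ h5), Or.inr ⟨Z, h6⟩⟩
      · rw [finsum_mem_singleton]
        exact hw _ (by omega)
    | nu =>
      obtain ⟨i, hi⟩ := H.exists_firstFresh hs hno (H.kind_eq_nu_iff.1 ⟨hκ.1, hκ.2.symm⟩)
      have step := LogicStep.nu (γ := γ) (X := X) s.names (s.fmls \ {(fix Fix.nu Z φ, u)}) Z φ u i
        hi
      rw [e] at step
      refine ⟨_, step, fun t ht => ?_⟩
      have hmem := ht
      rw [List.mem_singleton] at ht
      subst ht
      refine wait _ _ ?_ (Set.finite_singleton _) ?_ step hmem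
      · intro S T x c hc hcp
        have h1 : expand γ X c.fml = fix Fix.nu Z φ := congrArg Prod.fst hcp
        have h2 : c.ann = u := congrArg Prod.snd hcp
        obtain ⟨c', h3, h4, h5, h6⟩ := H.exists_unfoldStep hc h1 ⟨Z, i⟩ rfl
        exact ⟨c', h3, Prod.ext h4 (h2 ▸ h5), Or.inr ⟨Z, h6⟩⟩
      · rw [finsum_mem_singleton]
        exact hw _ (by simp only [List.length_append, List.length_singleton]; omega)

end Admissible

end Trace

end
end MuCalc
-- Completeness: unprovable nodes, and why no trace through them is infinite
namespace MuCalc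
noncomputable section
open Classical
open Formula

variable {Var Atom Act : Type*}

/-! ### Nodes without a proof tree -/

section Nodes

variable {γ : Formula Var Atom Act} {X : List Var}

/-- A node below which there is no proof tree, and which does not repeat a sequent above it; the
same holds of all the nodes above it. -/
structure Node (γ : Formula Var Atom Act) (X : List Var) where
  branch : Branch Var Atom Act
  seq : Sequent Var Atom Act
  good : Good γ X seq
  bad : ¬ Nonempty (ProofTree γ X branch seq)
  fresh : ¬ IsRepeat branch seq
  above : ∀ h₁ e h₂, branch = h₁ ++ e :: h₂ →
    Good γ X e.1 ∧ ¬ Nonempty (ProofTree γ X h₂ e.1) ∧ ¬ IsRepeat h₂ e.1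

/-- `n'` is a child of `n`, or the companion of a child of `n` that is a repeat but not a successful
one. -/
def Link (n : Node γ X) (r : Option (Name Var)) (n' : Node γ X) : Prop :=
  n'.branch = (n.seq, r) :: n.branch ∨
    (∃ h₁ r', (n.seq, r) :: n.branch = h₁ ++ (n'.seq, r') :: n'.branch) ∧
      ¬ IsSuccessfulRepeat ((n.seq, r) :: n.branch) n'.seq

/-- An unprovable child that is a repeat cannot be a successful one. Its companion has the same
sequent and is itself a node of the branch, so the descent resumes there. -/
theorem Node.exists_link (n : Node γ X) (r : Option (Name Var)) {t : Sequent Var Atom Act}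
    (ht : Good γ X t) (hbad : ¬ Nonempty (ProofTree γ X ((n.seq, r) :: n.branch) t)) :
    ∃ n' : Node γ X, n'.seq = t ∧ Link n r n' := by
  have habove : ∀ h₁ e h₂, (n.seq, r) :: n.branch = h₁ ++ e :: h₂ →
      Good γ X e.1 ∧ ¬ Nonempty (ProofTree γ X h₂ e.1) ∧ ¬ IsRepeat h₂ e.1 := by
    intro h₁ e h₂ he
    cases h₁ with
    | nil =>
      simp only [List.nil_append, List.cons.injEq] at he
      obtain ⟨rfl, rfl⟩ := he
      exact ⟨n.good, n.bad, n.fresh⟩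
    | cons e₁ h₁ =>
      simp only [List.cons_append, List.cons.injEq] at he
      exact n.above h₁ e h₂ he.2
  by_cases hrep : IsRepeat ((n.seq, r) :: n.branch) t
  · obtain ⟨⟨t', r'⟩, he, rfl⟩ := hrep
    obtain ⟨h₁, h₂, e⟩ := List.append_of_mem he
    have h := habove h₁ _ h₂ e
    refine ⟨⟨h₂, t', ht, h.2.1, h.2.2, fun h₃ e' h₄ e₂ => ?_⟩, rfl, Or.inr ⟨⟨h₁, r', e⟩, ?_⟩⟩
    · exact habove (h₁ ++ (t', r') :: h₃) e' h₄ (by rw [e, e₂]; simp)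
    · exact fun hsucc => hbad ⟨ProofTree.repeatLeaf _ _ hsucc⟩
  · exact ⟨⟨_, t, ht, hbad, hrep, habove⟩, rfl, Or.inl rfl⟩

/-- The sequents on a branch are good and pairwise different, and there are finitely many good
sequents. -/
theorem exists_length_branch_le (γ : Formula Var Atom Act) (X : List Var) :
    ∃ B, ∀ n : Node γ X, n.branch.length ≤ B := by
  refine ⟨(finite_good γ X).toFinset.card, fun n => ?_⟩
  have key : ∀ h : Branch Var Atom Act,
      (∀ h₁ e h₂, h = h₁ ++ e :: h₂ → Good γ X e.1 ∧ ¬ IsRepeat h₂ e.1) →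
      (h.map Prod.fst).Nodup ∧ ∀ s ∈ h.map Prod.fst, Good γ X s := by
    intro h
    induction h with
    | nil => simp
    | cons e h ih =>
      intro hh
      obtain ⟨h1, h2⟩ := ih fun h₁ e' h₂ e₂ => hh (e :: h₁) e' h₂ (by rw [e₂]; rfl)
      obtain ⟨h3, h4⟩ := hh [] e h rfl
      refine ⟨List.nodup_cons.2 ⟨fun hmem => ?_, h1⟩, ?_⟩
      · obtain ⟨e', he', e₂⟩ := List.mem_map.1 hmem
        exact h4 ⟨e', he', e₂⟩
      · intro s hs
        rcases List.mem_cons.1 hs with rfl | hs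
        · exact h3
        · exact h2 s hs
  obtain ⟨h1, h2⟩ := key n.branch fun h₁ e h₂ he =>
    ⟨(n.above h₁ e h₂ he).1, (n.above h₁ e h₂ he).2.2⟩
  rw [← List.length_map (f := Prod.fst), ← List.toFinset_card_of_nodup h1]
  refine Finset.card_le_card fun s hs => ?_
  rw [List.mem_toFinset] at hs
  exact (finite_good γ X).mem_toFinset.2 (h2 s hs)

/-- A bounded sequence of numbers has an inferior limit. -/
theorem exists_eventually_le_frequently_le (f : ℕ → ℕ → Prop) {B : ℕ}
    (hB : ∀ M, ∃ i ≥ M, ∃ k ≤ B, f i k) :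
    ∃ k M, (∀ i ≥ M, ∀ j, f i j → k ≤ j) ∧ ∀ M, ∃ i ≥ M, f i k := by
  have hex : ∃ k, ∀ M, ∃ i ≥ M, ∃ j ≤ k, f i j := ⟨B, hB⟩
  have hmin : ∃ M, ∀ i ≥ M, ∀ j, f i j → Nat.find hex ≤ j := by
    by_contra hcon
    push Not at hcon
    have h0 : 0 < Nat.find hex := by
      obtain ⟨i, -, j, -, hj⟩ := hcon 0
      omega
    refine Nat.find_min hex (Nat.sub_lt h0 one_pos) fun M => ?_
    obtain ⟨i, hi, j, hf, hj⟩ := hcon M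
    exact ⟨i, hi, j, by omega, hf⟩
  obtain ⟨M, hM⟩ := hmin
  refine ⟨Nat.find hex, M, hM, fun M' => ?_⟩
  obtain ⟨i, hi, j, hj, hf⟩ := Nat.find_spec hex (max M M')
  rw [le_antisymm (hM i (le_of_max_le_left hi) j hf) hj]
  exact ⟨i, le_of_max_le_right hi, hf⟩

/-- On an infinite sequence of linked nodes, no name that remains in the sequents is reset
infinitely often. -/
theorem not_reset_infinitely_often {n : ℕ → Node γ X} {r : ℕ → Option (Name Var)}
    (hlink : ∀ i, Link (n i) (r i) (n (i + 1))) {z : Name Var} {N : ℕ}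
    (hz : ∀ i ≥ N, z ∈ (n i).seq.names) (hr : ∀ M, ∃ i ≥ M, r i = some z) : False := by
  obtain ⟨B, hB⟩ := exists_length_branch_le γ X
  -- `k` is the inferior limit of the branch lengths. From a late moment of length `k` on, jumps
  -- never cut into the branch `h₀` of that moment.
  obtain ⟨k, M, hM, hk⟩ := exists_eventually_le_frequently_le
    (fun i k => (n i).branch.length = k) (B := B)
    fun M => ⟨M, le_rfl, _, hB (n M), rfl⟩
  have hM : ∀ i ≥ M, k ≤ (n i).branch.length := fun i hi => hM i hi _ rfl
  obtain ⟨t₀, ht₀, hlen₀⟩ := hk (max M N)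
  have htM := le_of_max_le_left ht₀
  have htN := le_of_max_le_right ht₀
  set h₀ := (n t₀).branch with hh₀
  -- The branch is treated as a stack on top of `h₀`, all of whose entries contain `z`. An entry
  -- recording a Reset of `z` is never popped.
  have step : ∀ i ≥ t₀, ∀ L, (n i).branch = L ++ h₀ → (∀ e ∈ L, z ∈ e.1.names) →
      ∃ L', (n (i + 1)).branch = L' ++ h₀ ∧ (∀ e ∈ L', z ∈ e.1.names) ∧
        ∀ s, (s, some z) ∈ ((n i).seq, r i) :: L → (s, some z) ∈ L' := by
    intro i hi L hL hLz
    have hz' : ∀ e ∈ ((n i).seq, r i) :: L, z ∈ e.1.names := by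
      intro e he
      rcases List.mem_cons.1 he with rfl | he
      · exact hz i (htN.trans hi)
      · exact hLz e he
    rcases hlink i with h | ⟨⟨h₁, r', h⟩, hns⟩
    · exact ⟨((n i).seq, r i) :: L, by rw [h, hL]; rfl, hz', fun s hs => hs⟩
    · have hsuf : h₀ <:+ (n (i + 1)).branch := by
        apply List.suffix_of_suffix_length_le (l₃ := ((n i).seq, r i) :: (n i).branch)
        · rw [hL]
          exact ⟨((n i).seq, r i) :: L, rfl⟩
        · rw [h]
          exact ⟨h₁ ++ [((n (i + 1)).seq, r')], by simp⟩
        · rw [hlen₀]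
          exact hM _ (by omega)
      obtain ⟨L', hL'⟩ := hsuf
      have e : ((n i).seq, r i) :: L = h₁ ++ [((n (i + 1)).seq, r')] ++ L' := by
        apply List.append_cancel_right (bs := h₀)
        rw [List.cons_append, ← hL, h, ← hL']
        simp
      rw [e] at hz' ⊢
      refine ⟨L', hL'.symm, fun e he => hz' e (List.mem_append_right _ he), fun s hs => ?_⟩
      rcases List.mem_append.1 hs with hs | hs
      -- Popping that entry means that `z` was reset between companion and repeat while occurring
      -- throughout, so the repeat would be successful.
      · refine (hns ⟨h₁, _, r', h, z, ⟨_, hs, rfl⟩, hz _ (by omega), ?_⟩).elim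
        exact fun e he => hz' e (List.mem_append_left _ he)
      · exact hs
  obtain ⟨t₁, ht₁, hrt⟩ := hr t₀
  have stack : ∀ i ≥ t₀, ∃ L, (n i).branch = L ++ h₀ ∧ (∀ e ∈ L, z ∈ e.1.names) ∧
      (t₁ < i → ((n t₁).seq, some z) ∈ L) := by
    intro i hi
    induction i, hi using Nat.le_induction with
    | base => exact ⟨[], rfl, by simp, fun h => absurd h (by omega)⟩
    | succ i hi ih =>
      obtain ⟨L, hL, hLz, hmem⟩ := ih
      obtain ⟨L', h1, h2, h3⟩ := step i hi L hL hLz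
      refine ⟨L', h1, h2, fun hlt => h3 _ ?_⟩
      by_cases hti : t₁ = i
      · subst hti
        rw [hrt]
        exact List.mem_cons_self
      · exact List.mem_cons_of_mem _ (hmem (by omega))
  -- At a later return to length `k` the stack is empty, although the Reset entry should still be on
  -- it.
  obtain ⟨i, hi, hlen⟩ := hk (t₁ + 1)
  obtain ⟨L, hL, -, hmem⟩ := stack i (by omega)
  have : L.length = 0 := by
    rw [hL, List.length_append, hlen₀] at hlen
    omega
  rw [List.length_eq_zero_iff.1 this] at hmem
  exact List.not_mem_nil (hmem (by omega))

end Nodes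

/-! ### The names on a trace -/

theorem exists_bound_of_forall_mem {α : Type*} (q : List α) (P : α → ℕ → Prop)
    (h : ∀ z ∈ q, ∃ M, ∀ i ≥ M, P z i) : ∃ M, ∀ i ≥ M, ∀ z ∈ q, P z i := by
  induction q with
  | nil => exact ⟨0, by simp⟩
  | cons z q ih =>
    obtain ⟨M, hM⟩ := ih fun y hy => h y (List.mem_cons_of_mem _ hy)
    obtain ⟨M', hM'⟩ := h z (by simp)
    refine ⟨max M M', fun i hi y hy => ?_⟩
    rcases List.mem_cons.1 hy with rfl | hy
    · exact hM' i (le_of_max_le_right hi)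
    · exact hM i (le_of_max_le_left hi) y hy

/-- A step of an annotation on a trace that does not unfold a variable before `Z`. -/
def AnnotationStep (X : List Var) (Z : Var) (w : List (Name Var)) (r : Option (Name Var))
    (u u' : List (Name Var)) : Prop :=
  u' = u ∨ Better X w u' u ∨
    (∃ a z z' b, r = some z ∧ u = a ++ z :: z' :: b ∧ z'.var = z.var ∧ u' = a ++ [z]) ∨
    ∃ Y, restrict X Y u <+: u' ∧ pos X Z ≤ pos X Y

/-- If the names of a prefix `q` of the annotations are not reset, the next name can only change to
a better one. -/
theorem AnnotationStep.next_name {X : List Var} (hX : X.Nodup) {Z : Var}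
    {w u u' q : List (Name Var)} {r : Option (Name Var)} (h : AnnotationStep X Z w r u u')
    (hw : w.Nodup) (hu : SortedNames X u) (huX : ∀ n ∈ u, n.var ∈ X) (hq : q <+: u)
    (hq' : q <+: u') (hr : ∀ z ∈ q, r ≠ some z) {n : Name Var} (hn : u[q.length]? = some n)
    (hnZ : pos X n.var ≤ pos X Z) :
    ∃ n', u'[q.length]? = some n' ∧ (n' = n ∨ pos X n'.var < pos X n.var ∨
      n'.var = n.var ∧ Before w n' n) := by
  rcases h with rfl | ⟨j, a, ha, hlt, hb⟩ | ⟨a, z, z', b, hrz, e, hv, e'⟩ | ⟨Y, hpre, hY⟩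
  · exact ⟨n, hn, Or.inl rfl⟩
  · rcases lt_trichotomy j q.length with hj | rfl | hj
    -- Both annotations start with `q`, so no improvement can occur inside `q`.
    · exfalso
      have h1 : u[j]? = some a := by
        obtain ⟨t, rfl⟩ := hq
        obtain ⟨t', rfl⟩ := hq'
        rw [List.getElem?_append_left hj] at ha ⊢
        exact ha
      rcases hb a h1 with h | ⟨-, h⟩
      · exact lt_irrefl _ h
      · exact lt_irrefl _ ((before_iff hw).1 h).1
    · exact ⟨a, ha, Or.inr (hb n hn)⟩
    · exact ⟨n, by rw [hlt _ hj, hn], Or.inl rfl⟩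
  · refine ⟨n, ?_, Or.inl rfl⟩
    -- The reset name is not in `q`, so Reset cuts only behind position `q.length`: the name there
    -- is in the kept part or is the reset name itself.
    have hle : q.length ≤ a.length := by
      by_contra hcon
      push Not at hcon
      have hz : z ∈ q := by
        obtain ⟨t, ht⟩ := hq
        have h1 : (q ++ t)[a.length]? = some z := by rw [ht, e]; simp
        rw [List.getElem?_append_left hcon] at h1
        exact List.mem_of_getElem? h1
      exact hr z hz hrz
    rw [e'] at *
    rw [e] at hn
    rcases hle.lt_or_eq with hlt | heq
    · rwa [List.getElem?_append_left hlt] at hn ⊢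
    · rw [heq] at hn ⊢
      simpa using hn
  · refine ⟨n, ?_, Or.inl rfl⟩
    obtain ⟨rest, e, hrest⟩ := restrict_append_rest hX Y hu huX
    -- The name at this position belongs to a variable not after `Z`, hence not after `Y`, so the
    -- restriction retains it.
    have hlt : q.length < (restrict X Y u).length := by
      by_contra hcon
      push Not at hcon
      rw [e, List.getElem?_append_right hcon] at hn
      have := hrest n (List.mem_of_getElem? hn)
      omega
    obtain ⟨t, rfl⟩ := hpre
    rw [e, List.getElem?_append_left hlt] at hn
    rwa [List.getElem?_append_left hlt]

/-- If the `ν`-variable `Z` is unfolded infinitely often on a trace and no variable before it is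
unfolded, then some name remains forever and is reset infinitely often. -/
theorem exists_persistent_reset {X : List Var} (hX : X.Nodup) {Z : Var} {B : ℕ}
    {w u : ℕ → List (Name Var)} {r : ℕ → Option (Name Var)} (hw : ∀ i, (w i).Nodup)
    (hsub : ∀ i, (u i).Sublist (w i)) (hwX : ∀ i, ∀ n ∈ w i, n.var ∈ X)
    (hsort : ∀ i, SortedNames X (u i)) (hlen : ∀ i, (u i).length ≤ B)
    (hnames : ∀ i, NamesStep (w i) (w (i + 1)))
    (hstep : ∀ i, AnnotationStep X Z (w i) (r i) (u i) (u (i + 1)))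
    (hinf : ∀ M, ∃ i ≥ M, ∃ z : Name Var, z.var = Z ∧ u (i + 1) = restrict X Z (u i) ++ [z]) :
    ∃ z N, (∀ i ≥ N, z ∈ w i) ∧ ∀ M, ∃ i ≥ M, r i = some z := by
  by_contra hcon
  push Not at hcon
  have huX : ∀ i, ∀ n ∈ u i, n.var ∈ X := fun i n hn => hwX i n ((hsub i).subset hn)
  -- If no persistent name is reset infinitely often, stable prefixes of every length exist.
  have claim : ∀ k, ∃ q N, q.length = k ∧ (∀ n ∈ q, pos X n.var ≤ pos X Z) ∧
      ∀ i ≥ N, q <+: u i := by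
    intro k
    induction k with
    | zero => exact ⟨[], 0, rfl, by simp, fun i _ => ⟨_, rfl⟩⟩
    | succ k ih =>
      obtain ⟨q, N, hqk, hqZ, hq⟩ := ih
      subst hqk
      obtain ⟨M, hM⟩ := exists_bound_of_forall_mem q (fun z i => r i ≠ some z) fun z hz =>
        hcon z N fun i hi => (hsub i).subset ((hq i hi).subset hz)
      -- An unfolding of `Z` after the names of `q` have ceased to be reset appends a name behind
      -- `q`, so position `q.length` is occupied from then on.
      obtain ⟨i₀, hi₀, z, hzZ, ez⟩ := hinf (max N M)
      have hiN := le_of_max_le_left hi₀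
      have hiM := le_of_max_le_right hi₀
      have next : ∀ i ≥ i₀, ∀ n, (u i)[q.length]? = some n → pos X n.var ≤ pos X Z →
          ∃ n', (u (i + 1))[q.length]? = some n' ∧ (n' = n ∨ pos X n'.var < pos X n.var ∨
            n'.var = n.var ∧ Before (w i) n' n) := fun i hi n hn hnZ =>
        (hstep i).next_name hX (hw i) (hsort i) (huX i) (hq i (by omega)) (hq _ (by omega))
          (hM i (by omega)) hn hnZ
      have hex : ∀ m, ∃ n, (u (i₀ + 1 + m))[q.length]? = some n ∧ pos X n.var ≤ pos X Z := by
        intro m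
        induction m with
        | zero =>
          have hqr : q <+: restrict X Z (u i₀) := by
            obtain ⟨t, ht⟩ := hq i₀ hiN
            rw [← ht, restrict_append, restrict_eq_self hX fun n hn =>
              ⟨huX i₀ n (by rw [← ht]; simp [hn]), hqZ n hn⟩]
            exact List.prefix_append _ _
          have hlt : q.length < (u (i₀ + 1 + 0)).length := by
            rw [add_zero, ez, List.length_append, List.length_singleton]
            have := hqr.length_le
            omega
          refine ⟨(u (i₀ + 1 + 0))[q.length], List.getElem?_eq_getElem hlt, ?_⟩
          have hmem := List.getElem_mem hlt
          generalize (u (i₀ + 1 + 0))[q.length] = n at hmem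
          rw [add_zero, ez] at hmem
          rcases List.mem_append.1 hmem with hmem | hmem
          · exact ((mem_restrict hX (huX i₀ n (List.mem_of_mem_filter hmem))).1 hmem).2
          · rw [List.mem_singleton.1 hmem, hzZ]
        | succ m ih =>
          obtain ⟨n, hn, hnZ⟩ := ih
          obtain ⟨n', hn', h⟩ := next _ (by omega) n hn hnZ
          refine ⟨n', hn', ?_⟩
          rcases h with rfl | h | ⟨h, -⟩
          · exact hnZ
          · omega
          · rw [h]; exact hnZ
      choose n hn hnZ using hex
      -- A better name has an earlier variable, or the same variable and an earlier place in `w`.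
      -- Places never increase with time, so this pair descends and the name finally becomes
      -- constant.
      let f : ℕ → ℕ ×ₗ ℕ := fun m => toLex (pos X (n m).var, pos (w (i₀ + 1 + m)) (n m))
      have hmem : ∀ m, n m ∈ w (i₀ + 1 + m) := fun m =>
        (hsub _).subset (List.mem_of_getElem? (hn m))
      have hf : ∀ m, f (m + 1) ≤ f m ∧ (n (m + 1) ≠ n m → f (m + 1) < f m) := by
        intro m
        obtain ⟨n', hn', h⟩ := next _ (by omega) (n m) (hn m) (hnZ m)
        have e : n (m + 1) = n' := by
          have := hn (m + 1)
          rw [show i₀ + 1 + (m + 1) = i₀ + 1 + m + 1 by omega, hn'] at this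
          exact (Option.some.inj this).symm
        have hmem' := hmem (m + 1)
        rw [e] at hmem'
        have hlt : pos X n'.var < pos X (n m).var ∨
            n'.var = (n m).var ∧ Before (w (i₀ + 1 + m)) n' (n m) → f (m + 1) < f m := by
          rintro (h | ⟨h, hb⟩)
          · refine Prod.Lex.toLex_lt_toLex.2 (Or.inl ?_)
            rw [e]; exact h
          · refine Prod.Lex.toLex_lt_toLex.2 (Or.inr ?_)
            rw [e]
            refine ⟨by rw [h], ?_⟩
            exact ((hnames _).pos_le (hw _) hb.mem_left hmem').trans_lt ((before_iff (hw _)).1 hb).1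
        rcases h with h | h
        · refine ⟨?_, fun hne => (hne (e.trans h)).elim⟩
          refine Prod.Lex.toLex_le_toLex.2 (Or.inr ?_)
          rw [e]
          refine ⟨by rw [h], ?_⟩
          rw [h] at hmem' ⊢
          exact (hnames _).pos_le (hw _) (hmem m) hmem'
        · exact ⟨(hlt h).le, fun _ => hlt h⟩
      obtain ⟨_, ⟨m₀, rfl⟩, hmin⟩ := (wellFounded_lt (α := ℕ ×ₗ ℕ)).has_min (Set.range f)
        ⟨f 0, 0, rfl⟩
      have hconst : ∀ m ≥ m₀, f m ≤ f m₀ ∧ n m = n m₀ := by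
        intro m hm
        induction m, hm using Nat.le_induction with
        | base => exact ⟨le_rfl, rfl⟩
        | succ m hm ih =>
          refine ⟨(hf m).1.trans ih.1, ?_⟩
          by_contra hne
          rw [← ih.2] at hne
          exact hmin _ ⟨m + 1, rfl⟩ (((hf m).2 hne).trans_le ih.1)
      refine ⟨q ++ [n m₀], i₀ + 1 + m₀, by simp, ?_, fun i hi => ?_⟩
      · intro y hy
        rcases List.mem_append.1 hy with hy | hy
        · exact hqZ y hy
        · rw [List.mem_singleton.1 hy]
          exact hnZ m₀
      · obtain ⟨m, rfl⟩ := Nat.exists_eq_add_of_le (show i₀ + 1 ≤ i by omega)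
        obtain ⟨t, ht⟩ := hq (i₀ + 1 + m) (by omega)
        have h1 := hn m
        rw [(hconst m (by omega)).2, ← ht, List.getElem?_append_right le_rfl, Nat.sub_self] at h1
        cases t with
        | nil => simp at h1
        | cons y t =>
          simp only [List.getElem?_cons_zero, Option.some.injEq] at h1
          exact ⟨t, by rw [← ht, h1]; simp⟩
  obtain ⟨q, N, hq, -, hpre⟩ := claim (B + 1)
  have := (hpre N le_rfl).length_le
  have := hlen N
  omega

/-! ### There is no infinite trace -/

section Runs

variable {γ : Formula Var Atom Act} {X : List Var}

/-- One step of a trace of a true formula through nodes without a proof tree. -/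
def RunStep (n n' : Node γ X) (c c' : Config.{u} Var Atom Act) (r : Option (Name Var)) : Prop :=
  Link n r n' ∧ NamesStep n.seq.names n'.seq.names ∧
    ((QuietStep X n.seq.names r c c' ∧
        (c'.fml.length < c.fml.length ∨ measure γ X n'.seq < measure γ X n.seq)) ∨
      ∃ Z, UnfoldStep γ X Z c c')

theorem UnfoldStep.annotationStep {Z Y : Var} {c c' : Config.{u} Var Atom Act}
    (h : UnfoldStep γ X Y c c') (hY : pos X Z ≤ pos X Y) (w : List (Name Var))
    (r : Option (Name Var)) : AnnotationStep X Z w r c.ann c'.ann := by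
  refine Or.inr (Or.inr (Or.inr ⟨Y, ?_, hY⟩))
  rcases h.2.2.2 with ⟨-, h, -⟩ | ⟨-, -, z, -, h⟩
  · rw [h]
  · rw [h]
    exact List.prefix_append _ _

namespace Admissible

/-- A quiet step never lengthens the traced formula, and when the length stays the same the measure
drops. Modal steps may raise the measure but shorten the formula, so the pair descends
lexicographically. -/
theorem unfoldStep_infinitely_often {n : ℕ → Node γ X} {c : ℕ → Config.{u} Var Atom Act}
    {r : ℕ → Option (Name Var)} (h : ∀ i, RunStep (n i) (n (i + 1)) (c i) (c (i + 1)) (r i))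
    (M : ℕ) : ∃ i ≥ M, ∃ Z, UnfoldStep γ X Z (c i) (c (i + 1)) := by
  by_contra hcon
  push Not at hcon
  let f : ℕ → ℕ ×ₗ ℕ := fun m => toLex ((c (M + m)).fml.length, measure γ X (n (M + m)).seq)
  obtain ⟨_, ⟨m, rfl⟩, hmin⟩ := (wellFounded_lt (α := ℕ ×ₗ ℕ)).has_min (Set.range f) ⟨f 0, 0, rfl⟩
  refine hmin (f (m + 1)) ⟨m + 1, rfl⟩ ?_
  rcases (h (M + m)).2.2 with ⟨hq, hlt⟩ | ⟨Z, hZ⟩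
  · have hle := length_le_of_mem_subformulas hq.1
    refine Prod.Lex.toLex_lt_toLex.2 ?_
    rcases hle.lt_or_eq with hl | he
    · exact Or.inl hl
    · exact Or.inr ⟨he, hlt.resolve_left (by omega)⟩
  · exact (hcon _ (by omega) Z hZ).elim

/-- The first variable that is unfolded infinitely often. -/
theorem exists_outermost_unfolded {c : ℕ → Config.{u} Var Atom Act}
    (h : ∀ M, ∃ i ≥ M, ∃ Z, UnfoldStep γ X Z (c i) (c (i + 1))) :
    ∃ Z ∈ X, ∃ M, (∀ i ≥ M, ∀ Y, UnfoldStep γ X Y (c i) (c (i + 1)) → pos X Z ≤ pos X Y) ∧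
      ∀ M, ∃ i ≥ M, UnfoldStep γ X Z (c i) (c (i + 1)) := by
  obtain ⟨k, M, hM, hk⟩ := exists_eventually_le_frequently_le
    (fun i k => ∃ Z, pos X Z = k ∧ UnfoldStep γ X Z (c i) (c (i + 1))) (B := X.length) <| by
      intro M
      obtain ⟨i, hi, Z, hZ⟩ := h M
      exact ⟨i, hi, pos X Z, List.idxOf_le_length, Z, rfl, hZ⟩
  obtain ⟨i, -, Z, rfl, hZ⟩ := hk 0
  refine ⟨Z, hZ.1, M, fun i hi Y hY => hM i hi _ ⟨Y, rfl, hY⟩, fun M' => ?_⟩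
  obtain ⟨i, hi, Y, hYZ, hY⟩ := hk M'
  rw [pos_injOn hY.1 hYZ] at hY
  exact ⟨i, hi, hY⟩

/-- The outermost variable unfolded infinitely often is not a `μ`-variable. -/
theorem kind_eq_nu_of_unfolded (H : Admissible γ X) {c : ℕ → Config.{u} Var Atom Act}
    {w : ℕ → List (Name Var)} {r : ℕ → Option (Name Var)}
    (h : ∀ i, QuietStep X (w i) (r i) (c i) (c (i + 1)) ∨
      ∃ Y, UnfoldStep γ X Y (c i) (c (i + 1)))
    {Z : Var} (hZ : Z ∈ X)
    (hout : ∀ i, ∀ Y, UnfoldStep γ X Y (c i) (c (i + 1)) → pos X Z ≤ pos X Y)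
    (hinf : ∀ M, ∃ i ≥ M, UnfoldStep γ X Z (c i) (c (i + 1))) : kind γ Z = Fix.nu := by
  cases hk : kind γ Z with
  | nu => rfl
  | mu =>
    exfalso
    obtain ⟨i₀, -, h₀⟩ := hinf 0
    -- After one unfolding of `Z`, with nothing further out unfolded, the trace stays inside the
    -- body of `Z`. From then on `Z` is met as a variable and not as its fixpoint formula, so each
    -- unfolding lowers its stage.
    have hin : ∀ i ≥ i₀ + 1, (c i).fml ∈ (body γ Z).subformulas := by
      intro i hi
      induction i, hi using Nat.le_induction with
      | base =>
        rw [h₀.2.2.1]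
        exact self_mem_subformulas _
      | succ i hi ih =>
        rcases h i with hq | ⟨Y, hY⟩
        · exact subformulas_trans ih hq.1
        · have hle := hout i Y hY
          rw [hY.2.2.1]
          rcases hY.2.1 with e | e <;> rw [e] at ih
          · exact H.body_mem_of_var_mem hZ ih hle
          · exact subformulas_trans ih body_mem_subformulas
    have hstage : ∀ i ≥ i₀ + 1, (c (i + 1)).stage Z ≤ (c i).stage Z ∧
        (UnfoldStep γ X Z (c i) (c (i + 1)) → (c (i + 1)).stage Z < (c i).stage Z) := by
      intro i hi
      have hself : UnfoldStep γ X Z (c i) (c (i + 1)) →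
          (c (i + 1)).stage Z < (c i).stage Z := by
        intro hu
        rcases hu.2.2.2 with ⟨-, -, b, hb, hlt⟩ | ⟨hν, -⟩
        · rw [hb, Function.update_self]
          refine hlt (hu.2.1.resolve_right fun e => ?_)
          have := hin i hi
          rw [e] at this
          exact fix_notMem_subformulas_body this
        · rw [hk] at hν
          cases hν
      refine ⟨?_, hself⟩
      rcases h i with hq | ⟨Y, hY⟩
      · rw [hq.2.1]
      · by_cases hYZ : Y = Z
        · subst hYZ
          exact (hself hY).le
        · rcases hY.2.2.2 with ⟨-, -, b, hb, -⟩ | ⟨-, hs, -⟩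
          · rw [hb, Function.update_of_ne (Ne.symm hYZ)]
          · rw [hs]
    obtain ⟨_, ⟨m, rfl⟩, hmin⟩ := (wellFounded_lt (α := Stage.{u})).has_min
      (Set.range fun m => (c (i₀ + 1 + m)).stage Z) ⟨_, 0, rfl⟩
    have hanti : ∀ i ≥ i₀ + 1 + m, (c i).stage Z ≤ (c (i₀ + 1 + m)).stage Z := by
      intro i hi
      induction i, hi using Nat.le_induction with
      | base => exact le_rfl
      | succ i hi ih => exact (hstage i (by omega)).1.trans ih
    obtain ⟨i, hi, hu⟩ := hinf (i₀ + 1 + m)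
    obtain ⟨j, rfl⟩ := Nat.exists_eq_add_of_le (show i₀ + 1 ≤ i by omega)
    exact hmin _ ⟨j + 1, rfl⟩ (((hstage _ (by omega)).2 hu).trans_le (hanti _ hi))

/-- The outermost variable unfolded infinitely often must be a ν-variable. It then yields a
persistent name reset infinitely often, which the bounded branches exclude. -/
theorem no_infinite_run (H : Admissible γ X) {n : ℕ → Node γ X}
    {c : ℕ → Config.{u} Var Atom Act} {r : ℕ → Option (Name Var)}
    (hmem : ∀ i, (c i).toNFormula γ X ∈ (n i).seq.fmls)
    (h : ∀ i, RunStep (n i) (n (i + 1)) (c i) (c (i + 1)) (r i)) : False := by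
  obtain ⟨Z, hZ, M, hout, hinf⟩ :=
    exists_outermost_unfolded (unfoldStep_infinitely_often h)
  have hinf' : ∀ M', ∃ i ≥ M', UnfoldStep γ X Z (c (M + i)) (c (M + i + 1)) := by
    intro M'
    obtain ⟨i, hi, hu⟩ := hinf (M + M')
    obtain ⟨j, rfl⟩ := Nat.exists_eq_add_of_le (show M ≤ i by omega)
    exact ⟨j, by omega, hu⟩
  have hν : kind γ Z = Fix.nu := by
    refine H.kind_eq_nu_of_unfolded (c := fun i => c (M + i))
      (w := fun i => (n (M + i)).seq.names) (r := fun i => r (M + i)) (fun i => ?_) hZ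
      (fun i Y hY => hout (M + i) (by omega) Y hY) hinf'
    exact (h (M + i)).2.2.imp_left And.left
  obtain ⟨z, N, hz, hr⟩ := exists_persistent_reset H.order.nodup (Z := Z)
    (B := X.length * γ.length) (w := fun i => (n (M + i)).seq.names)
    (u := fun i => (c (M + i)).ann) (r := fun i => r (M + i))
    (fun i => (n _).good.nodup) (fun i => (n _).good.sublist _ (hmem _))
    (fun i m hm => ((n _).good.nu m hm).1) (fun i => (n _).good.sorted _ (hmem _))
    (fun i => (n _).good.length_le (hmem _)) (fun i => (h _).2.1)
    (fun i => by
      rcases (h (M + i)).2.2 with ⟨hq, -⟩ | ⟨Y, hY⟩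
      · rcases hq.2.2 with hq | hq | hq
        · exact Or.inl hq
        · exact Or.inr (Or.inl hq)
        · exact Or.inr (Or.inr (Or.inl hq))
      · exact hY.annotationStep (hout _ (by omega) Y hY) _ _)
    (fun M' => by
      obtain ⟨i, hi, hu⟩ := hinf' M'
      rcases hu.2.2.2 with ⟨hμ, -⟩ | ⟨-, -, z, hz, e⟩
      · rw [hν] at hμ
        cases hμ
      · exact ⟨i, hi, z, hz, e⟩)
  exact not_reset_infinitely_often (n := fun i => n (M + i)) (r := fun i => r (M + i))
    (fun i => (h (M + i)).1) hz hr

end Admissible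

end Runs

end
end MuCalc
-- Completeness: the countermodel built from saturated nodes
namespace MuCalc
noncomputable section
open Classical
open Formula

variable {Var Atom Act : Type*} {γ : Formula Var Atom Act} {X : List Var}

/-! ### Saturated nodes -/

/-- Only modal rules can be applied to the sequent. -/
def Saturated (γ : Formula Var Atom Act) (X : List Var) (s : Sequent Var Atom Act) : Prop :=
  (¬ ∃ r t, StructStep γ X s r t) ∧ ∀ p ∈ s.fmls, p.1.depth = 0

/-- The result of the modal rule for `p`, the formula `[a] p` being in the sequent `s`; all the
formulas `⟨a⟩ q` of `s` are used. -/
def modalChild (s : Sequent Var Atom Act) (a : Act) (p : NFormula Var Atom Act) :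
    Sequent Var Atom Act :=
  ⟨keep s.names ({q | (dia a q.1, q.2) ∈ s.fmls} ∪ {p}), {q | (dia a q.1, q.2) ∈ s.fmls} ∪ {p}⟩

namespace Node

theorem not_isAxiomatic (n : Node γ X) : ¬ n.seq.IsAxiomatic :=
  fun h => n.bad ⟨ProofTree.axiomLeaf _ _ h⟩

theorem exists_bad_child (n : Node γ X) (hno : ¬ ∃ r t, StructStep γ X n.seq r t)
    {cs : List (Sequent Var Atom Act)} (h : LogicStep γ X n.seq cs) :
    ∃ t ∈ cs, ¬ Nonempty (ProofTree γ X ((n.seq, none) :: n.branch) t) := by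
  by_contra hcon
  push Not at hcon
  exact n.bad ⟨ProofTree.logicNode _ _ cs n.fresh hno h fun t ht => (hcon t ht).some⟩

theorem exists_localStep (H : Admissible γ X) (n : Node γ X) (hn : ¬ Saturated γ X n.seq) :
    ∃ (n' : Node γ X) (r : Option (Name Var)), Link n r n' ∧ LocalStep.{u} γ X n.seq r n'.seq := by
  by_cases hst : ∃ r t, StructStep γ X n.seq r t
  · obtain ⟨r, t, h⟩ := hst
    obtain ⟨r, t, h, hloc⟩ := H.exists_localStep_of_structStep.{u} n.good h
    obtain ⟨n', rfl, hlink⟩ := n.exists_link r hloc.good fun ⟨D⟩ =>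
      n.bad ⟨ProofTree.structNode _ _ _ r n.fresh h D⟩
    exact ⟨n', r, hlink, hloc⟩
  · have : ∃ p ∈ n.seq.fmls, p.1.depth ≠ 0 := by
      by_contra hcon
      push Not at hcon
      exact hn ⟨hst, hcon⟩
    obtain ⟨p, hp, hd⟩ := this
    obtain ⟨cs, hstep, hloc⟩ := H.exists_logicStep.{u} n.good hst hp hd
    obtain ⟨t, ht, hbad⟩ := n.exists_bad_child hst hstep
    obtain ⟨n', rfl, hlink⟩ := n.exists_link none (hloc t ht).good hbad
    exact ⟨n', none, hlink, hloc _ ht⟩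

theorem exists_modal_link (H : Admissible γ X) (n : Node γ X)
    (hno : ¬ ∃ r t, StructStep γ X n.seq r t) {a : Act} {ψ : Formula Var Atom Act}
    {u : List (Name Var)} (h : (box a ψ, u) ∈ n.seq.fmls) :
    ∃ n' : Node γ X, Link n none n' ∧ n'.seq = modalChild n.seq a (ψ, u) := by
  have step := LogicStep.modal (γ := γ) (X := X) n.seq.names n.seq.fmls
    {q | (dia a q.1, q.2) ∈ n.seq.fmls} a ψ u
  have e : n.seq.fmls ∪ (fun p : NFormula Var Atom Act => (dia a p.1, p.2)) ''
      {q : NFormula Var Atom Act | (dia a q.1, q.2) ∈ n.seq.fmls} ∪ {(box a ψ, u)} =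
      n.seq.fmls := by
    rw [Set.union_assoc, Set.union_eq_left]
    rintro p (⟨q, hq, rfl⟩ | rfl)
    · exact hq
    · exact h
  rw [e] at step
  obtain ⟨t, ht, hbad⟩ := n.exists_bad_child hno step
  have hg := (H.good_logicStep n.good step ht).1
  rw [List.mem_singleton] at ht
  obtain ⟨n', hn', hlink⟩ := n.exists_link none hg hbad
  exact ⟨n', hlink, hn'.trans ht⟩

theorem exists_saturated {next : Node γ X → Node γ X}
    (hnext : ∀ n : Node γ X, ¬ Saturated γ X n.seq →
      measure γ X (next n).seq < measure γ X n.seq) (n : Node γ X) :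
    ∃ k, Saturated γ X (next^[k] n).seq := by
  induction hm : measure γ X n.seq using Nat.strong_induction_on generalizing n with
  | _ m ih =>
    subst hm
    by_cases hn : Saturated γ X n.seq
    · exact ⟨0, hn⟩
    · obtain ⟨k, hk⟩ := ih _ (hnext n hn) (next n) rfl
      exact ⟨k + 1, hk⟩

/-- The formulas of a node in a list. -/
def toList (n : Node γ X) : List (NFormula Var Atom Act) := n.good.finite.toFinset.toList

theorem mem_toList (n : Node γ X) {p : NFormula Var Atom Act} :
    p ∈ n.toList ↔ p ∈ n.seq.fmls := by
  simp [toList]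

/-- The node reached by the modal rule for the formula number `i`. -/
def child (n : Node γ X) (i : ℕ) : Node γ X :=
  if h : ∃ n' : Node γ X, ∃ a ψ u, n.toList[i]? = some (box a ψ, u) ∧ Link n none n' ∧
    n'.seq = modalChild n.seq a (ψ, u) then h.choose else n

theorem child_spec (H : Admissible γ X) (n : Node γ X) (hn : Saturated γ X n.seq) {i : ℕ} {a : Act}
    {ψ : Formula Var Atom Act} {u : List (Name Var)} (hi : n.toList[i]? = some (box a ψ, u)) :
    Link n none (n.child i) ∧ (n.child i).seq = modalChild n.seq a (ψ, u) := by
  have h : ∃ n' : Node γ X, ∃ a ψ u, n.toList[i]? = some (box a ψ, u) ∧ Link n none n' ∧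
      n'.seq = modalChild n.seq a (ψ, u) := by
    obtain ⟨n', h⟩ := n.exists_modal_link H hn.1 (n.mem_toList.1 (List.mem_of_getElem? hi))
    exact ⟨n', a, ψ, u, hi, h⟩
  unfold child
  rw [dif_pos h]
  obtain ⟨a', ψ', u', hi', h'⟩ := h.choose_spec
  rw [hi] at hi'
  cases hi'
  exact h'

end Node

/-! ### The countermodel -/

/-- The saturated node reached by a list of choices of modal formulas, the last choice first. -/
def nodeAt (sat : Node γ X → Node γ X) (root : Node γ X) : List ℕ → Node γ X
  | [] => sat root
  | i :: l => sat ((nodeAt sat root l).child i)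

/-- The model whose states are the choices of modal formulas. -/
def counterModel (sat : Node γ X → Node γ X) (root : Node γ X) :
    Model Atom Act (ULift.{u} (List ℕ)) where
  trans a x y := ∃ i ψ v, y.down = i :: x.down ∧
    (nodeAt sat root x.down).toList[i]? = some (box a ψ, v)
  -- This makes every literal of the node false at its state; there is no conflict, since the
  -- sequent is not an axiom.
  val P := {x | ∃ v, (natom P, v) ∈ (nodeAt sat root x.down).seq.fmls}

namespace Admissible

/-- A true formula of a saturated node leads to a true formula of one of the nodes reached by a
modal rule. -/
theorem exists_modal_runStep (H : Admissible γ X) {sat : Node γ X → Node γ X} {root : Node γ X}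
    {l : List ℕ} (hsat : Saturated γ X (nodeAt sat root l).seq) {c : Config.{u} Var Atom Act}
    (hc : c.TrueAt γ X (counterModel sat root) ⟨l⟩)
    (hmem : c.toNFormula γ X ∈ (nodeAt sat root l).seq.fmls) :
    ∃ i c', c'.TrueAt γ X (counterModel.{u} sat root) ⟨i :: l⟩ ∧
      c'.toNFormula γ X ∈ ((nodeAt sat root l).child i).seq.fmls ∧
      RunStep (nodeAt sat root l) ((nodeAt sat root l).child i) c c' none := by
  obtain ⟨f, u, σ⟩ := c
  obtain ⟨hsub, htop, hx⟩ := hc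
  simp only at hsub htop hx
  set n := nodeAt sat root l with hn
  have hmem : (expand γ X f, u) ∈ n.seq.fmls := hmem
  have hd : (expand γ X f).depth = 0 := hsat.2 _ hmem
  have modal : ∀ {i : ℕ} {a : Act} {ψ : Formula Var Atom Act} {v : List (Name Var)}
      {g : Formula Var Atom Act}, n.toList[i]? = some (box a ψ, v) → g ∈ f.subformulas →
      g.length < f.length → (⟨i :: l⟩ : ULift.{u} (List ℕ)) ∈
        sem (counterModel sat root) (env (counterModel sat root) γ X σ) g →
      (expand γ X g, u) ∈ (modalChild n.seq a (ψ, v)).fmls →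
      ∃ i c', c'.TrueAt γ X (counterModel.{u} sat root) ⟨i :: l⟩ ∧
        c'.toNFormula γ X ∈ (n.child i).seq.fmls ∧ RunStep n (n.child i) ⟨f, u, σ⟩ c' none := by
    intro i a ψ v g hi hg hlt hx hgm
    obtain ⟨hlink, hseq⟩ := n.child_spec H hsat hi
    refine ⟨i, ⟨g, u, σ⟩, ⟨subformulas_trans hsub hg, htop, hx⟩, ?_, hlink, ?_,
      Or.inl ⟨⟨hg, rfl, Or.inl rfl⟩, Or.inl hlt⟩⟩
    · rw [hseq]
      exact hgm
    · rw [hseq]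
      exact namesStep_keep _ _
  cases f with
  | var Y =>
    have e : expand γ X (var Y) = expandVar γ X Y := rfl
    -- A variable expands to a fixpoint formula, which has positive depth and cannot occur in a
    -- saturated sequent.
    rw [e, H.expandVar_eq (H.var_mem_order hsub)] at hd
    exact absurd hd (Nat.succ_ne_zero _)
  | and _ _ | or _ _ | fix _ _ _ => exact absurd hd (Nat.succ_ne_zero _)
  | atom P =>
    obtain ⟨v, hv⟩ := hx
    exact (n.not_isAxiomatic (Or.inl ⟨P, u, v, hmem, hv⟩)).elim
  | natom P => exact (hx ⟨u, hmem⟩).elim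
  | tt => exact (n.not_isAxiomatic (Or.inr ⟨u, hmem⟩)).elim
  | ff => exact hx.elim
  | box a g =>
    -- A true box formula is followed to the successor created for that very formula.
    obtain ⟨i, hi⟩ := List.mem_iff_getElem?.1 (n.mem_toList.2 hmem)
    exact modal hi (Or.inr (self_mem_subformulas _)) (Nat.lt_succ_self _)
      (hx ⟨i :: l⟩ ⟨i, _, _, rfl, hi⟩) (Or.inr rfl)
  | dia a g =>
    -- The witnessing successor was created for some box formula with the same action, and its modal
    -- child contains the bodies of all diamond formulas for that action.
    obtain ⟨⟨_⟩, ⟨i, ψ, v, rfl, hi⟩, hx⟩ := hx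
    exact modal hi (Or.inr (self_mem_subformulas _)) (Nat.lt_succ_self _) hx (Or.inl hmem)

/-- The formulas of a node without a proof tree are false at its state in the countermodel. -/
theorem exists_counterModel (H : Admissible γ X) (root : Node γ X)
    (hroot : root.seq = initial γ) :
    ∃ (S : Type u) (T : Model Atom Act S) (x : S),
      x ∉ sem T (env T γ X fun _ => (⊤ : Stage.{u})) γ := by
  have hex : ∀ n : Node γ X, ∃ (n' : Node γ X) (r : Option (Name Var)),
      (Saturated γ X n.seq → n' = n) ∧
      (¬ Saturated γ X n.seq → Link n r n' ∧ LocalStep.{u} γ X n.seq r n'.seq) := by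
    intro n
    by_cases hn : Saturated γ X n.seq
    · exact ⟨n, none, fun _ => rfl, fun h => (h hn).elim⟩
    · obtain ⟨n', r, h⟩ := n.exists_localStep.{u} H hn
      exact ⟨n', r, fun h => (hn h).elim, fun _ => h⟩
  choose next ρ hnext_sat hnext using hex
  choose k hk using Node.exists_saturated fun n hn => (hnext n hn).2.measure_lt
  set sat : Node γ X → Node γ X := fun n => next^[k n] n with hsat
  have hnode : ∀ l, Saturated γ X (nodeAt sat root l).seq := by
    intro l
    cases l with
    | nil => exact hk _
    | cons i l => exact hk _
  refine ⟨_, counterModel.{u} sat root, ⟨[]⟩, fun htrue => ?_⟩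
  -- Between saturated nodes the state does not change: the current node leads by `next` to the node
  -- of the state at which the traced formula is true.
  let P : Node γ X × List ℕ × Config.{u} Var Atom Act → Prop := fun x =>
    (∃ m, next^[m] x.1 = nodeAt sat root x.2.1) ∧
      x.2.2.TrueAt γ X (counterModel.{u} sat root) ⟨x.2.1⟩ ∧
      x.2.2.toNFormula γ X ∈ x.1.seq.fmls
  have hstep : ∀ x : Subtype P, ∃ y : Subtype P, ∃ r,
      RunStep x.1.1 y.1.1 x.1.2.2 y.1.2.2 r := by
    rintro ⟨⟨n, l, c⟩, ⟨m, hm⟩, hc, hmem⟩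
    simp only at hm hc hmem
    by_cases hn : Saturated γ X n.seq
    · rw [Function.iterate_fixed (hnext_sat n hn)] at hm
      subst hm
      obtain ⟨i, c', hc', hmem', hrun⟩ := H.exists_modal_runStep hn hc hmem
      exact ⟨⟨(_, i :: l, c'), ⟨_, rfl⟩, hc', hmem'⟩, none, hrun⟩
    · obtain ⟨hlink, hloc⟩ := hnext n hn
      obtain ⟨c', hc', hmem', htr⟩ := hloc.trace _ _ _ c hc hmem
      cases m with
      | zero =>
        rw [Function.iterate_zero, id] at hm
        rw [hm] at hn
        exact (hn (hnode l)).elim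
      | succ m =>
        exact ⟨⟨(next n, l, c'), ⟨m, hm⟩, hc', hmem'⟩, ρ n, hlink, hloc.names,
          htr.imp_left fun h => ⟨h, Or.inr hloc.measure_lt⟩⟩
  choose F r hF using hstep
  let x₀ : Subtype P := ⟨(root, [], ⟨γ, [], fun _ => ⊤⟩), ⟨_, rfl⟩,
    ⟨self_mem_subformulas γ, fun _ _ => rfl, htrue⟩, by
      rw [hroot]
      exact Prod.ext H.expand_self rfl⟩
  refine H.no_infinite_run (n := fun i => (F^[i] x₀).1.1) (c := fun i => (F^[i] x₀).1.2.2)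
    (r := fun i => r (F^[i] x₀)) (fun i => (F^[i] x₀).2.2.2) fun i => ?_
  simp only [Function.iterate_succ_apply']
  exact hF _

theorem hasProofTree_of_valid (H : Admissible γ X) (h : Formula.Valid.{u} γ) :
    HasProofTree γ X := by
  by_contra hno
  obtain ⟨S, T, x, hx⟩ := H.exists_counterModel.{u} ⟨[], initial γ, Good.of_initial H, hno,
    by simp [IsRepeat], by simp⟩ rfl
  exact hx (h S T _ ▸ Set.mem_univ x)

end Admissible

end
end MuCalc

theorem mainTheorem1 {Var Atom Act : Type*}
    (γ : MuCalc.Formula Var Atom Act) (hpnf : γ.PositiveNormal) (hclosed : γ.Closed)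
    (hguarded : γ.Guarded) (X : List Var) (hX : MuCalc.IsVarOrder γ X) :
    MuCalc.Formula.Valid.{u} γ ↔ MuCalc.HasProofTree γ X := by
  have H : MuCalc.Admissible γ X := ⟨hpnf, hclosed, hguarded, hX⟩
  exact ⟨H.hasProofTree_of_valid, H.valid_of_hasProofTree⟩
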